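/- **Setting.** Wright's equation is $y'(t)=-\alpha\,y(t-1)\,[1+y(t)]$, $t\in\mathbb R$. A *slowly oscillating periodic solution* (SOPS) is a solution $y:\mathbb R\to\mathbb R$ for which there are $\tau\in\mathbb R$ and $t_-,t_+>1$ such that $y(\tau+t)>0$ for $t\in(0,t_+)$, $y(\tau+t)<0$ for $t\in(-t_-,0)$ and $y(t+L)=y(t)$ for all $t$, where $L=t_-+t_+$ (so $L$ is the minimal period). Its frequency is $\omega=2\pi/L$. For complex sequences $a=\{a_k\}_{k\ge1}$ put $\|a\|=2\sum_{k\ge 1}|a_k|$, and let $\ell^1$ be the space of sequences with $\|a\|<\infty$. Let $(\mathrm e_j)_k=\delta_{jk}$, $(K^{-1}a)_k=k a_k$, $(U_\omega a)_k=e^{-ik\omega}a_k$, $(\sigma^+a)_k=a_{k-1}$ (with $a_0=0$), $(\sigma^-a)_k=a_{k+1}$, $L_\omega=\sigma^+(e^{-i\omega}I+U_\omega)+\sigma^-(e^{i\omega}I+U_\omega)$, and $[a*b]_k=\sum_{k_1+k_2=k}a_{k_1}b_{k_2}$ over $k_1,k_2\in\mathbb Z$ with the conventions $a_0=0$, $a_{-k}=\overline{a_k}$.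 For $c\in\ell^1$ with $c_1=0$ and $\|K^{-1}c\|<\infty$ define $$F_\epsilon(\alpha,\omega,c)=[i\omega+\alpha e^{-i\omega}]\mathrm e_1+(i\omega K^{-1}+\alpha U_\omega)c+\epsilon\alpha e^{-i\omega}\mathrm e_2+\alpha\epsilon L_\omega c+\alpha\epsilon\,[U_\omega c]*c .$$ Let $\bar\alpha_\epsilon=\frac\pi2+\frac{\epsilon^2}5(\frac{3\pi}2-1)$, $\bar\omega_\epsilon=\frac\pi2-\frac{\epsilon^2}5$, $\bar c_\epsilon=\frac{2-i}5\,\epsilon\,\mathrm e_2$. **Theorem.** For every $0<\epsilon\le 0.1$ there is exactly one triple $(\hat\alpha_\epsilon,\hat\omega_\epsilon,\hat c_\epsilon)\in\mathbb R\times\mathbb R\times\ell^1$ with $(\hat c_\epsilon)_1=0$, $F_\epsilon(\hat\alpha_\epsilon,\hat\omega_\epsilon,\hat c_\epsilon)=0$ and $$|\hat\alpha_\epsilon-\bar\alpha_\epsilon|<0.0594\,\epsilon^2,\quad |\hat\omega_\epsilon-\bar\omega_\epsilon|<0.0260\,\epsilon^2,\quad \|\hat c_\epsilon-\bar c_\epsilon\|<0.4929\,\epsilon^2,\quad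 \|K^{-1}\hat c_\epsilon\|<0.3191 .$$ The function $$\hat y_\epsilon(t)=\epsilon\,(e^{i\hat\omega_\epsilon t}+e^{-i\hat\omega_\epsilon t})+\epsilon\sum_{k\ge2}\big((\hat c_\epsilon)_k e^{i\hat\omega_\epsilon kt}+\overline{(\hat c_\epsilon)_k}\,e^{-i\hat\omega_\epsilon kt}\big)$$ is a SOPS of Wright's equation with $\alpha=\hat\alpha_\epsilon$, of frequency $\hat\omega_\epsilon$, and $(\hat\alpha_\epsilon,\hat\omega_\epsilon,\hat c_\epsilon)\to(\frac\pi2,\frac\pi2,0)$ as $\epsilon\downarrow0$ (this is the branch that originates from the Hopf bifurcation at $\alpha=\frac\pi2$). The map $\epsilon\mapsto(\hat\alpha_\epsilon,\hat\omega_\epsilon,\hat c_\epsilon)\in\mathbb R^2\times\ell^1$ is continuously differentiable on $(0,0.1]$, and $$\frac{d}{d\epsilon}\hat\alpha_\epsilon>0\qquad\text{for all }0<\epsilon\le0.1$$ (one-sided at $\epsilon=0.1$). For every $\alpha$ with $\frac\pi2<\alpha\le\frac\pi2+6.830\times10^{-3}$ there is exactly one $\epsilon\in(0,0.1]$ with $\hat\alpha_\epsilon=\alpha$,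 and the branch has no bifurcation (neither a fold nor a secondary bifurcation) at the corresponding $\hat y_\epsilon$, in the following sense. Write $(\alpha_0,\omega_0,y_0)=(\hat\alpha_\epsilon,\hat\omega_\epsilon,\hat y_\epsilon)$. There are $\eta,\delta>0$ and $C^1$ maps $\alpha\mapsto\omega(\alpha)\in\mathbb R$, $\alpha\mapsto a(\alpha)\in\ell^1$ on $(\alpha_0-\eta,\alpha_0+\eta)$ such that $y_\alpha(t)=\sum_{k\ge1}\big(a(\alpha)_ke^{i\omega(\alpha)kt}+\overline{a(\alpha)_k}e^{-i\omega(\alpha)kt}\big)$ is a SOPS of Wright's equation with parameter $\alpha$, of frequency $\omega(\alpha)$, for each such $\alpha$; $\omega(\alpha_0)=\omega_0$ and $y_{\alpha_0}=y_0$; and every solution $y$ of Wright's equation with parameter $\alpha\in(\alpha_0-\eta,\alpha_0+\eta)$ that is periodic with period $2\pi/\omega$, $\omega>0$, and satisfies $|\omega-\omega_0|<\delta$ and $\sup_{s}|y(s/\omega)-y_0(s/\omega_0)|<\delta$ has $\omega=\omega(\alpha)$ and is a time translate of $y_\alpha$. -/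

import Mathlib

open Set Filter Topology

noncomputable section

/-- Absolutely summable complex sequences indexed by `ℕ`. The entry of index `k ≥ 1` is the
coefficient of `exp (i ω k t)`. The entry of index `0` is required to vanish wherever it could
matter. -/
abbrev L1 : Type := lp (fun _ : ℕ => ℂ) 1

/-- The norm `2 ∑_{k ≥ 1} |a_k|`. -/
def seqNorm (a : ℕ → ℂ) : ℝ := 2 * ∑' k : ℕ, ‖a (k + 1)‖

/-- The basis element `e_j`. -/
def basisSeq (j : ℕ) : ℕ → ℂ := fun k => if k = j then 1 else 0

/-- The diagonal operator `(K⁻¹ a)_k = k a_k`. -/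
def invK (a : ℕ → ℂ) : ℕ → ℂ := fun k => (k : ℂ) * a k

/-- The diagonal operator `(U_ω a)_k = exp (-i k ω) a_k`. -/
def opU (ω : ℝ) (a : ℕ → ℂ) : ℕ → ℂ :=
  fun k => Complex.exp (-Complex.I * (k : ℂ) * (ω : ℂ)) * a k

/-- The shift `(σ⁺ a)_k = a_{k-1}`, where `a_0 = 0` by convention. -/
def shiftUp (a : ℕ → ℂ) : ℕ → ℂ := fun k => if 2 ≤ k then a (k - 1) else 0

/-- The shift `(σ⁻ a)_k = a_{k+1}`. -/
def shiftDown (a : ℕ → ℂ) : ℕ → ℂ := fun k => a (k + 1)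

/-- The operator `L_ω = σ⁺ (exp (-i ω) I + U_ω) + σ⁻ (exp (i ω) I + U_ω)`. -/
def opL (ω : ℝ) (a : ℕ → ℂ) : ℕ → ℂ := fun k =>
  shiftUp (fun j => Complex.exp (-Complex.I * (ω : ℂ)) * a j + opU ω a j) k +
    shiftDown (fun j => Complex.exp (Complex.I * (ω : ℂ)) * a j + opU ω a j) k

/-- The symmetric extension of a one-sided sequence to `ℤ`: `a_0 = 0` and `a_{-k} = conj a_k`. -/
def symExt (a : ℕ → ℂ) : ℤ → ℂ := fun k =>
  if 0 < k then a k.natAbs else if k < 0 then (starRingEnd ℂ) (a k.natAbs) else 0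

/-- The discrete convolution `(a * b)_k = ∑_{k₁ + k₂ = k} a_{k₁} b_{k₂}` over `k₁, k₂ ∈ ℤ`,
of the symmetric extensions of two one-sided sequences. -/
def seqConv (a b : ℕ → ℂ) : ℕ → ℂ := fun k => ∑' j : ℤ, symExt a j * symExt b ((k : ℤ) - j)

/-- The map `F_ε (α, ω, c)`. Only its entries of index `k ≥ 1` are relevant. -/
def mapF (ε α ω : ℝ) (c : ℕ → ℂ) : ℕ → ℂ := fun k =>
  (Complex.I * (ω : ℂ) + (α : ℂ) * Complex.exp (-Complex.I * (ω : ℂ))) * basisSeq 1 k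
    + (Complex.I * (ω : ℂ) * invK c k + (α : ℂ) * opU ω c k)
    + (ε : ℂ) * (α : ℂ) * Complex.exp (-Complex.I * (ω : ℂ)) * basisSeq 2 k
    + (α : ℂ) * (ε : ℂ) * opL ω c k
    + (α : ℂ) * (ε : ℂ) * seqConv (opU ω c) c k

/-- The approximate parameter value `π/2 + (ε²/5)(3π/2 - 1)`. -/
def approxAlpha (ε : ℝ) : ℝ := Real.pi / 2 + ε ^ 2 / 5 * (3 * Real.pi / 2 - 1)

/-- The approximate frequency `π/2 - ε²/5`. -/
def approxOmega (ε : ℝ) : ℝ := Real.pi / 2 - ε ^ 2 / 5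

/-- The approximate rescaled Fourier coefficients `((2 - i)/5) ε e_2`. -/
def approxC (ε : ℝ) : ℕ → ℂ := fun k => (2 - Complex.I) / 5 * (ε : ℂ) * basisSeq 2 k

/-- `(α, ω, c)` is a zero of `F_ε`, with `c` summable, `c_1 = 0` and `K⁻¹ c` summable, that lies
in the prescribed small neighbourhood of the approximate solution. -/
structure IsHopfZero (ε α ω : ℝ) (c : L1) : Prop where
  coeff_zero : c 0 = 0
  coeff_one : c 1 = 0
  summable_invK : Summable fun k : ℕ => ‖invK c k‖
  zero : ∀ k : ℕ, 1 ≤ k → mapF ε α ω c k = 0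
  alpha_near : |α - approxAlpha ε| < 0.0594 * ε ^ 2
  omega_near : |ω - approxOmega ε| < 0.0260 * ε ^ 2
  c_near : seqNorm (fun k => c k - approxC ε k) < 0.4929 * ε ^ 2
  invK_bound : seqNorm (invK c) < 0.3191

/-- The real function `∑_{k ≥ 1} (a_k exp (i ω k t) + conj a_k exp (-i ω k t))`. -/
def fourierFun (ω : ℝ) (a : ℕ → ℂ) (t : ℝ) : ℝ :=
  2 * ∑' k : ℕ, (a (k + 1) * Complex.exp (Complex.I * (ω : ℂ) * ((k : ℂ) + 1) * (t : ℂ))).re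

/-- The function `ε (e^{iωt} + e^{-iωt}) + ε ∑_{k ≥ 2} (c_k e^{iωkt} + conj c_k e^{-iωkt})`
(for `c_1 = 0`). -/
def hopfFun (ε ω : ℝ) (c : ℕ → ℂ) : ℝ → ℝ :=
  fourierFun ω (fun k => (ε : ℂ) * (basisSeq 1 k + c k))

/-- `y` solves the delay equation `y'(t) = -α y(t - 1) (1 + y(t))` on the whole line. -/
def SolvesWright (α : ℝ) (y : ℝ → ℝ) : Prop :=
  ∀ t : ℝ, HasDerivAt y (-α * y (t - 1) * (1 + y t)) t

/-- `y` is a solution of the equation with parameter `α` that has period `2π/ω`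
(not necessarily minimal). -/
def IsPeriodicWright (α ω : ℝ) (y : ℝ → ℝ) : Prop :=
  0 < ω ∧ SolvesWright α y ∧ ∀ t : ℝ, y (t + 2 * Real.pi / ω) = y t

/-- `y` is a slowly oscillating periodic solution of the equation with parameter `α`, with
minimal period `2π/ω`: up to a time translation by `τ` it is positive on `(0, t₊)`, negative
on `(-t₋, 0)`, and periodic with period `t₋ + t₊`, where `t₋, t₊ > 1`. -/
def IsSOPS (α ω : ℝ) (y : ℝ → ℝ) : Prop :=
  0 < ω ∧ SolvesWright α y ∧
    ∃ τ tm tp : ℝ, 1 < tm ∧ 1 < tp ∧ tm + tp = 2 * Real.pi / ω ∧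
      (∀ t ∈ Ioo 0 tp, 0 < y (t + τ)) ∧
      (∀ t ∈ Ioo (-tm) 0, y (t + τ) < 0) ∧
      ∀ t : ℝ, y (t + (tm + tp)) = y t

/-- The solution `y₀` (parameter `α₀`, frequency `ω₀`) is not a bifurcation point:
near `(α₀, ω₀, y₀)` the periodic solutions form, up to time translation, a `C¹` graph over the
parameter `α` (in a two-sided neighbourhood of `α₀`), and this graph consists of slowly
oscillating periodic solutions. Solutions with different frequencies are compared after
rescaling time so that the period is `2π`. At a fold, or at a point where another family of
solutions branches off, this fails. -/
def NoBifurcationAt (α₀ ω₀ : ℝ) (y₀ : ℝ → ℝ) : Prop :=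
  ∃ η > 0, ∃ (W : ℝ → ℝ) (a : ℝ → L1),
    ContDiffOn ℝ 1 W (Ioo (α₀ - η) (α₀ + η)) ∧
    ContDiffOn ℝ 1 a (Ioo (α₀ - η) (α₀ + η)) ∧
    W α₀ = ω₀ ∧ fourierFun (W α₀) (a α₀) = y₀ ∧
    (∀ α ∈ Ioo (α₀ - η) (α₀ + η), IsSOPS α (W α) (fourierFun (W α) (a α))) ∧
    ∃ δ > 0, ∀ α ∈ Ioo (α₀ - η) (α₀ + η), ∀ (ω : ℝ) (y : ℝ → ℝ),
      IsPeriodicWright α ω y → |ω - ω₀| < δ →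
      (∀ s : ℝ, |y (s / ω) - y₀ (s / ω₀)| < δ) →
      ω = W α ∧ ∃ τ : ℝ, ∀ t : ℝ, y t = fourierFun (W α) (a α) (t + τ)

end

/-! ### The space `ℓ¹` and its bounded operators -/

noncomputable section

/-! Put `c = ε K v`, `ω = π/2 + θ`, `λ = ω/α` and divide `F = 0` by `α`. The first mode becomes `iλ
+ e^{-iω} + ε² R₁ = 0`, that is, `sin θ = ε² Re R₁` and `λ = cos θ - ε² Im R₁`. A mode `k ≥ 2`
becomes `(ikλ + e^{-ikω}) v_k / k + e^{-iω} δ_{k2} + ε R_k = 0`. At `θ = 0`, `λ = 1` the factor `ik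
+ e^{-ikω}` vanishes for `k = 1` (the Hopf bifurcation) and for no `k ≥ 2`. Inverting it on the
modes `k ≥ 2` gives a fixed point problem that is regular at `ε = 0` and a contraction of one box
for all `|ε| ≤ 0.11` (`fixMap_mem_interior`, `fixMap_lipschitz`). The unknown is `v` and not `c`,
because `U_ω` depends on `ω` only strongly continuously, whereas `(ω, v) ↦ U_ω K v` is `C¹`
(`contDiff_phaseK`). Hence the branch is `C¹` by the implicit function theorem
(`contDiffAt_branch`).

The box is much larger than the neighbourhood of the theorem. The moduli of the modes of a zero
satisfy a closed system of scalar inequalities (`ReducedZero.scalarIneq`); iterating it from the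
crude bounds of the box yields the sharp ones (`ReducedZero.zeroBounds`). Conversely a zero in the
neighbourhood of the theorem lies in the box, so it is the fixed point (`isHopfZero_unique`).

Along the branch `R₁` tends to `(-1 + 3i)/5`, so `α = ω/λ` grows like `π/2 + (3π/10 - 1/5) ε²`. Its
derivative is `2ε` times a number near `0.74`, up to an error of size `ε² |R₁'|`. The Lipschitz
estimate `|R₁'| ≤ 6.5` (`norm_deriv_sigmaB_le`) is just strong enough to keep the sign up to `ε =
0.1` (`deriv_alphaB_pos`).

A zero of `F` kills all nonzero Fourier modes of the residual of Wright's equation. The mean mode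
also vanishes, because the residual divided by `1 + y` is the derivative of a periodic function
(`fSeries_solves`). The solution is `2ε` times a `C¹`-small perturbation of the cosine, which gives
the sign pattern (`IsHopfZero.isSOPS`).

For the absence of bifurcations, a periodic solution that is uniformly close to one on the branch
must be shown to satisfy the bounds of the uniqueness statement, although these involve `∑ k |a_k|`.
The equation bounds three derivatives, so the Fourier coefficients decay like `k⁻³`; together with
uniform closeness this makes `∑ k |a_k - b_k|` small. A time translation makes the first coefficient
positive, and its value is the amplitude (`exists_nearby_branch`). As `α` is a strictly increasing
function of the amplitude with nonzero derivative, the branch is locally a graph over `α`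
(`noBifurcationAt_branch`). -/

theorem l1_norm_eq (a : L1) : ‖a‖ = ∑' k, ‖a k‖ := by
  rw [lp.norm_eq_tsum_rpow (by simp)]
  simp

theorem l1_summable (a : L1) : Summable fun k => ‖a k‖ := by
  simpa using (lp.memℓp a).summable (by simp)

/-- The element of `ℓ¹` with prescribed entries. -/
def l1Mk (f : ℕ → ℂ) (h : Summable fun k => ‖f k‖) : L1 :=
  ⟨f, memℓp_gen (by simpa using h)⟩

@[simp] theorem l1Mk_apply (f : ℕ → ℂ) (h : Summable fun k => ‖f k‖) (k : ℕ) :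
    l1Mk f h k = f k := rfl

theorem l1_norm_apply_le (a : L1) (k : ℕ) : ‖a k‖ ≤ ‖a‖ :=
  lp.norm_apply_le_norm one_ne_zero a k

@[simp] theorem l1_add_apply (a b : L1) (k : ℕ) : (a + b) k = a k + b k := rfl
@[simp] theorem l1_sub_apply (a b : L1) (k : ℕ) : (a - b) k = a k - b k := rfl
@[simp] theorem l1_neg_apply (a : L1) (k : ℕ) : (-a) k = -a k := rfl
@[simp] theorem l1_zero_apply (k : ℕ) : (0 : L1) k = 0 := rfl
@[simp] theorem l1_smul_apply (c : ℂ) (a : L1) (k : ℕ) : (c • a) k = c * a k := rfl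
@[simp] theorem l1_real_smul_apply (c : ℝ) (a : L1) (k : ℕ) : (c • a) k = (c : ℂ) * a k := by
  change c • a k = _
  simp

theorem l1_ext {a b : L1} (h : ∀ k, a k = b k) : a = b := by
  ext k; exact h k

theorem l1_norm_le_of_apply_le {a : L1} {f : ℕ → ℝ} (hf : Summable f) (h : ∀ k, ‖a k‖ ≤ f k) :
    ‖a‖ ≤ ∑' k, f k := by
  rw [l1_norm_eq]; exact (l1_summable a).tsum_le_tsum h hf

/-- A linear map of sequences that is bounded for the `ℓ¹`-norm, as an operator on `ℓ¹`. -/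
def l1Op (F : (ℕ → ℂ) →ₗ[ℝ] (ℕ → ℂ)) (C : ℝ)
    (hs : ∀ a : L1, Summable fun k => ‖F a k‖) (hC : ∀ a : L1, ∑' k, ‖F a k‖ ≤ C * ‖a‖) :
    L1 →L[ℝ] L1 :=
  LinearMap.mkContinuous
    { toFun := fun a => l1Mk (F a) (hs a)
      map_add' := fun a b => l1_ext fun k => by
        have : ((a + b : L1) : ℕ → ℂ) = (a : ℕ → ℂ) + (b : ℕ → ℂ) := rfl
        simp [this]
      map_smul' := fun r a => l1_ext fun k => by
        have : ((r • a : L1) : ℕ → ℂ) = r • (a : ℕ → ℂ) := rfl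
        simp [this] } C
    (fun a => by
      rw [l1_norm_eq]
      exact hC a)

theorem norm_l1Op_le (F : (ℕ → ℂ) →ₗ[ℝ] (ℕ → ℂ)) (C : ℝ) (hs) (hC) (a : L1) :
    ‖l1Op F C hs hC a‖ ≤ C * ‖a‖ := by
  rw [l1_norm_eq]
  exact hC a

/-- The diagonal operator with bounded entries `m`. -/
def diag (m : ℕ → ℂ) (C : ℝ) (hm : ∀ k, ‖m k‖ ≤ C) : L1 →L[ℝ] L1 :=
  l1Op
    { toFun := fun a k => m k * a k
      map_add' := fun a b => by ext k; simp [mul_add]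
      map_smul' := fun r a => by ext k; simp; ring } C
    (fun a => by
      refine Summable.of_nonneg_of_le (fun _ => norm_nonneg _) (fun k => ?_)
        ((l1_summable a).mul_left C)
      simpa using mul_le_mul_of_nonneg_right (hm k) (norm_nonneg (a k)))
    (fun a => by
      rw [l1_norm_eq, ← tsum_mul_left]
      have h : ∀ k, ‖m k * a k‖ ≤ C * ‖a k‖ := fun k => by
        simpa using mul_le_mul_of_nonneg_right (hm k) (norm_nonneg (a k))
      exact (Summable.of_nonneg_of_le (fun _ => norm_nonneg _) h
        ((l1_summable a).mul_left C)).tsum_le_tsum h ((l1_summable a).mul_left C))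

@[simp] theorem diag_apply (m : ℕ → ℂ) (C : ℝ) (hm) (a : L1) (k : ℕ) :
    diag m C hm a k = m k * a k := rfl

theorem norm_diag_sub_le {m m' : ℕ → ℂ} {C C' D : ℝ} (hm hm') (h : ∀ k, ‖m k - m' k‖ ≤ D)
    (a : L1) : ‖diag m C hm a - diag m' C' hm' a‖ ≤ D * ‖a‖ := by
  rw [l1_norm_eq a, ← tsum_mul_left]
  refine l1_norm_le_of_apply_le ((l1_summable a).mul_left D) fun k => ?_
  simp only [l1_sub_apply, diag_apply, ← sub_mul, norm_mul]
  exact mul_le_mul_of_nonneg_right (h k) (norm_nonneg _)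

theorem norm_diag_le {m : ℕ → ℂ} {C D : ℝ} (hm) (h : ∀ k, ‖m k‖ ≤ D) (a : L1) :
    ‖diag m C hm a‖ ≤ D * ‖a‖ := by
  rw [l1_norm_eq a, ← tsum_mul_left]
  refine l1_norm_le_of_apply_le ((l1_summable a).mul_left D) fun k => ?_
  simp only [diag_apply, norm_mul]
  exact mul_le_mul_of_nonneg_right (h k) (norm_nonneg _)

theorem norm_diag_le' {m : ℕ → ℂ} {C : ℝ} (hm) (a : L1) : ‖diag m C hm a‖ ≤ C * ‖a‖ :=
  norm_diag_le hm hm a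

/-- Pointwise convergence of uniformly bounded diagonals is strong convergence. -/
theorem tendsto_diag {ι : Type*} {l : Filter ι} {m : ι → ℕ → ℂ} {m₀ : ℕ → ℂ} {C : ℝ}
    (hm : ∀ i k, ‖m i k‖ ≤ C) (hm₀ : ∀ k, ‖m₀ k‖ ≤ C)
    (h : ∀ k, Tendsto (fun i => m i k) l (𝓝 (m₀ k))) (a : L1) :
    Tendsto (fun i => diag (m i) C (hm i) a) l (𝓝 (diag m₀ C hm₀ a)) := by
  rw [tendsto_iff_norm_sub_tendsto_zero]
  have h0 : (0 : ℝ) = ∑' _ : ℕ, (0 : ℝ) := by simp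
  simp only [l1_norm_eq]
  rw [h0]
  refine tendsto_tsum_of_dominated_convergence (bound := fun k => 2 * C * ‖a k‖)
    ((l1_summable a).mul_left _) (fun k => ?_) (Eventually.of_forall fun i k => ?_)
  · have := (((h k).sub_const (m₀ k)).mul_const (a k)).norm
    simpa [sub_mul] using this
  · simp only [l1_sub_apply, diag_apply, ← sub_mul, norm_mul, norm_norm]
    refine mul_le_mul_of_nonneg_right ?_ (norm_nonneg _)
    linarith [norm_sub_le (m i k) (m₀ k), hm i k, hm₀ k]

/-- The shift `σ⁺` (for sequences with vanishing entry of index `0`). -/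
def shiftUpL : L1 →L[ℝ] L1 :=
  l1Op
    { toFun := shiftUp
      map_add' := fun a b => by ext k; by_cases h : 2 ≤ k <;> simp [shiftUp, h]
      map_smul' := fun r a => by ext k; by_cases h : 2 ≤ k <;> simp [shiftUp, h] } 1
    (fun a => by
      rw [← summable_nat_add_iff 2]
      simpa [shiftUp] using (summable_nat_add_iff 1).2 (l1_summable a))
    (fun a => by
      have hs : Summable fun k => ‖shiftUp a k‖ := by
        rw [← summable_nat_add_iff 2]
        simpa [shiftUp] using (summable_nat_add_iff 1).2 (l1_summable a)
      have h2 := hs.sum_add_tsum_nat_add 2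
      have h1 := (l1_summable a).sum_add_tsum_nat_add 1
      simp [shiftUp, Finset.sum_range_succ] at h1 h2 ⊢
      rw [l1_norm_eq, ← h2]
      linarith [norm_nonneg (a 0)])

@[simp] theorem shiftUpL_apply (a : L1) (k : ℕ) : shiftUpL a k = shiftUp a k := rfl

/-- The shift `σ⁻`. -/
def shiftDownL : L1 →L[ℝ] L1 :=
  l1Op
    { toFun := shiftDown
      map_add' := fun a b => by ext k; simp [shiftDown]
      map_smul' := fun r a => by ext k; simp [shiftDown] } 1
    (fun a => (summable_nat_add_iff 1).2 (l1_summable a))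
    (fun a => by
      have h1 := (l1_summable a).sum_add_tsum_nat_add 1
      simp only [Finset.range_one, Finset.sum_singleton] at h1
      simp [shiftDown]
      rw [l1_norm_eq, ← h1]
      linarith [norm_nonneg (a 0)])

@[simp] theorem shiftDownL_apply (a : L1) (k : ℕ) : shiftDownL a k = shiftDown a k := rfl

theorem norm_shiftUpL_le (a : L1) : ‖shiftUpL a‖ ≤ ‖a‖ := by
  exact (norm_l1Op_le _ 1 _ _ a).trans_eq (one_mul _)

theorem norm_shiftDownL_le (a : L1) : ‖shiftDownL a‖ ≤ ‖a‖ := by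
  exact (norm_l1Op_le _ 1 _ _ a).trans_eq (one_mul _)

/-! ### Convolution of symmetric extensions -/

section Convolution

/-- The change of variables `(k, j) ↦ (j, k - j)`. -/
def convEquiv : ℤ × ℤ ≃ ℤ × ℤ where
  toFun p := (p.2, p.1 - p.2)
  invFun p := (p.1 + p.2, p.1)
  left_inv p := by simp
  right_inv p := by simp

variable {f g : ℤ → ℂ}

theorem summable_conv_prod (hf : Summable fun k => ‖f k‖) (hg : Summable fun k => ‖g k‖) :
    Summable fun p : ℤ × ℤ => ‖f p.2 * g (p.1 - p.2)‖ := by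
  have h := Summable.mul_of_nonneg hf hg (fun _ => norm_nonneg _) (fun _ => norm_nonneg _)
  simpa [Function.comp_def, convEquiv] using convEquiv.summable_iff.2 h

theorem summable_conv (hf : Summable fun k => ‖f k‖) (hg : Summable fun k => ‖g k‖) (k : ℤ) :
    Summable fun j => ‖f j * g (k - j)‖ :=
  (summable_conv_prod hf hg).prod_factor k

theorem summable_norm_conv (hf : Summable fun k => ‖f k‖) (hg : Summable fun k => ‖g k‖) :
    Summable fun k : ℤ => ‖∑' j, f j * g (k - j)‖ := by
  refine Summable.of_nonneg_of_le (fun _ => norm_nonneg _)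
    (fun k => norm_tsum_le_tsum_norm (summable_conv hf hg k)) (summable_conv_prod hf hg).prod

/-- Young's inequality for `ℓ¹`: Tonelli's theorem after the change of variables `convEquiv`. -/
theorem tsum_norm_conv_le (hf : Summable fun k => ‖f k‖) (hg : Summable fun k => ‖g k‖) :
    ∑' k : ℤ, ‖∑' j, f j * g (k - j)‖ ≤ (∑' k, ‖f k‖) * ∑' k, ‖g k‖ := by
  calc ∑' k : ℤ, ‖∑' j, f j * g (k - j)‖ ≤ ∑' k : ℤ, ∑' j, ‖f j * g (k - j)‖ :=
        (summable_norm_conv hf hg).tsum_le_tsum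
          (fun k => norm_tsum_le_tsum_norm (summable_conv hf hg k)) (summable_conv_prod hf hg).prod
    _ = ∑' p : ℤ × ℤ, ‖f p.2 * g (p.1 - p.2)‖ := ((summable_conv_prod hf hg).tsum_prod).symm
    _ = ∑' p : ℤ × ℤ, ‖f p.1‖ * ‖g p.2‖ := by
        rw [← convEquiv.tsum_eq (fun p : ℤ × ℤ => ‖f p.1‖ * ‖g p.2‖)]
        simp [convEquiv]
    _ = _ := (hf.tsum_mul_tsum hg
        (Summable.mul_of_nonneg hf hg (fun _ => norm_nonneg _) fun _ => norm_nonneg _)).symm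

/-- Cauchy product by Fubini; it later turns a product of Fourier series into a convolution of
coefficients. -/
theorem hasSum_conv (hf : Summable fun k => ‖f k‖) (hg : Summable fun k => ‖g k‖) :
    HasSum (fun k : ℤ => ∑' j, f j * g (k - j)) ((∑' k, f k) * ∑' k, g k) := by
  have h := (summable_conv_prod hf hg).of_norm
  have h2 : ∑' p : ℤ × ℤ, f p.2 * g (p.1 - p.2) = (∑' k, f k) * ∑' k, g k := by
    rw [tsum_mul_tsum_of_summable_norm hf hg, ← convEquiv.tsum_eq (fun p : ℤ × ℤ => f p.1 * g p.2)]
    simp [convEquiv]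
  rw [← h2, h.tsum_prod]
  exact h.prod.hasSum

end Convolution

theorem symExt_natCast_succ (a : ℕ → ℂ) (k : ℕ) : symExt a ((k : ℤ) + 1) = a (k + 1) := by
  have h : (0 : ℤ) < (k : ℤ) + 1 := by positivity
  have h2 : ((k : ℤ) + 1).natAbs = k + 1 := by omega
  simp [symExt, h, h2]

theorem symExt_neg_natCast_succ (a : ℕ → ℂ) (k : ℕ) :
    symExt a (-((k : ℤ) + 1)) = (starRingEnd ℂ) (a (k + 1)) := by
  have h : ¬ (0 : ℤ) < -((k : ℤ) + 1) := by omega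
  have h1 : -((k : ℤ) + 1) < 0 := by omega
  have h2 : (-((k : ℤ) + 1)).natAbs = k + 1 := by omega
  simp only [symExt, h, h1, h2, if_true, if_false]

@[simp] theorem symExt_zero (a : ℕ → ℂ) : symExt a 0 = 0 := by simp [symExt]

theorem symExt_neg (a : ℕ → ℂ) (k : ℤ) : symExt a (-k) = (starRingEnd ℂ) (symExt a k) := by
  rcases lt_trichotomy k 0 with h | h | h
  · have h1 : ¬ 0 < k := by omega
    simp [symExt, h, h1]
  · simp [h]
  · have h1 : ¬ k < 0 := by omega
    simp [symExt, h, h1]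

/-- Summation over `ℤ` of a function that vanishes at zero. -/
theorem hasSum_int_of_nat {M : Type*} [AddCommGroup M] [TopologicalSpace M] [IsTopologicalAddGroup M]
    {f : ℤ → M} (h0 : f 0 = 0) {x y : M} (h1 : HasSum (fun k : ℕ => f ((k : ℤ) + 1)) x)
    (h2 : HasSum (fun k : ℕ => f (-((k : ℤ) + 1))) y) : HasSum f (x + y) := by
  have h3 : HasSum (fun k : ℕ => f k) x := by
    rw [← hasSum_nat_add_iff' 1]
    simpa [h0] using h1
  exact h3.of_nat_of_neg_add_one (by simpa using h2)

theorem hasSum_norm_symExt (a : L1) :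
    HasSum (fun k => ‖symExt a k‖) (∑' k, ‖a (k + 1)‖ + ∑' k, ‖a (k + 1)‖) := by
  have h := ((summable_nat_add_iff 1).2 (l1_summable a)).hasSum
  refine hasSum_int_of_nat (by simp) ?_ ?_
  · simpa [symExt_natCast_succ] using h
  · simpa only [symExt_neg_natCast_succ, RCLike.norm_conj] using h

theorem summable_norm_symExt (a : L1) : Summable fun k => ‖symExt a k‖ :=
  (hasSum_norm_symExt a).summable

theorem tsum_norm_symExt_le (a : L1) : ∑' k, ‖symExt a k‖ ≤ 2 * ‖a‖ := by
  rw [(hasSum_norm_symExt a).tsum_eq, l1_norm_eq]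
  have := (l1_summable a).sum_add_tsum_nat_add 1
  simp only [Finset.range_one, Finset.sum_singleton] at this
  linarith [norm_nonneg (a 0)]

theorem symExt_add (a b : ℕ → ℂ) (k : ℤ) : symExt (a + b) k = symExt a k + symExt b k := by
  simp only [symExt, Pi.add_apply]; split_ifs <;> simp

theorem symExt_smul (r : ℝ) (a : ℕ → ℂ) (k : ℤ) : symExt (r • a) k = (r : ℂ) * symExt a k := by
  simp only [symExt, Pi.smul_apply]; split_ifs <;> simp

theorem summable_seqConv (a b : L1) (k : ℤ) :
    Summable fun j : ℤ => symExt a j * symExt b (k - j) :=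
  (summable_conv (summable_norm_symExt a) (summable_norm_symExt b) k).of_norm

theorem natCast_int_injective : Function.Injective ((↑) : ℕ → ℤ) := Nat.cast_injective

theorem summable_norm_seqConv (a b : L1) : Summable fun k => ‖seqConv a b k‖ :=
  (summable_norm_conv (summable_norm_symExt a) (summable_norm_symExt b)).comp_injective
    natCast_int_injective

/-- The norm of `L1` is the plain sum over `ℕ`, without the factor 2 of `seqNorm`. Each symmetric
extension therefore has mass up to twice the norm, whence the constant 4. -/
theorem tsum_norm_seqConv_le (a b : L1) : ∑' k, ‖seqConv a b k‖ ≤ 4 * ‖a‖ * ‖b‖ := by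
  have h := summable_norm_conv (summable_norm_symExt a) (summable_norm_symExt b)
  calc ∑' k, ‖seqConv a b k‖ ≤ ∑' k : ℤ, ‖∑' j, symExt a j * symExt b (k - j)‖ :=
        (h.comp_injective natCast_int_injective).tsum_le_tsum_of_inj ((↑) : ℕ → ℤ)
          natCast_int_injective (fun _ _ => norm_nonneg _) (fun _ => le_rfl) h
    _ ≤ (∑' k, ‖symExt a k‖) * ∑' k, ‖symExt b k‖ :=
        tsum_norm_conv_le (summable_norm_symExt a) (summable_norm_symExt b)
    _ ≤ (2 * ‖a‖) * (2 * ‖b‖) := by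
        gcongr
        · exact tsum_norm_symExt_le a
        · exact tsum_norm_symExt_le b
    _ = _ := by ring

/-- The convolution as a bounded real bilinear map. -/
def convL : L1 →L[ℝ] L1 →L[ℝ] L1 :=
  LinearMap.mkContinuous₂
    -- Scalars are real only: the symmetric extension conjugates the entries of negative index.
    (LinearMap.mk₂ ℝ (fun a b => l1Mk (seqConv a b) (summable_norm_seqConv a b))
      (fun a a' b => l1_ext fun k => by
        have : ((a + a' : L1) : ℕ → ℂ) = (a : ℕ → ℂ) + (a' : ℕ → ℂ) := rfl
        simp only [l1Mk_apply, l1_add_apply, seqConv, this, symExt_add, add_mul]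
        exact (summable_seqConv a b k).tsum_add (summable_seqConv a' b k))
      (fun r a b => l1_ext fun k => by
        have : ((r • a : L1) : ℕ → ℂ) = r • (a : ℕ → ℂ) := rfl
        simp only [l1Mk_apply, l1_real_smul_apply, seqConv, this, symExt_smul, mul_assoc]
        exact tsum_mul_left)
      (fun a b b' => l1_ext fun k => by
        have : ((b + b' : L1) : ℕ → ℂ) = (b : ℕ → ℂ) + (b' : ℕ → ℂ) := rfl
        simp only [l1Mk_apply, l1_add_apply, seqConv, this, symExt_add, mul_add]
        exact (summable_seqConv a b k).tsum_add (summable_seqConv a b' k))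
      (fun r a b => l1_ext fun k => by
        have : ((r • b : L1) : ℕ → ℂ) = r • (b : ℕ → ℂ) := rfl
        simp only [l1Mk_apply, l1_real_smul_apply, seqConv, this, symExt_smul,
          mul_left_comm _ (r : ℂ)]
        exact tsum_mul_left)) 4
    (fun a b => by
      rw [l1_norm_eq]
      exact tsum_norm_seqConv_le a b)

@[simp] theorem convL_apply (a b : L1) (k : ℕ) : convL a b k = seqConv a b k := rfl

theorem norm_convL_le (a b : L1) : ‖convL a b‖ ≤ 4 * ‖a‖ * ‖b‖ := by
  rw [l1_norm_eq]
  exact tsum_norm_seqConv_le a b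

theorem norm_convL_sub_le (a b a' b' : L1) :
    ‖convL a b - convL a' b'‖ ≤ 4 * ‖a - a'‖ * ‖b‖ + 4 * ‖a'‖ * ‖b - b'‖ := by
  have : convL a b - convL a' b' = convL (a - a') b + convL a' (b - b') := by simp
  rw [this]
  exact (norm_add_le _ _).trans (add_le_add (norm_convL_le _ _) (norm_convL_le _ _))

/-! ### Phase operators and their dependence on the frequency -/

/-- The factor `exp (-i k ω)`. -/
def ephase (ω : ℝ) (k : ℕ) : ℂ := Complex.exp (-Complex.I * (k : ℂ) * (ω : ℂ))

@[simp] theorem norm_ephase (ω : ℝ) (k : ℕ) : ‖ephase ω k‖ = 1 := by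
  rw [ephase, Complex.norm_exp]; simp

theorem hasDerivAt_ephase (ω : ℝ) (k : ℕ) :
    HasDerivAt (fun w => ephase w k) (-Complex.I * k * ephase ω k) ω := by
  have h : HasDerivAt (fun w : ℝ => -Complex.I * (k : ℂ) * (w : ℂ)) (-Complex.I * (k : ℂ) * 1) ω :=
    (Complex.ofRealCLM.hasDerivAt (x := ω)).const_mul _
  simpa [ephase, mul_comm] using h.cexp

/-- Mean value inequality. The factor `k` is what `K` compensates in `norm_phaseK_sub_le`. -/
theorem norm_ephase_sub_le (ω ω' : ℝ) (k : ℕ) : ‖ephase ω k - ephase ω' k‖ ≤ k * |ω - ω'| := by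
  have := Convex.norm_image_sub_le_of_norm_hasDerivWithin_le (C := (k : ℝ))
    (fun x _ => (hasDerivAt_ephase x k).hasDerivWithinAt)
    (fun x _ => by simp) convex_univ (mem_univ ω') (mem_univ ω)
  simpa using this

/-- Restriction to indices `k ≥ 2` composed with `U_ω`. -/
def phaseOp (ω : ℝ) : L1 →L[ℝ] L1 :=
  diag (fun k => if 2 ≤ k then ephase ω k else 0) 1 (fun k => by split_ifs <;> simp)

/-- The operator `v ↦ U_ω K v`, restricted to indices `k ≥ 2`. -/
def phaseK (ω : ℝ) : L1 →L[ℝ] L1 :=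
  diag (fun k => if 2 ≤ k then ephase ω k / k else 0) (1 / 2) (fun k => by
    split_ifs with h
    · have : (2 : ℝ) ≤ k := by exact_mod_cast h
      simp only [norm_div, norm_ephase, Complex.norm_natCast]
      gcongr
    · simp)

/-- The operator `K`, restricted to indices `k ≥ 2`. -/
def opK : L1 →L[ℝ] L1 :=
  diag (fun k => if 2 ≤ k then 1 / (k : ℂ) else 0) (1 / 2) (fun k => by
    split_ifs with h
    · have : (2 : ℝ) ≤ k := by exact_mod_cast h
      simp only [norm_div, norm_one, Complex.norm_natCast]
      gcongr
    · simp)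

theorem opK_apply (v : L1) (k : ℕ) : opK v k = if 2 ≤ k then v k / k else 0 := by
  simp [opK, div_eq_inv_mul]

theorem phaseK_apply (ω : ℝ) (v : L1) (k : ℕ) : phaseK ω v k = ephase ω k * opK v k := by
  rw [phaseK, opK_apply, diag_apply]
  by_cases h : 2 ≤ k
  · rw [if_pos h, if_pos h]; ring
  · rw [if_neg h, if_neg h]; ring

theorem norm_opK_le (v : L1) : ‖opK v‖ ≤ ‖v‖ / 2 := by
  exact (norm_diag_le' _ v).trans_eq (by ring)

theorem norm_phaseK_eq (ω : ℝ) (v : L1) : ‖phaseK ω v‖ = ‖opK v‖ := by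
  simp [l1_norm_eq, phaseK_apply]

theorem norm_phaseK_sub_le (ω ω' : ℝ) (v : L1) :
    ‖phaseK ω v - phaseK ω' v‖ ≤ |ω - ω'| * ‖v‖ := by
  refine norm_diag_sub_le _ _ (fun k => ?_) v
  split_ifs with h
  · have hk : (0 : ℝ) < k := by exact_mod_cast (by omega : 0 < k)
    rw [← sub_div, norm_div, Complex.norm_natCast, div_le_iff₀ hk, mul_comm]
    exact norm_ephase_sub_le ω ω' k
  · simp

theorem norm_phaseK_sub_phaseK_le (ω ω' : ℝ) (v v' : L1) :
    ‖phaseK ω v - phaseK ω' v'‖ ≤ ‖opK (v - v')‖ + |ω - ω'| * ‖v'‖ := by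
  have : phaseK ω v - phaseK ω' v' = phaseK ω (v - v') + (phaseK ω v' - phaseK ω' v') := by
    simp
  rw [this, ← norm_phaseK_eq ω (v - v')]
  exact (norm_add_le _ _).trans (add_le_add le_rfl (norm_phaseK_sub_le ω ω' v'))

/-- The diagonal entries of the difference quotient are bounded by 1 uniformly in `k` and converge
for each `k`, so `tendsto_diag` applies. The convergence is strong, for a fixed `v`, and not in
operator norm. -/
theorem hasDerivAt_phaseK (ω : ℝ) (v : L1) :
    HasDerivAt (fun w => phaseK w v) (-Complex.I • phaseOp ω v) ω := by
  rw [hasDerivAt_iff_tendsto_slope]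
  let m : ℝ → ℕ → ℂ := fun w k =>
    if 2 ≤ k then ((w - ω)⁻¹ : ℝ) * (ephase w k - ephase ω k) / k else 0
  let m₀ : ℕ → ℂ := fun k => if 2 ≤ k then -Complex.I * ephase ω k else 0
  have hm : ∀ w k, ‖m w k‖ ≤ 1 := fun w k => by
    simp only [m]
    split_ifs with h
    · have hk : (0 : ℝ) < k := by exact_mod_cast (by omega : 0 < k)
      rw [norm_div, Complex.norm_natCast, div_le_one hk, norm_mul, Complex.norm_real,
        Real.norm_eq_abs, abs_inv]
      by_cases hw : w - ω = 0
      · simp [hw]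
      rw [inv_mul_le_iff₀ (abs_pos.2 hw), mul_comm]
      exact norm_ephase_sub_le w ω k
    · simp
  have hm₀ : ∀ k, ‖m₀ k‖ ≤ 1 := fun k => by simp only [m₀]; split_ifs <;> simp
  have h := tendsto_diag (l := 𝓝[≠] ω) hm hm₀ (fun k => ?_) v
  · convert h using 1
    · funext w
      refine l1_ext fun k => ?_
      simp only [slope, m, phaseK, vsub_eq_sub, l1_real_smul_apply, l1_sub_apply, diag_apply]
      by_cases h : 2 ≤ k
      · simp only [if_pos h]; ring
      · simp only [if_neg h]; ring
    · congr 1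
      refine l1_ext fun k => ?_
      simp only [phaseOp, m₀, l1_smul_apply, diag_apply]
      by_cases h : 2 ≤ k
      · simp only [if_pos h]; ring
      · simp only [if_neg h]; ring
  · simp only [m, m₀]
    split_ifs with h
    · have hk : (k : ℂ) ≠ 0 := by exact_mod_cast (by omega : k ≠ 0)
      have := (hasDerivAt_iff_tendsto_slope.1 (hasDerivAt_ephase ω k)).div_const (k : ℂ)
      convert this using 1
      · ext w; simp [slope]
      · congr 1; field_simp
    · exact tendsto_const_nhds

/-- Strong continuity in `ω` and the uniform operator bound 1 give joint continuity, although `ω ↦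
U_ω` is not norm continuous. -/
theorem continuous_phaseOp : Continuous fun p : ℝ × L1 => phaseOp p.1 p.2 := by
  rw [continuous_iff_continuousAt]
  rintro ⟨ω, v⟩
  have h1 : Tendsto (fun p : ℝ × L1 => phaseOp p.1 v) (𝓝 (ω, v)) (𝓝 (phaseOp ω v)) := by
    refine tendsto_diag _ _ (fun k => ?_) v
    split_ifs
    · exact ((hasDerivAt_ephase ω k).continuousAt.tendsto).comp (continuous_fst.tendsto (ω, v))
    · exact tendsto_const_nhds
  have h2 : Tendsto (fun p : ℝ × L1 => phaseOp p.1 (p.2 - v)) (𝓝 (ω, v)) (𝓝 0) := by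
    have h3 : Tendsto (fun p : ℝ × L1 => ‖p.2 - v‖) (𝓝 (ω, v)) (𝓝 0) := by
      have : Continuous fun p : ℝ × L1 => ‖p.2 - v‖ := by fun_prop
      simpa using this.tendsto (ω, v)
    exact squeeze_zero_norm (fun p => (norm_diag_le' _ (p.2 - v)).trans_eq (one_mul _)) h3
  have := h1.add h2
  simpa [ContinuousAt, ← map_add] using this

/-- Both partial derivatives are jointly continuous: the one in `ω` is `-i U_ω v`, by
`continuous_phaseOp`, and the one in `v` is `phaseK ω`, which is Lipschitz in `ω` in operator norm.
This is the reason for the unknown `v = K⁻¹ z`: the map `(ω, z) ↦ U_ω z` is not `C¹` on `ℓ¹`. -/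
theorem contDiff_phaseK : ContDiff ℝ 1 fun p : ℝ × L1 => phaseK p.1 p.2 := by
  have hc : Continuous phaseK := by
    have : LipschitzWith 1 phaseK := LipschitzWith.of_dist_le_mul fun ω ω' => by
      rw [dist_eq_norm, dist_eq_norm, Real.norm_eq_abs, NNReal.coe_one, one_mul]
      exact ContinuousLinearMap.opNorm_le_bound _ (abs_nonneg _) fun v => norm_phaseK_sub_le ω ω' v
    exact this.continuous
  let f₁ : ℝ → L1 → ℝ →L[ℝ] L1 := fun ω v =>
    (ContinuousLinearMap.toSpanSingleton ℝ (-Complex.I • phaseOp ω v))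
  let f₂ : ℝ → L1 → L1 →L[ℝ] L1 := fun ω _ => phaseK ω
  have c₁ : Continuous fun p : ℝ × L1 => f₁ p.1 p.2 := by
    have h := (continuous_phaseOp.const_smul (-Complex.I))
    exact (ContinuousLinearMap.toSpanSingletonCLE (𝕜 := ℝ) (E := L1)).continuous.comp h
  have c₂ : Continuous fun p : ℝ × L1 => f₂ p.1 p.2 := hc.comp continuous_fst
  rw [contDiff_one_iff_hasFDerivAt]
  refine ⟨fun p => (f₁ p.1 p.2).coprod (f₂ p.1 p.2), ?_, fun p => ?_⟩
  · exact (ContinuousLinearMap.coprodEquivL (S := ℝ)).continuous.comp (c₁.prodMk c₂)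
  · exact (hasStrictFDerivAt_uncurry_coprod (f := fun ω v => phaseK ω v) (f₁ := f₁) (f₂ := f₂)
      (Eventually.of_forall fun p => (hasDerivAt_phaseK p.1 p.2).hasFDerivAt)
      (Eventually.of_forall fun p => (phaseK p.1).hasFDerivAt) c₁.continuousAt
      c₂.continuousAt).hasFDerivAt

/-! ### The nonlinear remainder -/

/-- The remainder `L_ω z + ε [U_ω z] * z` with `z = K v`. -/
def remR (ε ω : ℝ) (v : L1) : L1 :=
  ephase ω 1 • shiftUpL (opK v) + shiftUpL (phaseK ω v) + ephase (-ω) 1 • shiftDownL (opK v)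
    + shiftDownL (phaseK ω v) + ε • convL (phaseK ω v) (opK v)

theorem norm_ephase_smul_sub_le (ω ω' : ℝ) (a a' : L1) :
    ‖ephase ω 1 • a - ephase ω' 1 • a'‖ ≤ ‖a - a'‖ + |ω - ω'| * ‖a'‖ := by
  have : ephase ω 1 • a - ephase ω' 1 • a' =
      ephase ω 1 • (a - a') + (ephase ω 1 - ephase ω' 1) • a' := by
    rw [smul_sub, sub_smul]; abel
  rw [this]
  refine (norm_add_le _ _).trans ?_
  rw [norm_smul, norm_smul, norm_ephase, one_mul]
  gcongr
  simpa using norm_ephase_sub_le ω ω' 1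

theorem norm_remR_le (ε ω : ℝ) (v : L1) :
    ‖remR ε ω v‖ ≤ 4 * ‖opK v‖ + |ε| * (4 * ‖opK v‖ * ‖opK v‖) := by
  have h1 : ‖ephase ω 1 • shiftUpL (opK v)‖ ≤ ‖opK v‖ := by
    rw [norm_smul, norm_ephase, one_mul]; exact norm_shiftUpL_le _
  have h2 : ‖ephase (-ω) 1 • shiftDownL (opK v)‖ ≤ ‖opK v‖ := by
    rw [norm_smul, norm_ephase, one_mul]; exact norm_shiftDownL_le _
  have h3 : ‖shiftUpL (phaseK ω v)‖ ≤ ‖opK v‖ := norm_phaseK_eq ω v ▸ norm_shiftUpL_le _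
  have h4 : ‖shiftDownL (phaseK ω v)‖ ≤ ‖opK v‖ := norm_phaseK_eq ω v ▸ norm_shiftDownL_le _
  have h5 : ‖ε • convL (phaseK ω v) (opK v)‖ ≤ |ε| * (4 * ‖opK v‖ * ‖opK v‖) := by
    rw [norm_smul, Real.norm_eq_abs]
    have := norm_convL_le (phaseK ω v) (opK v)
    rw [norm_phaseK_eq] at this
    gcongr
  unfold remR
  refine (norm_add_le_of_le (norm_add_le_of_le (norm_add_le_of_le (norm_add_le_of_le h1 h3) h2)
    h4) h5).trans (by linarith)

/-- On indices `k ≥ 2` the operator `K` has norm `1/2`. The four linear terms then contribute `4 ·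
1/2 = 2` to the coefficient of `‖v - v'‖`, and `V/2 + V/2 + V + V = 3V` to that of `|ω - ω'|`, the
last two from the phase inside `U_ω`. -/
theorem norm_remR_sub_le {V : ℝ} (ε ω ω' : ℝ) {v v' : L1} (hv : ‖v‖ ≤ V) (hv' : ‖v'‖ ≤ V) :
    ‖remR ε ω v - remR ε ω' v'‖ ≤ 2 * ‖v - v'‖ + 3 * V * |ω - ω'|
      + |ε| * (2 * V * ‖v - v'‖ + 2 * V ^ 2 * |ω - ω'|) := by
  have hK : ‖opK v - opK v'‖ ≤ ‖v - v'‖ / 2 := by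
    rw [← map_sub]; exact norm_opK_le _
  have hKv : ‖opK v‖ ≤ V / 2 := (norm_opK_le v).trans (by linarith)
  have hKv' : ‖opK v'‖ ≤ V / 2 := (norm_opK_le v').trans (by linarith)
  have hd := abs_nonneg (ω - ω')
  have hW : ‖phaseK ω v - phaseK ω' v'‖ ≤ ‖v - v'‖ / 2 + |ω - ω'| * V :=
    (norm_phaseK_sub_phaseK_le ω ω' v v').trans
      (add_le_add (norm_opK_le _) (mul_le_mul_of_nonneg_left hv' hd))
  have hW' : ‖phaseK ω' v'‖ ≤ V / 2 := (norm_phaseK_eq ω' v').trans_le hKv'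
  have h1 : ‖ephase ω 1 • shiftUpL (opK v) - ephase ω' 1 • shiftUpL (opK v')‖ ≤
      ‖v - v'‖ / 2 + |ω - ω'| * (V / 2) := by
    refine (norm_ephase_smul_sub_le _ _ _ _).trans (add_le_add ?_ ?_)
    · rw [← map_sub]; exact (norm_shiftUpL_le _).trans hK
    · exact mul_le_mul_of_nonneg_left ((norm_shiftUpL_le _).trans hKv') hd
  have h2 : ‖ephase (-ω) 1 • shiftDownL (opK v) - ephase (-ω') 1 • shiftDownL (opK v')‖ ≤
      ‖v - v'‖ / 2 + |ω - ω'| * (V / 2) := by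
    refine (norm_ephase_smul_sub_le _ _ _ _).trans (add_le_add ?_ ?_)
    · rw [← map_sub]; exact (norm_shiftDownL_le _).trans hK
    · have : |-ω - -ω'| = |ω - ω'| := by rw [← abs_neg]; congr 1; ring
      rw [this]
      exact mul_le_mul_of_nonneg_left ((norm_shiftDownL_le _).trans hKv') hd
  have h3 : ‖shiftUpL (phaseK ω v) - shiftUpL (phaseK ω' v')‖ ≤
      ‖v - v'‖ / 2 + |ω - ω'| * V := by
    rw [← map_sub]; exact (norm_shiftUpL_le _).trans hW
  have h4 : ‖shiftDownL (phaseK ω v) - shiftDownL (phaseK ω' v')‖ ≤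
      ‖v - v'‖ / 2 + |ω - ω'| * V := by
    rw [← map_sub]; exact (norm_shiftDownL_le _).trans hW
  have h5 : ‖ε • convL (phaseK ω v) (opK v) - ε • convL (phaseK ω' v') (opK v')‖ ≤
      |ε| * (2 * V * ‖v - v'‖ + 2 * V ^ 2 * |ω - ω'|) := by
    rw [← smul_sub, norm_smul, Real.norm_eq_abs]
    refine mul_le_mul_of_nonneg_left ((norm_convL_sub_le _ _ _ _).trans ?_) (abs_nonneg _)
    have e1 := mul_le_mul hW hKv (norm_nonneg _) ((norm_nonneg _).trans hW)
    have e2 := mul_le_mul hW' hK (norm_nonneg _) ((norm_nonneg _).trans hW')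
    nlinarith
  have : remR ε ω v - remR ε ω' v' =
      (ephase ω 1 • shiftUpL (opK v) - ephase ω' 1 • shiftUpL (opK v'))
      + (shiftUpL (phaseK ω v) - shiftUpL (phaseK ω' v'))
      + (ephase (-ω) 1 • shiftDownL (opK v) - ephase (-ω') 1 • shiftDownL (opK v'))
      + (shiftDownL (phaseK ω v) - shiftDownL (phaseK ω' v'))
      + (ε • convL (phaseK ω v) (opK v) - ε • convL (phaseK ω' v') (opK v')) := by
    unfold remR; abel
  rw [this]
  refine (norm_add_le_of_le (norm_add_le_of_le (norm_add_le_of_le (norm_add_le_of_le h1 h3) h2)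
    h4) h5).trans (by linarith)

theorem contDiff_ephase (k : ℕ) : ContDiff ℝ 1 fun w => ephase w k := by
  unfold ephase
  have : ContDiff ℝ 1 fun w : ℝ => (w : ℂ) := Complex.ofRealCLM.contDiff
  fun_prop

theorem contDiff_bilinear {E : Type*} [NormedAddCommGroup E] [NormedSpace ℝ E] {n : WithTop ℕ∞}
    (B : L1 →L[ℝ] L1 →L[ℝ] L1) {f g : E → L1} (hf : ContDiff ℝ n f) (hg : ContDiff ℝ n g) :
    ContDiff ℝ n fun x => B (f x) (g x) :=
  (B.contDiff.comp hf).clm_apply hg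

theorem contDiff_remR : ContDiff ℝ 1 fun p : ℝ × ℝ × L1 => remR p.1 p.2.1 p.2.2 := by
  have hW : ContDiff ℝ 1 fun p : ℝ × ℝ × L1 => phaseK p.2.1 p.2.2 :=
    contDiff_phaseK.comp contDiff_snd
  have hz : ContDiff ℝ 1 fun p : ℝ × ℝ × L1 => opK p.2.2 := by fun_prop
  have he : ContDiff ℝ 1 fun p : ℝ × ℝ × L1 => ephase p.2.1 1 :=
    (contDiff_ephase 1).comp (by fun_prop)
  have he' : ContDiff ℝ 1 fun p : ℝ × ℝ × L1 => ephase (-p.2.1) 1 :=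
    (contDiff_ephase 1).comp (by fun_prop)
  have hQ : ContDiff ℝ 1 fun p : ℝ × ℝ × L1 => convL (phaseK p.2.1 p.2.2) (opK p.2.2) :=
    contDiff_bilinear convL hW hz
  have h1 : ContDiff ℝ 1 fun p : ℝ × ℝ × L1 => shiftUpL (opK p.2.2) := by fun_prop
  have h2 : ContDiff ℝ 1 fun p : ℝ × ℝ × L1 => shiftUpL (phaseK p.2.1 p.2.2) := by fun_prop
  have h3 : ContDiff ℝ 1 fun p : ℝ × ℝ × L1 => shiftDownL (opK p.2.2) := by fun_prop
  have h4 : ContDiff ℝ 1 fun p : ℝ × ℝ × L1 => shiftDownL (phaseK p.2.1 p.2.2) := by fun_prop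
  have h5 : ContDiff ℝ 1 fun p : ℝ × ℝ × L1 => ephase p.2.1 1 • shiftUpL (opK p.2.2) :=
    he.smul h1
  have h6 : ContDiff ℝ 1 fun p : ℝ × ℝ × L1 => ephase (-p.2.1) 1 • shiftDownL (opK p.2.2) :=
    he'.smul h3
  have h7 : ContDiff ℝ 1 fun p : ℝ × ℝ × L1 =>
      p.1 • convL (phaseK p.2.1 p.2.2) (opK p.2.2) := contDiff_fst.smul hQ
  unfold remR
  exact (((h5.add h2).add h6).add h4).add h7

/-! ### Inverting the modes `k ≥ 2` at the bifurcation point -/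

theorem ephase_pi_div_two_two : ephase (Real.pi / 2) 2 = -1 := by
  rw [ephase, ← Complex.exp_neg_pi_mul_I]
  congr 1; push_cast; ring

theorem ephase_pi_div_two_three : ephase (Real.pi / 2) 3 = Complex.I := by
  have : -Complex.I * ((3 : ℕ) : ℂ) * ((Real.pi / 2 : ℝ) : ℂ) =
      Real.pi / 2 * Complex.I - 2 * Real.pi * Complex.I := by push_cast; ring
  rw [ephase, this, Complex.exp_periodic.sub_eq, Complex.exp_pi_div_two_mul_I]

theorem norm_two_mul_I_sub_one : ‖Complex.I * 2 - 1‖ = √5 := by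
  rw [Complex.norm_def]; congr 1; norm_num [Complex.normSq_apply]

/-- The factor is `2i - 1` at `k = 2` and `4i` at `k = 3`, and for `k ≥ 4` its modulus is at least
`k - 1 ≥ 3k/4`. At `k = 1` it would vanish, so only the first mode is resonant. -/
theorem le_norm_precond {k : ℕ} (hk : 2 ≤ k) :
    3 / 4 * (k : ℝ) ≤ ‖Complex.I * k + ephase (Real.pi / 2) k‖ := by
  obtain rfl | rfl | h : k = 2 ∨ k = 3 ∨ 4 ≤ k := by omega
  · rw [ephase_pi_div_two_two, ← sub_eq_add_neg, show ((2 : ℕ) : ℂ) = 2 from rfl,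
      norm_two_mul_I_sub_one]
    refine Real.le_sqrt_of_sq_le (by norm_num)
  · rw [ephase_pi_div_two_three]
    have : Complex.I * ((3 : ℕ) : ℂ) + Complex.I = 4 * Complex.I := by push_cast; ring
    rw [this, norm_mul, Complex.norm_I]; norm_num
  · have h1 := norm_sub_le (Complex.I * k + ephase (Real.pi / 2) k) (ephase (Real.pi / 2) k)
    have h2 : (4 : ℝ) ≤ k := by exact_mod_cast h
    simp only [add_sub_cancel_right, norm_mul, Complex.norm_I, Complex.norm_natCast, one_mul,
      norm_ephase] at h1
    linarith

/-- The inverse of `i + U_{π/2} K`, restricted to indices `k ≥ 2`. -/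
def precond : L1 →L[ℝ] L1 :=
  diag (fun k => if 2 ≤ k then k / (Complex.I * k + ephase (Real.pi / 2) k) else 0) (4 / 3)
    (fun k => by
      split_ifs with h
      · have h1 := le_norm_precond h
        have h2 : (0 : ℝ) < k := by exact_mod_cast (by omega : 0 < k)
        rw [norm_div, Complex.norm_natCast, div_le_iff₀ (by linarith)]
        linarith
      · simp; norm_num)

theorem norm_precond_le (a : L1) : ‖precond a‖ ≤ 4 / 3 * ‖a‖ := norm_diag_le' _ a

/-- The basis vector `e_2` of `ℓ¹`. -/
def unitTwo : L1 := lp.single 1 2 1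

theorem unitTwo_apply (k : ℕ) : unitTwo k = basisSeq 2 k := by
  simp [unitTwo, lp.single_apply, basisSeq, Pi.single_apply]

theorem norm_unitTwo : ‖unitTwo‖ = 1 := by
  simp [unitTwo, lp.norm_single]

/-- On `e_2` the preconditioner is multiplication by `2/(2i - 1)`, of modulus `2/√5 < 9/10`. The
inhomogeneous term of the fixed point equation is of this form, and the general constant `4/3` would
be too large for a ball of radius `17/10` to be mapped into itself. -/
theorem norm_precond_smul_unitTwo_le (c : ℂ) (hc : ‖c‖ = 1) : ‖precond (c • unitTwo)‖ ≤ 9 / 10 := by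
  have : precond (c • unitTwo) = (c * (2 / (Complex.I * 2 - 1))) • unitTwo := by
    refine l1_ext fun k => ?_
    simp only [precond, diag_apply, l1_smul_apply, unitTwo_apply, basisSeq]
    by_cases h : k = 2
    · subst h
      rw [ephase_pi_div_two_two]; simp; ring
    · simp [h]
  rw [this, norm_smul, norm_unitTwo, norm_mul, hc, norm_div, norm_two_mul_I_sub_one]
  have h : (20 / 9 : ℝ) ≤ √5 := Real.le_sqrt_of_sq_le (by norm_num)
  rw [one_mul, mul_one, div_le_iff₀ (by linarith)]
  norm_num; linarith

/-! ### The fixed point map and its contraction estimates -/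

/-- The bracket in the `v`-component of the fixed point map. -/
def innerG (ε θ ν : ℝ) (v : L1) : L1 :=
  (Complex.I * (ν : ℂ)) • v + (phaseK (Real.pi / 2 + θ) v - phaseK (Real.pi / 2) v)
    + ephase (Real.pi / 2 + θ) 1 • unitTwo + ε • remR ε (Real.pi / 2 + θ) v

/-- The fixed point map in the rescaled unknowns `(p, q, v)`, where `ω = π/2 + p/20`,
`ω/α = 1 + q/20` and `c = ε K v`. -/
def fixMap (ε : ℝ) (x : ℝ × ℝ × L1) : ℝ × ℝ × L1 :=
  (20 * (x.1 / 20 - Real.sin (x.1 / 20)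
      + ε ^ 2 * (remR ε (Real.pi / 2 + x.1 / 20) x.2.2 1).re),
    20 * (Real.cos (x.1 / 20) - 1 - ε ^ 2 * (remR ε (Real.pi / 2 + x.1 / 20) x.2.2 1).im),
    -precond (innerG ε (x.1 / 20) (x.2.1 / 20) x.2.2))

/-- The domain on which the fixed point map is a contraction. -/
def fixDom : Set (ℝ × ℝ × L1) := {x | |x.1| ≤ 1 ∧ |x.2.1| ≤ 1 ∧ ‖x.2.2‖ ≤ 17 / 10}

theorem isClosed_fixDom : IsClosed fixDom := by
  have h1 : Continuous fun x : ℝ × ℝ × L1 => |x.1| := by fun_prop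
  have h2 : Continuous fun x : ℝ × ℝ × L1 => |x.2.1| := by fun_prop
  have h3 : Continuous fun x : ℝ × ℝ × L1 => ‖x.2.2‖ := by fun_prop
  exact (isClosed_le h1 continuous_const).inter ((isClosed_le h2 continuous_const).inter
    (isClosed_le h3 continuous_const))

theorem ContDiff.remR_comp {E : Type*} [NormedAddCommGroup E] [NormedSpace ℝ E]
    {f g : E → ℝ} {h : E → L1} (hf : ContDiff ℝ 1 f) (hg : ContDiff ℝ 1 g) (hh : ContDiff ℝ 1 h) :
    ContDiff ℝ 1 fun x => remR (f x) (g x) (h x) := by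
  have h2 : ContDiff ℝ 1 fun x => (f x, g x, h x) := hf.prodMk (hg.prodMk hh)
  have h3 := contDiff_remR.comp h2
  exact h3

theorem ContDiff.phaseK_comp {E : Type*} [NormedAddCommGroup E] [NormedSpace ℝ E]
    {g : E → ℝ} {h : E → L1} (hg : ContDiff ℝ 1 g) (hh : ContDiff ℝ 1 h) :
    ContDiff ℝ 1 fun x => phaseK (g x) (h x) := by
  have h2 : ContDiff ℝ 1 fun x => (g x, h x) := hg.prodMk hh
  have h3 := contDiff_phaseK.comp h2
  exact h3

theorem contDiff_innerG : ContDiff ℝ 1 fun p : ℝ × ℝ × ℝ × L1 =>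
    innerG p.1 p.2.1 p.2.2.1 p.2.2.2 := by
  have hv : ContDiff ℝ 1 fun p : ℝ × ℝ × ℝ × L1 => p.2.2.2 := by fun_prop
  have hp : ContDiff ℝ 1 fun p : ℝ × ℝ × ℝ × L1 => Real.pi / 2 + p.2.1 := by fun_prop
  have hR : ContDiff ℝ 1 fun p : ℝ × ℝ × ℝ × L1 => remR p.1 (Real.pi / 2 + p.2.1) p.2.2.2 :=
    contDiff_fst.remR_comp hp hv
  have h1 : ContDiff ℝ 1 fun p : ℝ × ℝ × ℝ × L1 => Complex.I * ((p.2.2.1 : ℝ) : ℂ) :=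
    contDiff_const.mul (Complex.ofRealCLM.contDiff.comp (by fun_prop))
  have h2 : ContDiff ℝ 1 fun p : ℝ × ℝ × ℝ × L1 => (Complex.I * ((p.2.2.1 : ℝ) : ℂ)) • p.2.2.2 :=
    h1.smul hv
  have h3 : ContDiff ℝ 1 fun p : ℝ × ℝ × ℝ × L1 => phaseK (Real.pi / 2 + p.2.1) p.2.2.2 :=
    hp.phaseK_comp hv
  have h4 : ContDiff ℝ 1 fun p : ℝ × ℝ × ℝ × L1 => phaseK (Real.pi / 2) p.2.2.2 := by fun_prop
  have h5 : ContDiff ℝ 1 fun p : ℝ × ℝ × ℝ × L1 => ephase (Real.pi / 2 + p.2.1) 1 :=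
    (contDiff_ephase 1).comp hp
  have h6 : ContDiff ℝ 1 fun p : ℝ × ℝ × ℝ × L1 =>
      ephase (Real.pi / 2 + p.2.1) 1 • unitTwo := h5.smul contDiff_const
  have h7 : ContDiff ℝ 1 fun p : ℝ × ℝ × ℝ × L1 =>
      p.1 • remR p.1 (Real.pi / 2 + p.2.1) p.2.2.2 := contDiff_fst.smul hR
  unfold innerG
  exact ((h2.add (h3.sub h4)).add h6).add h7

theorem ContDiff.innerG_comp {E : Type*} [NormedAddCommGroup E] [NormedSpace ℝ E]
    {f g k : E → ℝ} {h : E → L1} (hf : ContDiff ℝ 1 f) (hg : ContDiff ℝ 1 g)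
    (hk : ContDiff ℝ 1 k) (hh : ContDiff ℝ 1 h) :
    ContDiff ℝ 1 fun x => innerG (f x) (g x) (k x) (h x) := by
  have h2 : ContDiff ℝ 1 fun x => (f x, g x, k x, h x) := hf.prodMk (hg.prodMk (hk.prodMk hh))
  have h3 := contDiff_innerG.comp h2
  exact h3

theorem contDiff_fixMap : ContDiff ℝ 1 fun p : ℝ × (ℝ × ℝ × L1) => fixMap p.1 p.2 := by
  have hv : ContDiff ℝ 1 fun p : ℝ × (ℝ × ℝ × L1) => p.2.2.2 := by fun_prop
  have h3 : ContDiff ℝ 1 fun p : ℝ × (ℝ × ℝ × L1) => p.2.1 / 20 := by fun_prop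
  have h4 : ContDiff ℝ 1 fun p : ℝ × (ℝ × ℝ × L1) => p.2.2.1 / 20 := by fun_prop
  have hp : ContDiff ℝ 1 fun p : ℝ × (ℝ × ℝ × L1) => Real.pi / 2 + p.2.1 / 20 := by fun_prop
  have hR : ContDiff ℝ 1 fun p : ℝ × (ℝ × ℝ × L1) =>
      remR p.1 (Real.pi / 2 + p.2.1 / 20) p.2.2.2 :=
    contDiff_fst.remR_comp hp hv
  have hR1 : ContDiff ℝ 1 fun p : ℝ × (ℝ × ℝ × L1) =>
      remR p.1 (Real.pi / 2 + p.2.1 / 20) p.2.2.2 1 :=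
    (lp.evalCLM ℝ (fun _ : ℕ => ℂ) 1 1).contDiff.comp hR
  have hre : ContDiff ℝ 1 fun p : ℝ × (ℝ × ℝ × L1) =>
      (remR p.1 (Real.pi / 2 + p.2.1 / 20) p.2.2.2 1).re := Complex.reCLM.contDiff.comp hR1
  have him : ContDiff ℝ 1 fun p : ℝ × (ℝ × ℝ × L1) =>
      (remR p.1 (Real.pi / 2 + p.2.1 / 20) p.2.2.2 1).im := Complex.imCLM.contDiff.comp hR1
  have hG : ContDiff ℝ 1 fun p : ℝ × (ℝ × ℝ × L1) =>
      innerG p.1 (p.2.1 / 20) (p.2.2.1 / 20) p.2.2.2 :=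
    contDiff_fst.innerG_comp h3 h4 hv
  have hM : ContDiff ℝ 1 fun p : ℝ × (ℝ × ℝ × L1) =>
      -precond (innerG p.1 (p.2.1 / 20) (p.2.2.1 / 20) p.2.2.2) := by fun_prop
  have h := contDiff_fst (𝕜 := ℝ) (n := 1) (E := ℝ) (F := ℝ × ℝ × L1)
  unfold fixMap
  refine ContDiff.prodMk ?_ (ContDiff.prodMk ?_ hM)
  · exact contDiff_const.mul ((h3.sub (Real.contDiff_sin.comp h3)).add ((h.pow 2).mul hre))
  · exact contDiff_const.mul (((Real.contDiff_cos.comp h3).sub contDiff_const).sub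
      ((h.pow 2).mul him))

theorem norm_innerG_sub_le {V : ℝ} (ε θ θ' ν ν' : ℝ) {v v' : L1} (hv : ‖v‖ ≤ V) (hv' : ‖v'‖ ≤ V) :
    ‖innerG ε θ ν v - innerG ε θ' ν' v'‖ ≤ (|ν| + |θ|) * ‖v - v'‖ + V * |ν - ν'|
      + (V + 1) * |θ - θ'| + |ε| * (2 * ‖v - v'‖ + 3 * V * |θ - θ'|
      + |ε| * (2 * V * ‖v - v'‖ + 2 * V ^ 2 * |θ - θ'|)) := by
  have hω : Real.pi / 2 + θ - (Real.pi / 2 + θ') = θ - θ' := by ring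
  have h1 : ‖(Complex.I * (ν : ℂ)) • v - (Complex.I * (ν' : ℂ)) • v'‖ ≤
      |ν| * ‖v - v'‖ + |ν - ν'| * V := by
    have : (Complex.I * (ν : ℂ)) • v - (Complex.I * (ν' : ℂ)) • v' =
        (Complex.I * (ν : ℂ)) • (v - v') + (Complex.I * ((ν - ν' : ℝ) : ℂ)) • v' := by
      push_cast; rw [smul_sub, mul_sub, sub_smul]; abel
    rw [this]
    refine (norm_add_le _ _).trans ?_
    rw [norm_smul, norm_smul, norm_mul, norm_mul, Complex.norm_I, one_mul, one_mul,
      Complex.norm_real, Complex.norm_real, Real.norm_eq_abs, Real.norm_eq_abs]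
    gcongr
  have h2 : ‖(phaseK (Real.pi / 2 + θ) v - phaseK (Real.pi / 2) v)
      - (phaseK (Real.pi / 2 + θ') v' - phaseK (Real.pi / 2) v')‖ ≤
      |θ| * ‖v - v'‖ + |θ - θ'| * V := by
    have : (phaseK (Real.pi / 2 + θ) v - phaseK (Real.pi / 2) v)
      - (phaseK (Real.pi / 2 + θ') v' - phaseK (Real.pi / 2) v') =
      (phaseK (Real.pi / 2 + θ) (v - v') - phaseK (Real.pi / 2) (v - v'))
      + (phaseK (Real.pi / 2 + θ) v' - phaseK (Real.pi / 2 + θ') v') := by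
      simp only [map_sub]; abel
    rw [this]
    have e1 := norm_phaseK_sub_le (Real.pi / 2 + θ) (Real.pi / 2) (v - v')
    have e2 := norm_phaseK_sub_le (Real.pi / 2 + θ) (Real.pi / 2 + θ') v'
    rw [add_sub_cancel_left] at e1
    rw [hω] at e2
    exact norm_add_le_of_le e1 (e2.trans (by gcongr))
  have h3 : ‖ephase (Real.pi / 2 + θ) 1 • unitTwo - ephase (Real.pi / 2 + θ') 1 • unitTwo‖ ≤
      |θ - θ'| := by
    have := norm_ephase_smul_sub_le (Real.pi / 2 + θ) (Real.pi / 2 + θ') unitTwo unitTwo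
    simpa [hω, norm_unitTwo] using this
  have h4 : ‖ε • remR ε (Real.pi / 2 + θ) v - ε • remR ε (Real.pi / 2 + θ') v'‖ ≤
      |ε| * (2 * ‖v - v'‖ + 3 * V * |θ - θ'|
      + |ε| * (2 * V * ‖v - v'‖ + 2 * V ^ 2 * |θ - θ'|)) := by
    rw [← smul_sub, norm_smul, Real.norm_eq_abs]
    have := norm_remR_sub_le ε (Real.pi / 2 + θ) (Real.pi / 2 + θ') hv hv'
    rw [hω] at this
    gcongr
  have : innerG ε θ ν v - innerG ε θ' ν' v' =
      ((Complex.I * (ν : ℂ)) • v - (Complex.I * (ν' : ℂ)) • v')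
      + ((phaseK (Real.pi / 2 + θ) v - phaseK (Real.pi / 2) v)
      - (phaseK (Real.pi / 2 + θ') v' - phaseK (Real.pi / 2) v'))
      + (ephase (Real.pi / 2 + θ) 1 • unitTwo - ephase (Real.pi / 2 + θ') 1 • unitTwo)
      + (ε • remR ε (Real.pi / 2 + θ) v - ε • remR ε (Real.pi / 2 + θ') v') := by
    unfold innerG; abel
  rw [this]
  exact (norm_add_le_of_le (norm_add_le_of_le (norm_add_le_of_le h1 h2) h3) h4).trans (by linarith)

/-- A priori bound of the `v`-component of the fixed point map. -/
theorem norm_precond_innerG_le (ε θ ν : ℝ) (v : L1) :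
    ‖precond (innerG ε θ ν v)‖ ≤ 9 / 10 + 4 / 3 * ((|ν| + |θ|) * ‖v‖
      + |ε| * (4 * ‖opK v‖ + |ε| * (4 * ‖opK v‖ * ‖opK v‖))) := by
  have h1 : ‖(Complex.I * (ν : ℂ)) • v‖ ≤ |ν| * ‖v‖ := by
    rw [norm_smul, norm_mul, Complex.norm_I, one_mul, Complex.norm_real, Real.norm_eq_abs]
  have h2 := norm_phaseK_sub_le (Real.pi / 2 + θ) (Real.pi / 2) v
  rw [add_sub_cancel_left] at h2
  have h3 : ‖ε • remR ε (Real.pi / 2 + θ) v‖ ≤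
      |ε| * (4 * ‖opK v‖ + |ε| * (4 * ‖opK v‖ * ‖opK v‖)) := by
    rw [norm_smul, Real.norm_eq_abs]
    exact mul_le_mul_of_nonneg_left (norm_remR_le _ _ _) (abs_nonneg _)
  have : innerG ε θ ν v = ephase (Real.pi / 2 + θ) 1 • unitTwo + ((Complex.I * (ν : ℂ)) • v
      + (phaseK (Real.pi / 2 + θ) v - phaseK (Real.pi / 2) v)
      + ε • remR ε (Real.pi / 2 + θ) v) := by unfold innerG; abel
  rw [this, map_add]
  refine (norm_add_le_of_le (norm_precond_smul_unitTwo_le _ (norm_ephase _ _))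
    ((norm_precond_le _).trans (mul_le_mul_of_nonneg_left
      (norm_add_le_of_le (norm_add_le_of_le h1 h2) h3) (by norm_num)))).trans (by linarith)

theorem abs_sub_sin_sub_le {a b : ℝ} (ha : |a| ≤ 1 / 20) (hb : |b| ≤ 1 / 20) :
    |(a - Real.sin a) - (b - Real.sin b)| ≤ 1 / 100 * |a - b| := by
  have h : ∀ x ∈ Icc (-(1 / 20) : ℝ) (1 / 20), HasDerivWithinAt (fun x => x - Real.sin x)
      (1 - Real.cos x) (Icc (-(1 / 20)) (1 / 20)) x := fun x _ =>
    ((hasDerivAt_id x).sub (Real.hasDerivAt_sin x)).hasDerivWithinAt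
  have := Convex.norm_image_sub_le_of_norm_hasDerivWithin_le (C := 1 / 100) h (fun x hx => by
    rw [Real.norm_eq_abs, abs_of_nonneg (by linarith [Real.cos_le_one x])]
    nlinarith [Real.one_sub_sq_div_two_le_cos (x := x), hx.1, hx.2])
    (convex_Icc _ _) (abs_le.1 hb) (abs_le.1 ha)
  simpa [Real.norm_eq_abs] using this

theorem abs_cos_sub_cos_le {a b : ℝ} (ha : |a| ≤ 1 / 20) (hb : |b| ≤ 1 / 20) :
    |Real.cos a - Real.cos b| ≤ 1 / 20 * |a - b| := by
  have := Convex.norm_image_sub_le_of_norm_hasDerivWithin_le (C := 1 / 20)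
    (s := Icc (-(1 / 20) : ℝ) (1 / 20))
    (fun x _ => (Real.hasDerivAt_cos x).hasDerivWithinAt) (fun x hx => by
      rw [norm_neg, Real.norm_eq_abs]
      exact (Real.abs_sin_le_abs).trans (abs_le.2 hx))
    (convex_Icc _ _) (abs_le.1 hb) (abs_le.1 ha)
  simpa [Real.norm_eq_abs] using this

theorem abs_div_twenty_le {x : ℝ} (h : |x| ≤ 1) : |x / 20| ≤ 1 / 20 := by
  rw [abs_div, abs_of_pos (by norm_num : (0 : ℝ) < 20)]; linarith

/-- The inequalities are strict because the implicit function argument needs the fixed point in the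
interior of the box. The range `|ε| ≤ 0.11` exceeds that of the theorem so that `ε = 0.1` is an
interior parameter value. -/
theorem fixMap_mem_interior {ε : ℝ} (hε : |ε| ≤ 11 / 100) {x : ℝ × ℝ × L1} (hx : x ∈ fixDom) :
    |(fixMap ε x).1| < 1 ∧ |(fixMap ε x).2.1| < 1 ∧ ‖(fixMap ε x).2.2‖ < 17 / 10 := by
  obtain ⟨h1, h2, h3⟩ := hx
  set R := remR ε (Real.pi / 2 + x.1 / 20) x.2.2 with hR
  have hθ := abs_div_twenty_le h1
  have hν := abs_div_twenty_le h2
  have hK : ‖opK x.2.2‖ ≤ 17 / 20 := (norm_opK_le _).trans (by linarith)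
  have hK0 := norm_nonneg (opK x.2.2)
  have hε0 := abs_nonneg ε
  have hKK : ‖opK x.2.2‖ * ‖opK x.2.2‖ ≤ 17 / 20 * (17 / 20) := by gcongr
  -- `4 · 0.85 + 0.11 · 4 · 0.85² < 3.72`.
  have hb : 4 * ‖opK x.2.2‖ + |ε| * (4 * ‖opK x.2.2‖ * ‖opK x.2.2‖) ≤ 3.72 := by nlinarith
  have hR1 : ‖R 1‖ ≤ 3.72 := (l1_norm_apply_le _ 1).trans ((norm_remR_le _ _ _).trans hb)
  have hε2 : ε ^ 2 ≤ 0.0121 := by rw [← sq_abs]; nlinarith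
  have hre : |ε ^ 2 * (R 1).re| ≤ 0.0121 * 3.72 := by
    rw [abs_mul, abs_of_nonneg (sq_nonneg ε)]
    exact mul_le_mul hε2 ((Complex.abs_re_le_norm _).trans hR1) (abs_nonneg _) (by norm_num)
  have him : |ε ^ 2 * (R 1).im| ≤ 0.0121 * 3.72 := by
    rw [abs_mul, abs_of_nonneg (sq_nonneg ε)]
    exact mul_le_mul hε2 ((Complex.abs_im_le_norm _).trans hR1) (abs_nonneg _) (by norm_num)
  rw [abs_le] at hre him
  refine ⟨?_, ?_, ?_⟩
  · have h := abs_sub_sin_sub_le hθ (b := 0) (by norm_num)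
    simp only [Real.sin_zero, sub_zero] at h
    have h' := abs_le.1 (h.trans (mul_le_mul_of_nonneg_left hθ (by norm_num)))
    simp only [fixMap, ← hR]
    rw [abs_lt]
    constructor <;> linarith
  · have h := abs_cos_sub_cos_le hθ (b := 0) (by norm_num)
    simp only [Real.cos_zero, sub_zero] at h
    have h' := abs_le.1 (h.trans (mul_le_mul_of_nonneg_left hθ (by norm_num)))
    simp only [fixMap, ← hR]
    rw [abs_lt]
    constructor <;> linarith
  · simp only [fixMap, norm_neg]
    refine (norm_precond_innerG_le _ _ _ _).trans_lt ?_
    have e1 : (|x.2.1 / 20| + |x.1 / 20|) * ‖x.2.2‖ ≤ (1 / 20 + 1 / 20) * (17 / 10) := by gcongr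
    have e2 : |ε| * (4 * ‖opK x.2.2‖ + |ε| * (4 * ‖opK x.2.2‖ * ‖opK x.2.2‖)) ≤
        11 / 100 * 3.72 := by gcongr
    linarith

theorem fixMap_mem {ε : ℝ} (hε : |ε| ≤ 11 / 100) {x : ℝ × ℝ × L1} (hx : x ∈ fixDom) :
    fixMap ε x ∈ fixDom :=
  have h := fixMap_mem_interior hε hx
  ⟨h.1.le, h.2.1.le, h.2.2.le⟩

theorem fixMap_lipschitz {ε : ℝ} (hε : |ε| ≤ 11 / 100) {x y : ℝ × ℝ × L1} (hx : x ∈ fixDom)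
    (hy : y ∈ fixDom) : ‖fixMap ε x - fixMap ε y‖ ≤ 9 / 10 * ‖x - y‖ := by
  obtain ⟨h1, h2, h3⟩ := hx
  obtain ⟨g1, g2, g3⟩ := hy
  have hθ := abs_div_twenty_le h1
  have hν := abs_div_twenty_le h2
  have gθ := abs_div_twenty_le g1
  have hε0 := abs_nonneg ε
  have hε2 : ε ^ 2 ≤ 0.0121 := by rw [← sq_abs]; nlinarith
  set D := ‖x - y‖ with hD
  have hD0 : 0 ≤ D := norm_nonneg _
  -- The scaling by 20 pays off here: changes of `θ` and `ν` enter the `v`-component with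
  -- coefficients larger than 1, which are divided by 20. The price, a factor 20 in the scalar
  -- components, is harmless since these carry `ε²`, or a derivative that is small for `|θ| ≤ 1/20`.
  have d1 : |x.1 / 20 - y.1 / 20| ≤ D / 20 := by
    rw [← sub_div, abs_div, abs_of_pos (by norm_num : (0 : ℝ) < 20)]
    have : |x.1 - y.1| ≤ D := norm_fst_le (x - y)
    linarith
  have d2 : |x.2.1 / 20 - y.2.1 / 20| ≤ D / 20 := by
    rw [← sub_div, abs_div, abs_of_pos (by norm_num : (0 : ℝ) < 20)]
    have : |x.2.1 - y.2.1| ≤ D := (norm_fst_le (x - y).2).trans (norm_snd_le (x - y))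
    linarith
  have d3 : ‖x.2.2 - y.2.2‖ ≤ D := (norm_snd_le (x - y).2).trans (norm_snd_le (x - y))
  have hQ : |ε| * (2 * (17 / 10) * ‖x.2.2 - y.2.2‖
      + 2 * (17 / 10) ^ 2 * |x.1 / 20 - y.1 / 20|) ≤ 0.11 * (3.4 * D + 5.78 * (D / 20)) := by
    gcongr <;> norm_num; assumption
  have hRR : 2 * ‖x.2.2 - y.2.2‖ + 3 * (17 / 10) * |x.1 / 20 - y.1 / 20|
      + |ε| * (2 * (17 / 10) * ‖x.2.2 - y.2.2‖
      + 2 * (17 / 10) ^ 2 * |x.1 / 20 - y.1 / 20|) ≤ 2.661 * D := by linarith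
  have hR : ‖remR ε (Real.pi / 2 + x.1 / 20) x.2.2 - remR ε (Real.pi / 2 + y.1 / 20) y.2.2‖ ≤
      2.661 * D := by
    refine (norm_remR_sub_le ε _ _ h3 g3).trans ?_
    rwa [add_sub_add_left_eq_sub]
  set S := remR ε (Real.pi / 2 + x.1 / 20) x.2.2
  set S' := remR ε (Real.pi / 2 + y.1 / 20) y.2.2
  have hR1 : ‖S 1 - S' 1‖ ≤ 2.661 * D := (l1_norm_apply_le (S - S') 1).trans hR
  have hre : |ε ^ 2 * ((S 1).re - (S' 1).re)| ≤ 0.0121 * (2.661 * D) := by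
    rw [abs_mul, abs_of_nonneg (sq_nonneg ε)]
    exact mul_le_mul hε2 ((Complex.abs_re_le_norm (S 1 - S' 1)).trans hR1) (abs_nonneg _)
      (by norm_num)
  have him : |ε ^ 2 * ((S 1).im - (S' 1).im)| ≤ 0.0121 * (2.661 * D) := by
    rw [abs_mul, abs_of_nonneg (sq_nonneg ε)]
    exact mul_le_mul hε2 ((Complex.abs_im_le_norm (S 1 - S' 1)).trans hR1) (abs_nonneg _)
      (by norm_num)
  rw [abs_le] at hre him
  have r1 : |(fixMap ε x).1 - (fixMap ε y).1| ≤ 9 / 10 * D := by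
    have h' := abs_le.1 ((abs_sub_sin_sub_le hθ gθ).trans
      (mul_le_mul_of_nonneg_left d1 (by norm_num)))
    simp only [fixMap]
    rw [abs_le]
    constructor <;> linarith
  have r2 : |(fixMap ε x).2.1 - (fixMap ε y).2.1| ≤ 9 / 10 * D := by
    have h' := abs_le.1 ((abs_cos_sub_cos_le hθ gθ).trans
      (mul_le_mul_of_nonneg_left d1 (by norm_num)))
    simp only [fixMap]
    rw [abs_le]
    constructor <;> linarith
  have r3 : ‖(fixMap ε x).2.2 - (fixMap ε y).2.2‖ ≤ 9 / 10 * D := by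
    have e : (fixMap ε x).2.2 - (fixMap ε y).2.2 = -precond (innerG ε (x.1 / 20) (x.2.1 / 20) x.2.2
        - innerG ε (y.1 / 20) (y.2.1 / 20) y.2.2) := by simp only [fixMap, map_sub]; abel
    rw [e, norm_neg]
    refine (norm_precond_le _).trans ?_
    have hG := norm_innerG_sub_le ε (x.1 / 20) (y.1 / 20) (x.2.1 / 20) (y.2.1 / 20) h3 g3
    have e1 : (|x.2.1 / 20| + |x.1 / 20|) * ‖x.2.2 - y.2.2‖ ≤ (1 / 20 + 1 / 20) * D := by gcongr
    have e2 := mul_le_mul hε hRR (by positivity) (by norm_num)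
    linarith
  exact max_le r1 (max_le r2 r3)

/-- The fixed point map is a contraction of its domain. -/
theorem contractingWith_fixMap {ε : ℝ} (hε : |ε| ≤ 11 / 100) :
    ContractingWith (9 / 10) (MapsTo.restrict (fixMap ε) fixDom fixDom fun _ => fixMap_mem hε) := by
  refine ⟨?_, LipschitzWith.of_dist_le_mul fun x y => ?_⟩
  · rw [← NNReal.coe_lt_coe]; norm_num
  · have := fixMap_lipschitz hε x.2 y.2
    rw [Subtype.dist_eq, Subtype.dist_eq, dist_eq_norm, dist_eq_norm]
    have e : ((9 / 10 : NNReal) : ℝ) = 9 / 10 := by norm_num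
    rw [e]
    exact this

theorem exists_fixedPoint {ε : ℝ} (hε : |ε| ≤ 11 / 100) :
    ∃ x ∈ fixDom, fixMap ε x = x := by
  have h0 : (0 : ℝ × ℝ × L1) ∈ fixDom := by simp [fixDom]; norm_num
  obtain ⟨y, hy, hfy, -⟩ := ContractingWith.exists_fixedPoint' isClosed_fixDom.isComplete
    (fun _ => fixMap_mem hε) (contractingWith_fixMap hε) h0 (edist_ne_top _ _)
  exact ⟨y, hy, hfy⟩

theorem fixedPoint_unique {ε : ℝ} (hε : |ε| ≤ 11 / 100) {x y : ℝ × ℝ × L1} (hx : x ∈ fixDom)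
    (hy : y ∈ fixDom) (hfx : fixMap ε x = x) (hfy : fixMap ε y = y) : x = y := by
  have := fixMap_lipschitz hε hx hy
  rw [hfx, hfy] at this
  have h0 : ‖x - y‖ = 0 := le_antisymm (by linarith) (norm_nonneg _)
  exact sub_eq_zero.1 (norm_eq_zero.1 h0)

/-! ### The branch of fixed points and its smoothness -/

open Classical in
/-- The branch of fixed points. -/
def branch (ε : ℝ) : ℝ × ℝ × L1 :=
  if h : |ε| ≤ 11 / 100 then (exists_fixedPoint h).choose else 0

theorem branch_mem {ε : ℝ} (hε : |ε| ≤ 11 / 100) : branch ε ∈ fixDom := by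
  rw [branch, dif_pos hε]; exact (exists_fixedPoint hε).choose_spec.1

theorem fixMap_branch {ε : ℝ} (hε : |ε| ≤ 11 / 100) : fixMap ε (branch ε) = branch ε := by
  rw [branch, dif_pos hε]; exact (exists_fixedPoint hε).choose_spec.2

theorem eq_branch {ε : ℝ} (hε : |ε| ≤ 11 / 100) {x : ℝ × ℝ × L1} (hx : x ∈ fixDom)
    (h : fixMap ε x = x) : x = branch ε :=
  fixedPoint_unique hε hx (branch_mem hε) h (fixMap_branch hε)

/-- A branch of fixed points in the interior of the domain of contraction is as smooth as the
map. -/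
theorem contDiffAt_of_fixedPoint {X : Type*} [NormedAddCommGroup X] [NormedSpace ℝ X]
    [CompleteSpace X] {f : ℝ → X → X} {g : ℝ → X} {s : Set X} {ε κ : ℝ} (hκ : κ < 1)
    (hf : ContDiffAt ℝ 1 (fun p : ℝ × X => f p.1 p.2) (ε, g ε)) (hs : s ∈ 𝓝 (g ε))
    (hlip : ∀ x ∈ s, ∀ y ∈ s, ‖f ε x - f ε y‖ ≤ κ * ‖x - y‖) (hfix : f ε (g ε) = g ε)
    (huniq : ∀ᶠ e in 𝓝 ε, ∀ x ∈ s, f e x = x → x = g e) : ContDiffAt ℝ 1 g ε := by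
  let F : ℝ × X → X := fun p => p.2 - f p.1 p.2
  have hF : ContDiffAt ℝ 1 F (ε, g ε) := contDiffAt_snd.sub hf
  have hκ0 : 0 ≤ max κ 0 := le_max_right _ _
  have hd := hf.differentiableAt one_ne_zero |>.hasFDerivAt
  set A := fderiv ℝ (fun p : ℝ × X => f p.1 p.2) (ε, g ε) with hA
  have hd2 : HasFDerivAt (f ε) (A ∘L .inr ℝ ℝ X) (g ε) :=
    hd.comp (g ε) (hasFDerivAt_prodMk_right ε (g ε))
  -- A Lipschitz bound near the point bounds the partial derivative in `x`, so `1 - ∂ₓ f` is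
  -- inverted by a Neumann series.
  have hnorm : ‖A ∘L .inr ℝ ℝ X‖ ≤ max κ 0 := by
    refine hd2.le_of_lip' hκ0 ?_
    filter_upwards [hs] with x hx
    exact (hlip x hx _ (mem_of_mem_nhds hs)).trans
      (mul_le_mul_of_nonneg_right (le_max_left _ _) (norm_nonneg _))
  have hlt : ‖A ∘L .inr ℝ ℝ X‖ < 1 := hnorm.trans_lt (max_lt hκ one_pos)
  have hFd : fderiv ℝ F (ε, g ε) = .snd ℝ ℝ X - A :=
    (hasFDerivAt_snd.sub hd).fderiv
  have hinv : (fderiv ℝ F (ε, g ε) ∘L .inr ℝ ℝ X).IsInvertible := by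
    have e : fderiv ℝ F (ε, g ε) ∘L .inr ℝ ℝ X = 1 - A ∘L .inr ℝ ℝ X := by
      rw [hFd, ContinuousLinearMap.sub_comp, ContinuousLinearMap.snd_comp_inr]; rfl
    rw [e]
    exact ⟨ContinuousLinearEquiv.unitsEquiv ℝ X (Units.oneSub _ hlt), rfl⟩
  have h1 := hF.contDiffAt_implicitFunction one_ne_zero hinv
  refine h1.congr_of_eventuallyEq ?_
  have h2 := hF.eventually_apply_implicitFunction one_ne_zero hinv
  have h3 := h1.continuousAt.tendsto
  have h4 : hF.implicitFunction one_ne_zero hinv ε = g ε :=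
    hF.implicitFunction_apply_self one_ne_zero hinv
  have hs' : s ∈ 𝓝 (hF.implicitFunction one_ne_zero hinv (ε, g ε).1) := by
    show s ∈ 𝓝 (hF.implicitFunction one_ne_zero hinv ε)
    rwa [h4]
  -- The implicit function is continuous and hence stays in `s`, where uniqueness of the fixed point
  -- identifies it with `g`. Continuity of `g` is not presupposed.
  filter_upwards [h2, h3 hs', huniq] with e e1 e2 e3
  refine (e3 _ e2 ?_).symm
  have : F (e, hF.implicitFunction one_ne_zero hinv e) = 0 := by
    rw [e1]; simp [F, hfix]
  exact (sub_eq_zero.1 this).symm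

theorem contDiffAt_branch {ε : ℝ} (hε : |ε| < 11 / 100) : ContDiffAt ℝ 1 branch ε := by
  refine contDiffAt_of_fixedPoint (f := fixMap) (s := fixDom) (κ := 9 / 10) (by norm_num)
    contDiff_fixMap.contDiffAt ?_ (fun x hx y hy => fixMap_lipschitz hε.le hx hy)
    (fixMap_branch hε.le) ?_
  · have h := fixMap_mem_interior hε.le (branch_mem hε.le)
    rw [fixMap_branch hε.le] at h
    have h1 : Continuous fun x : ℝ × ℝ × L1 => |x.1| := by fun_prop
    have h2 : Continuous fun x : ℝ × ℝ × L1 => |x.2.1| := by fun_prop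
    have h3 : Continuous fun x : ℝ × ℝ × L1 => ‖x.2.2‖ := by fun_prop
    filter_upwards [h1.continuousAt.eventually_lt continuousAt_const h.1,
      h2.continuousAt.eventually_lt continuousAt_const h.2.1,
      h3.continuousAt.eventually_lt continuousAt_const h.2.2] with x e1 e2 e3
    exact ⟨e1.le, e2.le, e3.le⟩
  · filter_upwards [continuous_abs.continuousAt.eventually_lt continuousAt_const hε] with e he x hx hfx
    exact eq_branch he.le hx hfx

/-! ### Equivalence of `F = 0` and the fixed point equation -/

theorem ephase_one_add (θ : ℝ) :
    ephase (Real.pi / 2 + θ) 1 = ⟨-Real.sin θ, -Real.cos θ⟩ := by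
  have h : -Complex.I * ((1 : ℕ) : ℂ) * ((Real.pi / 2 + θ : ℝ) : ℂ) =
      ((-(Real.pi / 2 + θ) : ℝ) : ℂ) * Complex.I := by push_cast; ring
  rw [ephase, h]
  apply Complex.ext
  · rw [Complex.exp_ofReal_mul_I_re, Real.cos_neg, add_comm, Real.cos_add_pi_div_two]
  · rw [Complex.exp_ofReal_mul_I_im, Real.sin_neg, add_comm, Real.sin_add_pi_div_two]

theorem phaseK_coe (ω : ℝ) (v : L1) : (phaseK ω v : ℕ → ℂ) = opU ω (opK v) := by
  funext k; exact phaseK_apply ω v k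

theorem exp_neg_I_mul (ω : ℝ) : Complex.exp (-Complex.I * (ω : ℂ)) = ephase ω 1 := by
  simp [ephase]

theorem exp_I_mul (ω : ℝ) : Complex.exp (Complex.I * (ω : ℂ)) = ephase (-ω) 1 := by
  simp [ephase]

theorem remR_apply (ε ω : ℝ) (v : L1) (k : ℕ) :
    remR ε ω v k = opL ω (opK v) k + ε * seqConv (opU ω (opK v)) (opK v) k := by
  simp only [remR, l1_add_apply, l1_smul_apply, l1_real_smul_apply, shiftUpL_apply,
    shiftDownL_apply, convL_apply, phaseK_coe, opL, exp_neg_I_mul, exp_I_mul]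
  by_cases h : 2 ≤ k
  · simp only [shiftUp, shiftDown, if_pos h]; ring
  · simp only [shiftUp, shiftDown, if_neg h]; ring

/-- After the factor `α` is taken out, the parameter enters only through `λ = ω/α`, and `ε` cancels
from all modes `k ≥ 2`. This makes the problem regular at `ε = 0`. -/
theorem mapF_smul_opK (ε α ω : ℝ) (hα : α ≠ 0) (v : L1) (k : ℕ) :
    mapF ε α ω (ε • opK v : L1) k = α * ((Complex.I * ((ω / α : ℝ) : ℂ) + ephase ω 1) * basisSeq 1 k
      + ε * ((Complex.I * k * ((ω / α : ℝ) : ℂ) + ephase ω k) * opK v k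
        + ephase ω 1 * basisSeq 2 k + ε * remR ε ω v k)) := by
  have hc : ((ε • opK v : L1) : ℕ → ℂ) = fun k => (ε : ℂ) * opK v k := by
    funext k; simp
  have hU : opU ω (ε • opK v : L1) = (ε • phaseK ω v : L1) := by
    funext k; rw [hc, l1_real_smul_apply, phaseK_coe]; simp only [opU]; ring
  have hconv : seqConv (opU ω (ε • opK v : L1)) (ε • opK v : L1) k =
      ε * (ε * seqConv (opU ω (opK v)) (opK v) k) := by
    rw [hU, ← convL_apply]
    simp [phaseK_coe]
  have hL : opL ω (ε • opK v : L1) k = ε * opL ω (opK v) k := by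
    rw [hc]
    simp only [opL, shiftUp, shiftDown, opU]
    split_ifs <;> ring
  have hα' : (α : ℂ) ≠ 0 := by exact_mod_cast hα
  rw [mapF, hconv, hL, remR_apply, exp_neg_I_mul, hc]
  simp only [invK, opU, ← ephase.eq_1]
  push_cast
  field_simp
  ring

/-- The equation `F = 0` in the rescaled unknowns `θ = ω - π/2`, `lam = ω/α`, `c = ε K v`. -/
structure ReducedZero (ε θ lam : ℝ) (v : L1) : Prop where
  v_zero : v 0 = 0
  v_one : v 1 = 0
  mode_one : Complex.I * (lam : ℂ) + ephase (Real.pi / 2 + θ) 1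
    + ε ^ 2 * remR ε (Real.pi / 2 + θ) v 1 = 0
  mode : ∀ k : ℕ, 2 ≤ k → (Complex.I * k * (lam : ℂ) + ephase (Real.pi / 2 + θ) k) * opK v k
    + ephase (Real.pi / 2 + θ) 1 * basisSeq 2 k + ε * remR ε (Real.pi / 2 + θ) v k = 0

/-- Since `e^{-i(π/2 + θ)} = -sin θ - i cos θ`, the real part involves only `θ` and the imaginary
part is solved explicitly for `λ`. -/
theorem mode_one_iff (ε θ lam : ℝ) (r : ℂ) :
    Complex.I * (lam : ℂ) + ephase (Real.pi / 2 + θ) 1 + ε ^ 2 * r = 0 ↔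
      Real.sin θ = ε ^ 2 * r.re ∧ lam = Real.cos θ - ε ^ 2 * r.im := by
  rw [ephase_one_add, Complex.ext_iff]
  have h : ((ε : ℂ) ^ 2) = ((ε ^ 2 : ℝ) : ℂ) := by push_cast; rfl
  rw [h]
  simp only [Complex.add_re, Complex.add_im, Complex.mul_re, Complex.mul_im, Complex.I_re,
    Complex.I_im, Complex.ofReal_re, Complex.ofReal_im, Complex.zero_re, Complex.zero_im]
  constructor
  · rintro ⟨h1, h2⟩; constructor <;> linarith
  · rintro ⟨h1, h2⟩; constructor <;> linarith

theorem innerG_apply (ε θ ν : ℝ) (v : L1) (k : ℕ) :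
    innerG ε θ ν v k = Complex.I * ν * v k
      + (ephase (Real.pi / 2 + θ) k - ephase (Real.pi / 2) k) * opK v k
      + ephase (Real.pi / 2 + θ) 1 * basisSeq 2 k + ε * remR ε (Real.pi / 2 + θ) v k := by
  simp only [innerG, l1_add_apply, l1_sub_apply, l1_smul_apply, l1_real_smul_apply, phaseK_apply,
    unitTwo_apply]
  ring

/-- Multiplication by `(ik + e^{-ikπ/2})/k`, nonzero by `le_norm_precond`, undoes the preconditioner
in the mode `k ≥ 2`. The preconditioner annihilates the indices 0 and 1, so a fixed point has `v 0 =
v 1 = 0`. -/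
theorem neg_precond_innerG_eq_iff (ε θ ν : ℝ) (v : L1) :
    -precond (innerG ε θ ν v) = v ↔ v 0 = 0 ∧ v 1 = 0 ∧ ∀ k : ℕ, 2 ≤ k →
      (Complex.I * k * ((1 + ν : ℝ) : ℂ) + ephase (Real.pi / 2 + θ) k) * opK v k
      + ephase (Real.pi / 2 + θ) 1 * basisSeq 2 k + ε * remR ε (Real.pi / 2 + θ) v k = 0 := by
  have key : ∀ k : ℕ, 2 ≤ k → ((-precond (innerG ε θ ν v)) k = v k ↔
      (Complex.I * k * ((1 + ν : ℝ) : ℂ) + ephase (Real.pi / 2 + θ) k) * opK v k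
      + ephase (Real.pi / 2 + θ) 1 * basisSeq 2 k + ε * remR ε (Real.pi / 2 + θ) v k = 0) := by
    intro k hk
    have hk0 : (k : ℂ) ≠ 0 := by exact_mod_cast (by omega : k ≠ 0)
    have hd : Complex.I * k + ephase (Real.pi / 2) k ≠ 0 := by
      rw [← norm_pos_iff]
      have h2 : (0 : ℝ) < k := by exact_mod_cast (by omega : 0 < k)
      linarith [le_norm_precond hk]
    have hz : v k = k * opK v k := by rw [opK_apply, if_pos hk]; field_simp
    have e : (-precond (innerG ε θ ν v)) k = -(k / (Complex.I * k + ephase (Real.pi / 2) k)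
        * innerG ε θ ν v k) := by
      simp [precond, hk]
    rw [e, innerG_apply, hz, ← sub_eq_zero, ← mul_right_inj' (neg_ne_zero.2 (div_ne_zero hd hk0)),
      mul_zero]
    refine Eq.congr_left ?_
    push_cast
    field_simp
    ring
  constructor
  · intro h
    have e0 : (-precond (innerG ε θ ν v)) 0 = 0 := by simp [precond]
    have e1 : (-precond (innerG ε θ ν v)) 1 = 0 := by simp [precond]
    rw [h] at e0 e1
    exact ⟨e0, e1, fun k hk => (key k hk).1 (by rw [h])⟩
  · rintro ⟨h0, h1, h⟩
    refine l1_ext fun k => ?_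
    by_cases hk : 2 ≤ k
    · exact (key k hk).2 (h k hk)
    · obtain rfl | rfl : k = 0 ∨ k = 1 := by omega
      · simp [precond, h0]
      · simp [precond, h1]

/-- The equation `sin θ = ε² Re R₁` is used in the form `θ = (θ - sin θ) + ε² Re R₁`, whose
right-hand side is flat in `θ` near 0. -/
theorem reducedZero_iff (ε : ℝ) (x : ℝ × ℝ × L1) :
    ReducedZero ε (x.1 / 20) (1 + x.2.1 / 20) x.2.2 ↔ fixMap ε x = x := by
  obtain ⟨p, q, v⟩ := x
  have h1 := mode_one_iff ε (p / 20) (1 + q / 20) (remR ε (Real.pi / 2 + p / 20) v 1)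
  have h2 := neg_precond_innerG_eq_iff ε (p / 20) (q / 20) v
  simp only [fixMap, Prod.mk.injEq]
  rw [h2]
  constructor
  · rintro ⟨a, b, c, d⟩
    obtain ⟨e, f⟩ := h1.1 c
    exact ⟨by linarith, by linarith, a, b, d⟩
  · rintro ⟨e, f, a, b, d⟩
    exact ⟨a, b, h1.2 ⟨by linarith, by linarith⟩, d⟩

theorem ReducedZero.mapF_eq_zero {ε θ lam : ℝ} {v : L1} (h : ReducedZero ε θ lam v)
    (hlam : lam ≠ 0) (hω : Real.pi / 2 + θ ≠ 0) (k : ℕ) (hk : 1 ≤ k) :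
    mapF ε ((Real.pi / 2 + θ) / lam) (Real.pi / 2 + θ) (ε • opK v : L1) k = 0 := by
  rw [mapF_smul_opK _ _ _ (div_ne_zero hω hlam), div_div_cancel₀ hω]
  obtain rfl | hk : k = 1 ∨ 2 ≤ k := by omega
  · have h1 := h.mode_one
    have hz : opK v 1 = 0 := by simp [opK_apply]
    rw [hz]
    simp only [basisSeq, if_true, OfNat.one_ne_ofNat, if_false]
    linear_combination (((Real.pi / 2 + θ) / lam : ℝ) : ℂ) * h1
  · have h1 := h.mode k hk
    have hb : basisSeq 1 k = 0 := by simp [basisSeq]; omega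
    rw [h1, hb]; simp

theorem reducedZero_of_mapF {ε α ω : ℝ} (hε : ε ≠ 0) (hα : α ≠ 0) {v : L1} (h0 : v 0 = 0)
    (h1 : v 1 = 0) (h : ∀ k : ℕ, 1 ≤ k → mapF ε α ω (ε • opK v : L1) k = 0) :
    ReducedZero ε (ω - Real.pi / 2) (ω / α) v := by
  have hα' : (α : ℂ) ≠ 0 := by exact_mod_cast hα
  have hε' : (ε : ℂ) ≠ 0 := by exact_mod_cast hε
  have e : Real.pi / 2 + (ω - Real.pi / 2) = ω := by ring
  refine ⟨h0, h1, ?_, fun k hk => ?_⟩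
  · have h2 := h 1 le_rfl
    rw [mapF_smul_opK _ _ _ hα, mul_eq_zero, or_iff_right hα'] at h2
    have hz : opK v 1 = 0 := by simp [opK_apply]
    rw [hz] at h2
    simp only [basisSeq, if_true, OfNat.one_ne_ofNat, if_false] at h2
    rw [e]
    linear_combination h2
  · have h2 := h k (by omega)
    have hb : basisSeq 1 k = 0 := by simp [basisSeq]; omega
    rw [mapF_smul_opK _ _ _ hα, mul_eq_zero, or_iff_right hα', hb, mul_zero, zero_add,
      mul_eq_zero, or_iff_right hε'] at h2
    rw [e]
    exact h2

/-! ### The remainder mode by mode -/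

theorem symExt_smul_unitTwo_of_ne (x : ℂ) {j : ℤ} (h : j ≠ 2) (h' : j ≠ -2) :
    symExt (x • unitTwo : L1) j = 0 := by
  have e : ∀ n : ℕ, n ≠ 2 → (x • unitTwo : L1) n = 0 := fun n hn => by
    simp [unitTwo_apply, basisSeq, hn]
  have hn : j.natAbs ≠ 2 := by omega
  simp [symExt, e _ hn]

theorem seqConv_unitTwo_eq_zero (x y : ℂ) {k : ℕ} (h0 : k ≠ 0) (h4 : k ≠ 4) :
    seqConv (x • unitTwo : L1) (y • unitTwo : L1) k = 0 := by
  have : ∀ j : ℤ, symExt (x • unitTwo : L1) j * symExt (y • unitTwo : L1) ((k : ℤ) - j) = 0 := by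
    intro j
    by_cases hj : j = 2 ∨ j = -2
    · rw [symExt_smul_unitTwo_of_ne y (j := (k : ℤ) - j) (by omega) (by omega), mul_zero]
    · rw [symExt_smul_unitTwo_of_ne x (by tauto) (by tauto), zero_mul]
  rw [seqConv, tsum_congr this, tsum_zero]

theorem seqConv_unitTwo_four (x y : ℂ) :
    seqConv (x • unitTwo : L1) (y • unitTwo : L1) 4 = x * y := by
  rw [seqConv, tsum_eq_single (2 : ℤ)]
  · simp [symExt, unitTwo_apply, basisSeq]
  · intro j hj
    by_cases hj' : j = -2
    · rw [symExt_smul_unitTwo_of_ne y (j := ((4 : ℕ) : ℤ) - j) (by omega) (by omega), mul_zero]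
    · rw [symExt_smul_unitTwo_of_ne x hj hj', zero_mul]

/-- The mass of a sequence in the indices `k ≥ 4`. -/
def tailFour (z : L1) : ℝ := ∑' k, ‖z (k + 4)‖

theorem tailFour_nonneg (z : L1) : 0 ≤ tailFour z := tsum_nonneg fun _ => norm_nonneg _

theorem summable_tail (z : L1) (n : ℕ) : Summable fun k => ‖z (k + n)‖ :=
  (summable_nat_add_iff n).2 (l1_summable z)

theorem norm_eq_add_tailFour (z : L1) (h0 : z 0 = 0) (h1 : z 1 = 0) :
    ‖z‖ = ‖z 2‖ + ‖z 3‖ + tailFour z := by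
  have := (l1_summable z).sum_add_tsum_nat_add 4
  rw [l1_norm_eq, ← this, tailFour]
  simp [Finset.sum_range_succ, h0, h1]

/-- The part of the convolution that does not come from the second harmonic alone. -/
theorem exists_conv_split (ω : ℝ) (v : L1) :
    ∃ S : L1, ‖S‖ ≤ 4 * (2 * ‖opK v 2‖ * (‖opK v 3‖ + tailFour (opK v))
        + (‖opK v 3‖ + tailFour (opK v)) ^ 2) ∧
      (∀ k : ℕ, k ≠ 0 → k ≠ 4 → seqConv (opU ω (opK v)) (opK v) k = S k) ∧
      seqConv (opU ω (opK v)) (opK v) 4 = ephase ω 2 * opK v 2 * opK v 2 + S 4 := by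
  set z := opK v with hz
  have z0 : z 0 = 0 := by simp [hz, opK_apply]
  have z1 : z 1 = 0 := by simp [hz, opK_apply]
  set t := ‖z 3‖ + tailFour z with ht
  have ht0 : 0 ≤ t := add_nonneg (norm_nonneg _) (tailFour_nonneg z)
  -- `z'` and `w'` are the second harmonics of `z` and of `U_ω z`. Their convolution lives in the
  -- modes `0` and `±4`, so all the rest carries a factor `z - z'` or `U_ω z - w'`, whose norm is
  -- the mass in the modes `k ≥ 3`. For a zero this mass is of order `ε`, which gains a power of `ε`
  -- in the modes 1, 2, 3.
  let z' : L1 := z 2 • unitTwo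
  let w' : L1 := (ephase ω 2 * z 2) • unitTwo
  have e0 : ∀ k, (z - z') k = if k = 2 then 0 else z k := fun k => by
    simp only [z', l1_sub_apply, l1_smul_apply, unitTwo_apply, basisSeq]
    by_cases h : k = 2 <;> simp [h]
  have e1 : ∀ k, (phaseK ω v - w') k = if k = 2 then 0 else ephase ω k * z k := fun k => by
    simp only [w', l1_sub_apply, l1_smul_apply, unitTwo_apply, basisSeq, phaseK_apply, ← hz]
    by_cases h : k = 2 <;> simp [h]
  have n0 : ‖z - z'‖ = t := by
    rw [norm_eq_add_tailFour _ (by rw [e0]; simp [z0]) (by rw [e0]; simp [z1]), e0, e0, tailFour]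
    simp only [e0]
    simp [ht, tailFour]
  have n1 : ‖phaseK ω v - w'‖ = t := by
    rw [norm_eq_add_tailFour _ (by rw [e1]; simp [z0]) (by rw [e1]; simp [z1]), e1, e1, tailFour]
    simp only [e1]
    simp [ht, tailFour]
  have n2 : ‖w'‖ = ‖z 2‖ := by simp [w', norm_smul, norm_unitTwo]
  have n3 : ‖z‖ = ‖z 2‖ + t := by rw [norm_eq_add_tailFour z z0 z1, ht, add_assoc]
  have hsplit : convL (phaseK ω v) z = convL w' z' + (convL w' (z - z')
      + convL (phaseK ω v - w') z) := by
    simp only [map_sub, sub_apply]; abel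
  have hval : ∀ k, seqConv (opU ω z) z k = convL w' z' k + (convL w' (z - z')
      + convL (phaseK ω v - w') z) k := fun k => by
    rw [← l1_add_apply, ← hsplit, convL_apply, phaseK_coe]
  refine ⟨convL w' (z - z') + convL (phaseK ω v - w') z, ?_, fun k h0 h4 => ?_, ?_⟩
  · refine (norm_add_le_of_le (norm_convL_le _ _) (norm_convL_le _ _)).trans ?_
    rw [n0, n1, n2, n3]
    apply le_of_eq; ring
  · rw [hval, convL_apply, seqConv_unitTwo_eq_zero _ _ h0 h4, zero_add]
  · rw [hval, convL_apply, seqConv_unitTwo_four]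

theorem ephase_pi_div_two_one : ephase (Real.pi / 2) 1 = -Complex.I := by
  have := ephase_one_add 0
  rw [add_zero] at this
  rw [this]; apply Complex.ext <;> simp

theorem ephase_neg_pi_div_two_one : ephase (-(Real.pi / 2)) 1 = Complex.I := by
  have h : -Complex.I * ((1 : ℕ) : ℂ) * ((-(Real.pi / 2) : ℝ) : ℂ) =
      Real.pi / 2 * Complex.I := by push_cast; ring
  rw [ephase, h, Complex.exp_pi_div_two_mul_I]

theorem norm_ephase_sub_pi_le (θ : ℝ) (k : ℕ) :
    ‖ephase (Real.pi / 2 + θ) k - ephase (Real.pi / 2) k‖ ≤ k * |θ| := by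
  have := norm_ephase_sub_le (Real.pi / 2 + θ) (Real.pi / 2) k
  rwa [add_sub_cancel_left] at this

theorem norm_ephase_neg_sub_pi_le (θ : ℝ) :
    ‖ephase (-(Real.pi / 2 + θ)) 1 - Complex.I‖ ≤ |θ| := by
  have := norm_ephase_sub_le (-(Real.pi / 2 + θ)) (-(Real.pi / 2)) 1
  rw [ephase_neg_pi_div_two_one] at this
  have e : |-(Real.pi / 2 + θ) - -(Real.pi / 2)| = |θ| := by
    rw [← abs_neg]; congr 1; ring
  rw [e, Nat.cast_one, one_mul] at this
  exact this

theorem norm_I_sub_one : ‖Complex.I - 1‖ = √2 := by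
  rw [Complex.norm_def]; congr 1; norm_num [Complex.normSq_apply]

theorem ephase_eq_pow (ω : ℝ) (k : ℕ) : ephase ω k = ephase ω 1 ^ k := by
  rw [ephase, ephase, ← Complex.exp_nat_mul]; congr 1; push_cast; ring

theorem norm_coef_down_two (θ : ℝ) :
    ‖ephase (-(Real.pi / 2 + θ)) 1 + ephase (Real.pi / 2 + θ) 2 - (Complex.I - 1)‖ ≤ 3 * |θ| := by
  have h1 := norm_ephase_neg_sub_pi_le θ
  have h2 := norm_ephase_sub_pi_le θ 2
  rw [ephase_pi_div_two_two] at h2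
  have e : ephase (-(Real.pi / 2 + θ)) 1 + ephase (Real.pi / 2 + θ) 2 - (Complex.I - 1) =
    (ephase (-(Real.pi / 2 + θ)) 1 - Complex.I) + (ephase (Real.pi / 2 + θ) 2 - -1) := by ring
  rw [e]
  refine (norm_add_le_of_le h1 h2).trans (le_of_eq ?_)
  push_cast; ring

theorem norm_coef_up_three (θ : ℝ) :
    ‖ephase (Real.pi / 2 + θ) 1 + ephase (Real.pi / 2 + θ) 2‖ ≤ √2 + 3 * |θ| := by
  have h1 := norm_ephase_sub_pi_le θ 1
  have h2 := norm_ephase_sub_pi_le θ 2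
  rw [ephase_pi_div_two_two] at h2
  rw [ephase_pi_div_two_one] at h1
  have e : ephase (Real.pi / 2 + θ) 1 + ephase (Real.pi / 2 + θ) 2 =
    (starRingEnd ℂ) (Complex.I - 1) + ((ephase (Real.pi / 2 + θ) 1 - -Complex.I)
      + (ephase (Real.pi / 2 + θ) 2 - -1)) := by simp; ring
  rw [e]
  refine (norm_add_le_of_le (by rw [RCLike.norm_conj, norm_I_sub_one])
    (norm_add_le_of_le h1 h2)).trans (le_of_eq ?_)
  push_cast; ring

/-- `e^{-iω} + e^{-3iω} = 2 cos ω · e^{-2iω}` and `cos ω = -sin θ`. The coupling of the third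
harmonic into the fourth thus nearly vanishes, which keeps the bound of the tail small. -/
theorem norm_coef_up_four (θ : ℝ) :
    ‖ephase (Real.pi / 2 + θ) 1 + ephase (Real.pi / 2 + θ) 3‖ = 2 * |Real.sin θ| := by
  have hne : ephase (Real.pi / 2 + θ) 1 ≠ 0 := by rw [← norm_pos_iff, norm_ephase]; exact one_pos
  have e : ephase (Real.pi / 2 + θ) 1 + ephase (Real.pi / 2 + θ) 3 =
      ephase (Real.pi / 2 + θ) 2 * ((starRingEnd ℂ) (ephase (Real.pi / 2 + θ) 1)
        + ephase (Real.pi / 2 + θ) 1) := by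
    have hc : (starRingEnd ℂ) (ephase (Real.pi / 2 + θ) 1) = (ephase (Real.pi / 2 + θ) 1)⁻¹ := by
      rw [Complex.inv_def, Complex.normSq_eq_norm_sq, norm_ephase]; simp
    rw [hc, ephase_eq_pow _ 2, ephase_eq_pow _ 3]
    field_simp
  rw [e, norm_mul, norm_ephase, one_mul, add_comm, Complex.add_conj, ephase_one_add,
    Complex.norm_real, Real.norm_eq_abs, abs_mul, abs_neg, abs_two]

namespace ReducedZero

variable {ε θ lam : ℝ} {v : L1}

theorem mode_of_ne_two (h : ReducedZero ε θ lam v) {k : ℕ} (hk : 3 ≤ k) :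
    (Complex.I * k * (lam : ℂ) + ephase (Real.pi / 2 + θ) k) * opK v k =
      -(ε * remR ε (Real.pi / 2 + θ) v k) := by
  have h1 := h.mode k (by omega)
  have hb : basisSeq 2 k = 0 := by simp [basisSeq]; omega
  rw [hb, mul_zero, add_zero] at h1
  exact eq_neg_of_add_eq_zero_left h1

end ReducedZero

/-- The bound for the convolution terms in `exists_conv_split`. -/
def convBound (v : L1) : ℝ :=
  4 * (2 * ‖opK v 2‖ * (‖opK v 3‖ + tailFour (opK v)) + (‖opK v 3‖ + tailFour (opK v)) ^ 2)

theorem norm_seqConv_le_convBound (ω : ℝ) (v : L1) {k : ℕ} (h0 : k ≠ 0) (h4 : k ≠ 4) :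
    ‖seqConv (opU ω (opK v)) (opK v) k‖ ≤ convBound v := by
  obtain ⟨S, hS, h, -⟩ := exists_conv_split ω v
  rw [h k h0 h4]
  exact (l1_norm_apply_le S k).trans hS

theorem remR_one (ε ω : ℝ) (v : L1) : remR ε ω v 1 =
    (ephase (-ω) 1 + ephase ω 2) * opK v 2 + ε * seqConv (opU ω (opK v)) (opK v) 1 := by
  rw [remR_apply]
  simp only [opL, shiftUp, shiftDown, opU, ← ephase.eq_1, exp_I_mul, exp_neg_I_mul]
  norm_num
  ring

theorem remR_add_two (ε ω : ℝ) (v : L1) (k : ℕ) : remR ε ω v (k + 2) =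
    (ephase ω 1 + ephase ω (k + 1)) * opK v (k + 1)
    + (ephase (-ω) 1 + ephase ω (k + 3)) * opK v (k + 3)
    + ε * seqConv (opU ω (opK v)) (opK v) (k + 2) := by
  rw [remR_apply]
  have e1 : k + 2 - 1 = k + 1 := by omega
  have e2 : k + 2 + 1 = k + 3 := by omega
  have e3 : 2 ≤ k + 2 := by omega
  simp only [opL, shiftUp, shiftDown, opU, ← ephase.eq_1, exp_I_mul, exp_neg_I_mul, if_pos e3, e1,
    e2]
  ring

theorem norm_ephase_add_le (ω ω' : ℝ) (j k : ℕ) : ‖ephase ω j + ephase ω' k‖ ≤ 2 :=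
  (norm_add_le _ _).trans (by rw [norm_ephase, norm_ephase]; norm_num)

theorem norm_apply_four_le (z : L1) : ‖z 4‖ ≤ tailFour z := by
  exact (summable_tail z 4).le_tsum 0 fun _ _ => norm_nonneg _

theorem norm_remR_one_sub_le {ε : ℝ} (hε : 0 ≤ ε) (ω : ℝ) (v : L1) :
    ‖remR ε ω v 1 - (ephase (-ω) 1 + ephase ω 2) * opK v 2‖ ≤ ε * convBound v := by
  rw [remR_one, add_sub_cancel_left, norm_mul, Complex.norm_real, Real.norm_of_nonneg hε]
  gcongr
  exact norm_seqConv_le_convBound ω v one_ne_zero (by norm_num)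

theorem norm_remR_two_le {ε : ℝ} (hε : 0 ≤ ε) (ω : ℝ) (v : L1) :
    ‖remR ε ω v 2‖ ≤ 2 * ‖opK v 3‖ + ε * convBound v := by
  have h := remR_add_two ε ω v 0
  have z1 : opK v 1 = 0 := by simp [opK_apply]
  simp only [zero_add, z1, mul_zero] at h
  rw [h]
  refine norm_add_le_of_le ?_ ?_
  · rw [norm_mul]
    gcongr
    exact norm_ephase_add_le _ _ _ _
  · rw [norm_mul, Complex.norm_real, Real.norm_of_nonneg hε]
    gcongr
    exact norm_seqConv_le_convBound ω v two_ne_zero (by norm_num)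

theorem norm_remR_three_le {ε : ℝ} (hε : 0 ≤ ε) (θ : ℝ) (v : L1) :
    ‖remR ε (Real.pi / 2 + θ) v 3‖ ≤ (√2 + 3 * |θ|) * ‖opK v 2‖ + 2 * tailFour (opK v)
      + ε * convBound v := by
  rw [remR_add_two ε _ v 1]
  refine norm_add_le_of_le (norm_add_le_of_le ?_ ?_) ?_
  · rw [norm_mul]
    gcongr
    exact norm_coef_up_three θ
  · rw [norm_mul]
    exact mul_le_mul (norm_ephase_add_le _ _ _ _) (norm_apply_four_le _) (norm_nonneg _)
      (by norm_num)
  · rw [norm_mul, Complex.norm_real, Real.norm_of_nonneg hε]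
    gcongr
    exact norm_seqConv_le_convBound _ v three_ne_zero (by norm_num)

/-- Mode `k + 4` receives mode `k + 3` from `σ⁺` and mode `k + 5` from `σ⁻`. Only mode 4 sees the
third harmonic, with the small factor of `norm_coef_up_four`, and only mode 4 sees the square of the
second harmonic. Each shift contributes at most twice the tail, hence `4 * tailFour`. -/
theorem tsum_norm_remR_tail_le {ε : ℝ} (hε : 0 ≤ ε) (θ : ℝ) (v : L1) :
    ∑' k, ‖remR ε (Real.pi / 2 + θ) v (k + 4)‖ ≤ 2 * |Real.sin θ| * ‖opK v 3‖
      + 4 * tailFour (opK v) + ε * (‖opK v 2‖ ^ 2 + convBound v) := by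
  set ω := Real.pi / 2 + θ with hω
  set z := opK v with hz
  obtain ⟨S, hS, h1, h4⟩ := exists_conv_split ω v
  have hS' : ∑' k, ‖S (k + 4)‖ ≤ convBound v := by
    have := (l1_summable S).sum_add_tsum_nat_add 4
    have h0 : 0 ≤ ∑ i ∈ Finset.range 4, ‖S i‖ := Finset.sum_nonneg fun _ _ => norm_nonneg _
    rw [← l1_norm_eq] at this
    unfold convBound
    linarith
  let A : ℕ → ℝ := fun k => (if k = 0 then 2 * |Real.sin θ| else 2) * ‖z (k + 3)‖
  let C : ℕ → ℝ := fun k => if k = 0 then ‖z 2‖ ^ 2 else 0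
  have hA : HasSum A (2 * |Real.sin θ| * ‖z 3‖ + 2 * tailFour z) := by
    have : HasSum (fun k => A (k + 1)) (2 * tailFour z) := by
      simpa [A, tailFour, add_assoc] using (summable_tail z 4).hasSum.mul_left 2
    have h2 := (hasSum_nat_add_iff (f := A) 1).1 this
    simpa [A, add_comm] using h2
  have hB : Summable fun k => 2 * ‖z (k + 5)‖ := (summable_tail z 5).mul_left 2
  have hBle : ∑' k, 2 * ‖z (k + 5)‖ ≤ 2 * tailFour z := by
    rw [tsum_mul_left, tailFour, (summable_tail z 4).tsum_eq_zero_add]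
    have e : ∀ k, z (k + 1 + 4) = z (k + 5) := fun k => by rw [add_assoc]
    simp only [e]
    linarith [norm_nonneg (z (0 + 4))]
  have hC : HasSum C (‖z 2‖ ^ 2) := by
    simpa [C] using hasSum_ite_eq (0 : ℕ) (‖z 2‖ ^ 2)
  have hle : ∀ k, ‖remR ε ω v (k + 4)‖ ≤
      A k + 2 * ‖z (k + 5)‖ + ε * (C k + ‖S (k + 4)‖) := by
    intro k
    rw [show k + 4 = k + 2 + 2 by ring, remR_add_two ε ω v (k + 2)]
    refine norm_add_le_of_le (norm_add_le_of_le ?_ ?_) ?_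
    · rw [norm_mul]
      simp only [A]
      refine mul_le_mul_of_nonneg_right ?_ (norm_nonneg _)
      by_cases hk : k = 0
      · subst hk; simp only [if_true, zero_add]; exact (norm_coef_up_four θ).le
      · rw [if_neg hk]; exact norm_ephase_add_le _ _ _ _
    · rw [norm_mul]
      exact mul_le_mul_of_nonneg_right (norm_ephase_add_le _ _ _ _) (norm_nonneg _)
    · rw [norm_mul, Complex.norm_real, Real.norm_of_nonneg hε]
      refine mul_le_mul_of_nonneg_left ?_ hε
      by_cases hk : k = 0
      · subst hk
        simp only [zero_add, C, if_true]
        rw [h4]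
        refine norm_add_le_of_le ?_ le_rfl
        rw [norm_mul, norm_mul, norm_ephase, one_mul, sq]
      · rw [h1 (k + 2 + 2) (by omega) (by omega)]
        simp [C, hk]
  have hsum := (hA.summable.add hB).add ((hC.summable.add (summable_tail S 4)).mul_left ε)
  calc ∑' k, ‖remR ε ω v (k + 4)‖ ≤ ∑' k, (A k + 2 * ‖z (k + 5)‖ + ε * (C k + ‖S (k + 4)‖)) :=
        (summable_tail _ 4).tsum_le_tsum hle hsum
    _ = (2 * |Real.sin θ| * ‖z 3‖ + 2 * tailFour z) + ∑' k, 2 * ‖z (k + 5)‖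
        + ε * (‖z 2‖ ^ 2 + ∑' k, ‖S (k + 4)‖) :=
        ((hA.add hB.hasSum).add ((hC.add (summable_tail S 4).hasSum).mul_left ε)).tsum_eq
    _ ≤ _ := by nlinarith

/-! ### Scalar inequalities for the modes of a zero -/

theorem norm_denom_two_sub_le (θ lam : ℝ) :
    ‖Complex.I * (2 : ℕ) * (lam : ℂ) + ephase (Real.pi / 2 + θ) 2 - (Complex.I * 2 - 1)‖ ≤
      2 * (|lam - 1| + |θ|) := by
  have h2 := norm_ephase_sub_pi_le θ 2
  rw [ephase_pi_div_two_two] at h2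
  have e : Complex.I * (2 : ℕ) * (lam : ℂ) + ephase (Real.pi / 2 + θ) 2 - (Complex.I * 2 - 1) =
    Complex.I * 2 * ((lam - 1 : ℝ) : ℂ) + (ephase (Real.pi / 2 + θ) 2 - -1) := by push_cast; ring
  rw [e]
  have h3 : ‖Complex.I * 2 * ((lam - 1 : ℝ) : ℂ)‖ = 2 * |lam - 1| := by
    rw [norm_mul, norm_mul, Complex.norm_I, Complex.norm_real, Real.norm_eq_abs]; simp
  refine (norm_add_le_of_le h3.le h2).trans (le_of_eq ?_)
  push_cast; ring

theorem le_norm_denom_two (θ lam : ℝ) :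
    √5 - 2 * (|lam - 1| + |θ|) ≤
      ‖Complex.I * (2 : ℕ) * (lam : ℂ) + ephase (Real.pi / 2 + θ) 2‖ := by
  have h1 := norm_denom_two_sub_le θ lam
  have h2 := norm_sub_norm_le (Complex.I * 2 - 1)
    (Complex.I * (2 : ℕ) * (lam : ℂ) + ephase (Real.pi / 2 + θ) 2)
  rw [norm_sub_rev (Complex.I * 2 - 1) (_ + _), norm_two_mul_I_sub_one] at h2
  linarith

theorem le_norm_denom_three (θ lam : ℝ) :
    4 - 3 * (|lam - 1| + |θ|) ≤
      ‖Complex.I * (3 : ℕ) * (lam : ℂ) + ephase (Real.pi / 2 + θ) 3‖ := by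
  have h2 := norm_ephase_sub_pi_le θ 3
  rw [ephase_pi_div_two_three] at h2
  have e : Complex.I * 4 = (Complex.I * (3 : ℕ) * (lam : ℂ) + ephase (Real.pi / 2 + θ) 3)
      - (Complex.I * 3 * ((lam - 1 : ℝ) : ℂ) + (ephase (Real.pi / 2 + θ) 3 - Complex.I)) := by
    push_cast; ring
  have h3 : ‖Complex.I * 4‖ = 4 := by simp
  rw [e] at h3
  have h4 := norm_sub_le (Complex.I * (3 : ℕ) * (lam : ℂ) + ephase (Real.pi / 2 + θ) 3)
    (Complex.I * 3 * ((lam - 1 : ℝ) : ℂ) + (ephase (Real.pi / 2 + θ) 3 - Complex.I))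
  have h5 := norm_add_le (Complex.I * 3 * ((lam - 1 : ℝ) : ℂ))
    (ephase (Real.pi / 2 + θ) 3 - Complex.I)
  have h6 : ‖Complex.I * 3 * ((lam - 1 : ℝ) : ℂ)‖ = 3 * |lam - 1| := by
    rw [norm_mul, norm_mul, Complex.norm_I, Complex.norm_real, Real.norm_eq_abs]; simp
  push_cast at h2
  linarith

theorem le_norm_denom (ω : ℝ) {lam : ℝ} (hlam : 0 ≤ lam) (k : ℕ) :
    k * lam - 1 ≤ ‖Complex.I * k * (lam : ℂ) + ephase ω k‖ := by
  have h1 := norm_sub_le (Complex.I * k * (lam : ℂ) + ephase ω k) (ephase ω k)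
  simp only [add_sub_cancel_right, norm_mul, Complex.norm_I, Complex.norm_natCast, one_mul,
    norm_ephase, Complex.norm_real, Real.norm_of_nonneg hlam] at h1
  linarith

theorem sqrt_two_le : √2 ≤ 1.4143 := by
  rw [Real.sqrt_le_left (by norm_num)]; norm_num

theorem le_sqrt_five : 2.236 ≤ √5 := Real.le_sqrt_of_sq_le (by norm_num)

/-- The scalar inequalities satisfied by a zero: `a`, `b`, `Z` are the moduli of the second, the
third and all the higher coefficients, `q` bounds the convolution terms, `s = |sin θ|`,
`t = |θ|`, `n = |lam - 1|`, `r = |R_1|`. -/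
structure ScalarIneq (ε a b Z q s t n r : ℝ) : Prop where
  ε_nonneg : 0 ≤ ε
  ε_le : ε ≤ 0.1
  a_nonneg : 0 ≤ a
  b_nonneg : 0 ≤ b
  Z_nonneg : 0 ≤ Z
  t_nonneg : 0 ≤ t
  n_nonneg : 0 ≤ n
  q_eq : q = 4 * (2 * a * (b + Z) + (b + Z) ^ 2)
  two : (2.236 - 2 * (n + t)) * a ≤ 1 + ε * (2 * b + ε * q)
  three : (4 - 3 * (n + t)) * b ≤ ε * ((1.4143 + 3 * t) * a + 2 * Z + ε * q)
  tail : (4 * (1 - n) - 1) * Z ≤ ε * (2 * s * b + 4 * Z + ε * (a ^ 2 + q))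
  one : r ≤ (1.4143 + 3 * t) * a + ε * q
  s_le : s ≤ ε ^ 2 * r
  t_le : 0.99 * t ≤ s
  n_le : n ≤ ε ^ 2 * r + t ^ 2 / 2

namespace ScalarIneq

variable {ε a b Z q s t n r : ℝ}

theorem q_nonneg (h : ScalarIneq ε a b Z q s t n r) : 0 ≤ q := by
  have := h.a_nonneg; have := h.b_nonneg; have := h.Z_nonneg
  rw [h.q_eq]; positivity

theorem s_nonneg (h : ScalarIneq ε a b Z q s t n r) : 0 ≤ s := by
  linarith [h.t_le, h.t_nonneg]

set_option maxHeartbeats 1000000 in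
/-- One step of improvement of the bounds. -/
theorem improve (h : ScalarIneq ε a b Z q s t n r) {A B Zb Q S T N A' β ζ Q' r' : ℝ}
    (hA : a ≤ A) (hB : b ≤ B) (hZ : Z ≤ Zb) (hQ : q ≤ Q) (hS : s ≤ S) (hT : t ≤ T) (hN : n ≤ N)
    (c0 : N + T ≤ 1) (c0' : 0 < 4 * (1 - N) - 1.4)
    (c1 : 1 + 0.1 * (2 * B + 0.1 * Q) ≤ (2.236 - 2 * (N + T)) * A')
    (c2 : (1.4143 + 3 * T) * A' + 2 * Zb + 0.1 * Q ≤ (4 - 3 * (N + T)) * β)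
    (c3 : 2 * S * B + 0.1 * (A ^ 2 + Q) ≤ (4 * (1 - N) - 1.4) * ζ)
    (c4 : 4 * (2 * A' * (0.1 * β + 0.1 * ζ) + (0.1 * β + 0.1 * ζ) ^ 2) ≤ Q')
    (c5 : (1.4143 + 3 * T) * A' + 0.1 * Q' ≤ r') :
    a ≤ A' ∧ b ≤ β * ε ∧ Z ≤ ζ * ε ∧ q ≤ Q' ∧ r ≤ r' ∧ s ≤ r' * ε ^ 2 ∧
      t ≤ 1.0102 * r' * ε ^ 2 := by
  have e0 := h.ε_nonneg
  have e1 := h.ε_le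
  have a0 := h.a_nonneg
  have b0 := h.b_nonneg
  have Z0 := h.Z_nonneg
  have q0 := h.q_nonneg
  have t0 := h.t_nonneg
  have n0 := h.n_nonneg
  have s0 := h.s_nonneg
  have T0 := t0.trans hT
  have k1 : a ≤ A' := by
    have h1 : (2.236 - 2 * (N + T)) * a ≤ (2.236 - 2 * (N + T)) * A' := by
      calc (2.236 - 2 * (N + T)) * a ≤ (2.236 - 2 * (n + t)) * a := by gcongr
        _ ≤ 1 + ε * (2 * b + ε * q) := h.two
        _ ≤ 1 + 0.1 * (2 * B + 0.1 * Q) := by gcongr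
        _ ≤ _ := c1
    exact le_of_mul_le_mul_left h1 (by linarith)
  have A0 := a0.trans k1
  have T1 : 0 ≤ 1.4143 + 3 * T := by linarith
  have A2 : 0 ≤ 2 * A' := by linarith
  have k2 : b ≤ β * ε := by
    have h1 : (4 - 3 * (N + T)) * b ≤ (4 - 3 * (N + T)) * (β * ε) := by
      calc (4 - 3 * (N + T)) * b ≤ (4 - 3 * (n + t)) * b := by gcongr
        _ ≤ ε * ((1.4143 + 3 * t) * a + 2 * Z + ε * q) := h.three
        _ ≤ ε * ((1.4143 + 3 * T) * A' + 2 * Zb + 0.1 * Q) := by gcongr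
        _ ≤ ε * ((4 - 3 * (N + T)) * β) := by gcongr
        _ = _ := by ring
    exact le_of_mul_le_mul_left h1 (by linarith)
  -- The action of the tail on itself, `4 ε Z ≤ 0.4 Z`, is absorbed on the left: this turns `4 (1 -
  -- N) - 1` into `4 (1 - N) - 1.4`.
  have k3 : Z ≤ ζ * ε := by
    have h0 : ε * Z ≤ 0.1 * Z := by gcongr
    have h1 : (4 * (1 - N) - 1.4) * Z ≤ (4 * (1 - N) - 1.4) * (ζ * ε) := by
      calc (4 * (1 - N) - 1.4) * Z ≤ (4 * (1 - n) - 1) * Z - 4 * ε * Z := by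
            have : N * Z ≥ n * Z := by gcongr
            linarith
        _ ≤ ε * (2 * s * b + ε * (a ^ 2 + q)) := by linarith [h.tail]
        _ ≤ ε * (2 * S * B + 0.1 * (A ^ 2 + Q)) := by gcongr; linarith
        _ ≤ ε * ((4 * (1 - N) - 1.4) * ζ) := by gcongr
        _ = _ := by ring
    exact le_of_mul_le_mul_left h1 c0'
  have hβ : 0 ≤ β := by
    have h1 : (0 : ℝ) ≤ (4 - 3 * (N + T)) * β := le_trans (by
      have := a0.trans k1; have := t0.trans hT; have := Z0.trans hZ; have := q0.trans hQ
      positivity) c2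
    exact nonneg_of_mul_nonneg_right h1 (by linarith)
  have hζ : 0 ≤ ζ := by
    have h1 : (0 : ℝ) ≤ (4 * (1 - N) - 1.4) * ζ := le_trans (by
      have := s0.trans hS; have := b0.trans hB; have := q0.trans hQ
      positivity) c3
    exact nonneg_of_mul_nonneg_right h1 c0'
  have k4 : q ≤ Q' := by
    have hb' : b ≤ 0.1 * β := k2.trans (by rw [mul_comm]; gcongr)
    have hZ' : Z ≤ 0.1 * ζ := k3.trans (by rw [mul_comm]; gcongr)
    rw [h.q_eq]
    refine le_trans ?_ c4
    gcongr
  have k5 : r ≤ r' := by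
    refine (h.one.trans ?_).trans c5
    gcongr
  have k6 : s ≤ r' * ε ^ 2 := h.s_le.trans (by rw [mul_comm]; gcongr)
  refine ⟨k1, k2, k3, k4, k5, k6, ?_⟩
  -- The factor 1.0102 in the bound of `t` exceeds `1/0.99`.
  have h2 : 0 ≤ r' * ε ^ 2 := s0.trans k6
  linarith [h.t_le]

theorem n_le' (h : ScalarIneq ε a b Z q s t n r) {r' t' : ℝ} (hr : r ≤ r') (ht : t ≤ t')
    (hr0 : 0 ≤ r') : n ≤ 0.01 * r' + t' ^ 2 / 2 := by
  have e2 : ε ^ 2 ≤ 0.1 ^ 2 := by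
    have := h.ε_nonneg; have := h.ε_le
    gcongr
  have t0 := h.t_nonneg
  have h1 : ε ^ 2 * r ≤ ε ^ 2 * r' := by gcongr
  have h2 : ε ^ 2 * r' ≤ 0.1 ^ 2 * r' := by gcongr
  have h3 : t ^ 2 ≤ t' ^ 2 := by gcongr
  linarith [h.n_le]

set_option maxHeartbeats 1000000 in
-- Bootstrap: the crude bounds of the box are improved four times. In each inequality `b`, `Z` and
-- `q` occur on the right only with a factor `ε ≤ 0.1`, so the bounds shrink fast, that of `a`
-- towards the limit `1/√5 ≈ 0.447`. The numerical parameters are the values of one round, rounded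
-- upwards.
theorem bounds_aux (h : ScalarIneq ε a b Z q s t n r) (hz : a + b + Z ≤ 0.85) (hr : r ≤ 3.69) :
    a ≤ 0.4545 ∧ b ≤ 0.16691 * ε ∧ Z ≤ 0.0108 * ε ∧ q ≤ 0.0659 ∧ r ≤ 0.6586 ∧
      s ≤ 0.6586 * ε ^ 2 ∧ t ≤ 1.0102 * 0.6586 * ε ^ 2 ∧ n ≤ 0.00662 := by
  have e0 := h.ε_nonneg
  have e1 := h.ε_le
  have a0 := h.a_nonneg
  have b0 := h.b_nonneg
  have Z0 := h.Z_nonneg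
  have q0 := h.q_nonneg
  have t0 := h.t_nonneg
  have n0 := h.n_nonneg
  have s0 := h.s_nonneg
  have e2 : ε ^ 2 ≤ 0.01 := by nlinarith
  have e2' := sq_nonneg ε
  have hs1 : s ≤ 0.0369 := h.s_le.trans (by
    calc ε ^ 2 * r ≤ ε ^ 2 * 3.69 := by gcongr
      _ ≤ 0.0369 := by linarith)
  have ht1 : t ≤ 0.0373 := by linarith [h.t_le]
  have hn1 : n ≤ 0.0388 := (h.n_le' hr ht1 (by norm_num)).trans (by norm_num)
  -- `q = 4 ((a + b + Z)² - a²) ≤ 4 · 0.85² = 2.89`.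
  have hq1 : q ≤ 2.89 := by
    rw [h.q_eq]
    have h1 : (a + b + Z) ^ 2 ≤ 0.85 ^ 2 := by gcongr
    have h2 := sq_nonneg a
    linarith
  obtain ⟨a1, b1, Z1, q1, r1, s1, t1⟩ := h.improve (A' := 0.5754) (β := 0.76019) (ζ := 0.1735)
    (Q' := 0.4647) (r' := 0.9247) (by linarith : a ≤ 0.85) (by linarith : b ≤ 0.85)
    (by linarith : Z ≤ 0.85) hq1 hs1 ht1 hn1
    (by norm_num) (by norm_num) (by norm_num) (by norm_num) (by norm_num) (by norm_num)
    (by norm_num)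
  have n1 : n ≤ 0.0093 :=
    (h.n_le' r1 (by linarith : t ≤ 0.00935) (by norm_num)).trans (by norm_num)
  obtain ⟨a2, b2, Z2, q2, r2, s2, t2⟩ := h.improve (A' := 0.4639) (β := 0.19024) (ζ := 0.0317)
    (Q' := 0.0844) (r' := 0.6776) a1 (by linarith : b ≤ 0.07603)
    (by linarith : Z ≤ 0.01736) q1 (by linarith : s ≤ 0.00925) (by linarith : t ≤ 0.00935) n1
    (by norm_num) (by norm_num) (by norm_num) (by norm_num) (by norm_num) (by norm_num)
    (by norm_num)
  have n2 : n ≤ 0.00681 :=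
    (h.n_le' r2 (by linarith : t ≤ 0.00685) (by norm_num)).trans (by norm_num)
  obtain ⟨a3, b3, Z3, q3, r3, s3, t3⟩ := h.improve (A' := 0.4549) (β := 0.16861) (ζ := 0.0118)
    (Q' := 0.067) (r' := 0.6595) a2 (by linarith : b ≤ 0.01903)
    (by linarith : Z ≤ 0.00318) q2 (by linarith : s ≤ 0.00678) (by linarith : t ≤ 0.00685) n2
    (by norm_num) (by norm_num) (by norm_num) (by norm_num) (by norm_num) (by norm_num)
    (by norm_num)
  have n3 : n ≤ 0.00662 :=
    (h.n_le' r3 (by linarith : t ≤ 0.00667) (by norm_num)).trans (by norm_num)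
  obtain ⟨a4, b4, Z4, q4, r4, s4, t4⟩ := h.improve (A' := 0.4545) (β := 0.16691) (ζ := 0.0108)
    (Q' := 0.0659) (r' := 0.6586) a3 (by linarith : b ≤ 0.01687)
    (by linarith : Z ≤ 0.00119) q3 (by linarith : s ≤ 0.0066) (by linarith : t ≤ 0.00667) n3
    (by norm_num) (by norm_num) (by norm_num) (by norm_num) (by norm_num) (by norm_num)
    (by norm_num)
  exact ⟨a4, b4, Z4, q4, r4, s4, t4, n3⟩

set_option maxHeartbeats 400000 in
-- The fixed numerical bounds are converted into powers of `ε`: with `s = O(ε²)` and `b = O(ε)` the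
-- tail inequality gives `Z = O(ε²)`, and then the formula for `q` gives `q = O(ε)`.
theorem bounds (h : ScalarIneq ε a b Z q s t n r) (hz : a + b + Z ≤ 0.85) (hr : r ≤ 3.69) :
    a ≤ 0.4545 ∧ b ≤ 0.167 * ε ∧ Z ≤ 0.107 * ε ^ 2 ∧ q ≤ 0.66 * ε ∧ t ≤ 0.6655 * ε ^ 2 ∧
      n ≤ 0.661 * ε ^ 2 := by
  have e0 := h.ε_nonneg
  have e1 := h.ε_le
  have a0 := h.a_nonneg
  have b0 := h.b_nonneg
  have Z0 := h.Z_nonneg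
  have q0 := h.q_nonneg
  have t0 := h.t_nonneg
  have s0 := h.s_nonneg
  have e2 : ε ^ 2 ≤ 0.01 := by nlinarith
  obtain ⟨a4, b4, Z4, q4, r4, s4, t4, n3⟩ := h.bounds_aux hz hr
  have b5 : b ≤ 0.167 * ε := by linarith
  have t5 : t ≤ 0.6655 * ε ^ 2 := by linarith
  have n5 : n ≤ 0.661 * ε ^ 2 := h.n_le.trans (by
    have h1 : ε ^ 2 * r ≤ ε ^ 2 * 0.6586 := by gcongr
    have h2 : t ≤ 0.006655 := by linarith
    have h3 : t * t ≤ 0.006655 * (0.6655 * ε ^ 2) := by gcongr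
    linarith)
  have Z5 : Z ≤ 0.107 * ε ^ 2 := by
    have h0 : ε * Z ≤ 0.1 * Z := by gcongr
    have h3 : n * Z ≤ 0.00662 * Z := by gcongr
    have h4 : ε * (2 * s * b + ε * (a ^ 2 + q)) ≤
        ε * (2 * 0.0066 * (0.167 * ε) + ε * (0.4545 ^ 2 + 0.0659)) := by
      gcongr
      linarith
    linarith [h.tail]
  have q5 : q ≤ 0.66 * ε := by
    have hbZ : b + Z ≤ 0.1777 * ε := by nlinarith
    rw [h.q_eq]
    have h1 : 2 * a * (b + Z) ≤ 2 * 0.4545 * (0.1777 * ε) := by gcongr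
    have h2 : (b + Z) ^ 2 ≤ (0.1777 * ε) ^ 2 := by gcongr
    have h3 : ε * ε ≤ 0.1 * ε := by gcongr
    linarith
  exact ⟨a4, b5, Z5, q5, t5, n5⟩

end ScalarIneq

theorem abs_sub_sin_le {θ : ℝ} (h : |θ| ≤ 1 / 20) : |θ - Real.sin θ| ≤ 1 / 100 * |θ| := by
  simpa using abs_sub_sin_sub_le h (b := 0) (by norm_num)

theorem abs_cos_sub_one_le (θ : ℝ) : |Real.cos θ - 1| ≤ |θ| ^ 2 / 2 := by
  rw [abs_of_nonpos (by linarith [Real.cos_le_one θ]), sq_abs]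
  linarith [Real.one_sub_sq_div_two_le_cos (x := θ)]

namespace ReducedZero

variable {ε θ lam : ℝ} {v : L1}

theorem sin_eq (h : ReducedZero ε θ lam v) :
    Real.sin θ = ε ^ 2 * (remR ε (Real.pi / 2 + θ) v 1).re :=
  ((mode_one_iff _ _ _ _).1 h.mode_one).1

theorem lam_eq (h : ReducedZero ε θ lam v) :
    lam = Real.cos θ - ε ^ 2 * (remR ε (Real.pi / 2 + θ) v 1).im :=
  ((mode_one_iff _ _ _ _).1 h.mode_one).2

theorem abs_lam_sub_one_le (h : ReducedZero ε θ lam v) :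
    |lam - 1| ≤ ε ^ 2 * |(remR ε (Real.pi / 2 + θ) v 1).im| + |θ| ^ 2 / 2 := by
  have e : lam - 1 = (Real.cos θ - 1) - ε ^ 2 * (remR ε (Real.pi / 2 + θ) v 1).im := by
    rw [h.lam_eq]; ring
  rw [e]
  refine (abs_sub _ _).trans ?_
  rw [abs_mul, abs_of_nonneg (sq_nonneg ε)]
  linarith [abs_cos_sub_one_le θ]

theorem mode_two (h : ReducedZero ε θ lam v) :
    (Complex.I * (2 : ℕ) * (lam : ℂ) + ephase (Real.pi / 2 + θ) 2) * opK v 2 =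
      -(ephase (Real.pi / 2 + θ) 1 + ε * remR ε (Real.pi / 2 + θ) v 2) := by
  have := h.mode 2 le_rfl
  simp only [basisSeq, if_true, mul_one] at this
  linear_combination this

/-- Absolute values are taken in modes 1, 2, 3, and summed over `k ≥ 4`. The denominators are close
to `2i - 1` for `k = 2` and to `4i` for `k = 3`, and are at least `kλ - 1 ≥ 4λ - 1` in modulus for
`k ≥ 4`. -/
theorem scalarIneq (h : ReducedZero ε θ lam v) (hε0 : 0 ≤ ε) (hε : ε ≤ 0.1) (hθ : |θ| ≤ 1 / 20)
    (hl : |lam - 1| ≤ 1 / 20) :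
    ScalarIneq ε ‖opK v 2‖ ‖opK v 3‖ (tailFour (opK v)) (convBound v) |Real.sin θ| |θ|
      |lam - 1| ‖remR ε (Real.pi / 2 + θ) v 1‖ := by
  have hlam : 0.95 ≤ lam := by have := (abs_le.1 hl).1; linarith
  refine ⟨hε0, hε, norm_nonneg _, norm_nonneg _, tailFour_nonneg _, abs_nonneg _, abs_nonneg _,
    rfl, ?_, ?_, ?_, ?_, ?_, ?_, ?_⟩
  · have h1 := congrArg norm h.mode_two
    rw [norm_mul, norm_neg] at h1
    have h2 : ‖ephase (Real.pi / 2 + θ) 1 + ε * remR ε (Real.pi / 2 + θ) v 2‖ ≤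
        1 + ε * (2 * ‖opK v 3‖ + ε * convBound v) := by
      refine norm_add_le_of_le (norm_ephase _ _).le ?_
      rw [norm_mul, Complex.norm_real, Real.norm_of_nonneg hε0]
      exact mul_le_mul_of_nonneg_left (norm_remR_two_le hε0 _ _) hε0
    rw [← h1] at h2
    refine le_trans (mul_le_mul_of_nonneg_right ?_ (norm_nonneg _)) h2
    linarith [le_norm_denom_two θ lam, le_sqrt_five]
  · have h1 := congrArg norm (h.mode_of_ne_two le_rfl)
    rw [norm_mul, norm_neg, norm_mul, Complex.norm_real, Real.norm_of_nonneg hε0] at h1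
    have h2 := mul_le_mul_of_nonneg_left (norm_remR_three_le hε0 θ v) hε0
    rw [← h1] at h2
    have h3 := mul_le_mul_of_nonneg_right (le_norm_denom_three θ lam) (norm_nonneg (opK v 3))
    refine (h3.trans h2).trans ?_
    gcongr
    exact sqrt_two_le
  · have h1 : ∀ k, (4 * lam - 1) * ‖opK v (k + 4)‖ ≤
        ε * ‖remR ε (Real.pi / 2 + θ) v (k + 4)‖ := fun k => by
      have h2 := congrArg norm (h.mode_of_ne_two (by omega : 3 ≤ k + 4))
      rw [norm_mul, norm_neg, norm_mul, Complex.norm_real, Real.norm_of_nonneg hε0] at h2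
      rw [← h2]
      refine mul_le_mul_of_nonneg_right (le_trans ?_ (le_norm_denom _ (by linarith) (k + 4)))
        (norm_nonneg _)
      have : (0 : ℝ) ≤ k := Nat.cast_nonneg k
      push_cast
      nlinarith
    have h2 := ((summable_tail (opK v) 4).mul_left (4 * lam - 1)).tsum_le_tsum h1
      ((summable_tail _ 4).mul_left ε)
    rw [tsum_mul_left, tsum_mul_left] at h2
    have h3 := mul_le_mul_of_nonneg_left (tsum_norm_remR_tail_le hε0 θ v) hε0
    refine le_trans (mul_le_mul_of_nonneg_right ?_ (tailFour_nonneg _)) (h2.trans h3)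
    have := (abs_le.1 (le_refl |lam - 1|)).1
    linarith
  · have h1 := norm_remR_one_sub_le hε0 (Real.pi / 2 + θ) v
    have h2 := norm_coef_down_two θ
    have h3 : ‖ephase (-(Real.pi / 2 + θ)) 1 + ephase (Real.pi / 2 + θ) 2‖ ≤
        1.4143 + 3 * |θ| := by
      have := norm_le_norm_add_norm_sub' (ephase (-(Real.pi / 2 + θ)) 1
        + ephase (Real.pi / 2 + θ) 2) (Complex.I - 1)
      rw [norm_I_sub_one] at this
      linarith [sqrt_two_le]
    have h4 := norm_le_norm_add_norm_sub' (remR ε (Real.pi / 2 + θ) v 1)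
      ((ephase (-(Real.pi / 2 + θ)) 1 + ephase (Real.pi / 2 + θ) 2) * opK v 2)
    rw [norm_mul] at h4
    have h5 := mul_le_mul_of_nonneg_right h3 (norm_nonneg (opK v 2))
    linarith
  · rw [h.sin_eq, abs_mul, abs_of_nonneg (sq_nonneg ε)]
    exact mul_le_mul_of_nonneg_left (Complex.abs_re_le_norm _) (sq_nonneg _)
  · have h1 := abs_sub_sin_le hθ
    have h2 := abs_sub_abs_le_abs_sub θ (Real.sin θ)
    linarith
  · refine h.abs_lam_sub_one_le.trans ?_
    gcongr
    exact Complex.abs_im_le_norm _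

end ReducedZero

/-! ### Sharp bounds for a zero -/

namespace ReducedZero

variable {ε θ lam : ℝ} {v : L1}

theorem eq_neg_precond (h : ReducedZero ε θ lam v) : -precond (innerG ε θ (lam - 1) v) = v := by
  rw [neg_precond_innerG_eq_iff]
  refine ⟨h.v_zero, h.v_one, fun k hk => ?_⟩
  rw [add_sub_cancel]
  exact h.mode k hk

theorem norm_le_aux (h : ReducedZero ε θ lam v) :
    ‖v‖ ≤ 9 / 10 + 4 / 3 * ((|lam - 1| + |θ|) * ‖v‖
      + |ε| * (4 * ‖opK v‖ + |ε| * (4 * ‖opK v‖ * ‖opK v‖))) := by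
  have := norm_precond_innerG_le ε θ (lam - 1) v
  rwa [← norm_neg, h.eq_neg_precond] at this

theorem opK_zero (v : L1) : opK v 0 = 0 := by simp [opK_apply]

theorem opK_one (v : L1) : opK v 1 = 0 := by simp [opK_apply]

theorem norm_opK_eq (v : L1) : ‖opK v‖ = ‖opK v 2‖ + ‖opK v 3‖ + tailFour (opK v) :=
  norm_eq_add_tailFour _ (opK_zero v) (opK_one v)

/-- `(2 - i)/5` solves the second mode at `ε = 0`, which is `(2i - 1) z = i`. The deviation is thus
driven by the perturbation of the denominator, that of `e^{-iω}`, and the remainder. -/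
theorem coef_two_sub_le (h : ReducedZero ε θ lam v) (hε : 0 ≤ ε) :
    2.236 * ‖opK v 2 - (2 - Complex.I) / 5‖ ≤ 2 * (|lam - 1| + |θ|) * ‖opK v 2‖ + |θ|
      + ε * (2 * ‖opK v 3‖ + ε * convBound v) := by
  set D := Complex.I * (2 : ℕ) * (lam : ℂ) + ephase (Real.pi / 2 + θ) 2 with hD
  have h1 := h.mode_two
  rw [← hD] at h1
  have e : (Complex.I * 2 - 1) * (opK v 2 - (2 - Complex.I) / 5) =
      -((D - (Complex.I * 2 - 1)) * opK v 2 + (ephase (Real.pi / 2 + θ) 1 - -Complex.I)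
        + ε * remR ε (Real.pi / 2 + θ) v 2) := by
    linear_combination h1 + (2 / 5 : ℂ) * Complex.I_mul_I
  have h2 := congrArg norm e
  rw [norm_mul, norm_neg, norm_two_mul_I_sub_one] at h2
  have h3 := norm_ephase_sub_pi_le θ 1
  rw [ephase_pi_div_two_one, Nat.cast_one, one_mul] at h3
  have h4 : ‖(D - (Complex.I * 2 - 1)) * opK v 2 + (ephase (Real.pi / 2 + θ) 1 - -Complex.I)
        + ε * remR ε (Real.pi / 2 + θ) v 2‖ ≤ 2 * (|lam - 1| + |θ|) * ‖opK v 2‖ + |θ|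
      + ε * (2 * ‖opK v 3‖ + ε * convBound v) := by
    refine norm_add_le_of_le (norm_add_le_of_le ?_ h3) ?_
    · rw [norm_mul]
      exact mul_le_mul_of_nonneg_right (norm_denom_two_sub_le θ lam) (norm_nonneg _)
    · rw [norm_mul, Complex.norm_real, Real.norm_of_nonneg hε]
      exact mul_le_mul_of_nonneg_left (norm_remR_two_le hε _ _) hε
  rw [← h2] at h4
  exact (mul_le_mul_of_nonneg_right le_sqrt_five (norm_nonneg _)).trans h4

/-- `(-1 + 3i)/5 = (i - 1)(2 - i)/5` is the limit of `R₁` as `ε → 0`. Its real and imaginary parts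
are the source of `θ ≈ -ε²/5` and `λ ≈ 1 - 3ε²/5`, hence of the approximate parameter and frequency.
-/
theorem remR_one_sub_le (hε : 0 ≤ ε) (θ : ℝ) (v : L1) :
    ‖remR ε (Real.pi / 2 + θ) v 1 - (-1 + 3 * Complex.I) / 5‖ ≤
      1.4143 * ‖opK v 2 - (2 - Complex.I) / 5‖ + 3 * |θ| * ‖opK v 2‖ + ε * convBound v := by
  have h1 := norm_remR_one_sub_le hε (Real.pi / 2 + θ) v
  have h2 := norm_coef_down_two θ
  set C := ephase (-(Real.pi / 2 + θ)) 1 + ephase (Real.pi / 2 + θ) 2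
  have e : remR ε (Real.pi / 2 + θ) v 1 - (-1 + 3 * Complex.I) / 5 =
      (Complex.I - 1) * (opK v 2 - (2 - Complex.I) / 5) + (C - (Complex.I - 1)) * opK v 2
      + (remR ε (Real.pi / 2 + θ) v 1 - C * opK v 2) := by
    linear_combination (-1 / 5 : ℂ) * Complex.I_mul_I
  rw [e]
  refine norm_add_le_of_le (norm_add_le_of_le ?_ ?_) h1
  · rw [norm_mul, norm_I_sub_one]
    exact mul_le_mul_of_nonneg_right sqrt_two_le (norm_nonneg _)
  · rw [norm_mul]
    exact mul_le_mul_of_nonneg_right h2 (norm_nonneg _)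

end ReducedZero

/-- Quantitative description of the zero. -/
structure ZeroBounds (ε θ lam : ℝ) (v : L1) : Prop where
  three_le : ‖opK v 3‖ ≤ 0.167 * ε
  tail_le : tailFour (opK v) ≤ 0.107 * ε ^ 2
  two_near : ‖opK v 2 - (2 - Complex.I) / 5‖ ≤ 0.634 * ε ^ 2
  rem_near : ‖remR ε (Real.pi / 2 + θ) v 1 - (-1 + 3 * Complex.I) / 5‖ ≤ 1.874 * ε ^ 2
  theta_le : |θ| ≤ 0.2325 * ε ^ 2
  lam_le : |lam - 1| ≤ 0.6304 * ε ^ 2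
  norm_K_le : ‖opK v‖ ≤ 0.4723
  norm_le : ‖v‖ ≤ 1.2

theorem re_im_near {r : ℂ} {η : ℝ} (h : ‖r - (-1 + 3 * Complex.I) / 5‖ ≤ η) :
    |r.re + 0.2| ≤ η ∧ |r.im - 0.6| ≤ η := by
  have h1 := (Complex.abs_re_le_norm _).trans h
  have h2 := (Complex.abs_im_le_norm _).trans h
  have e1 : (r - (-1 + 3 * Complex.I) / 5).re = r.re + 0.2 := by
    simp; norm_num
  have e2 : (r - (-1 + 3 * Complex.I) / 5).im = r.im - 0.6 := by
    simp; norm_num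
  rw [e1] at h1
  rw [e2] at h2
  exact ⟨h1, h2⟩

theorem ReducedZero.theta_lam_le {ε θ lam ρ : ℝ} {v : L1} (h : ReducedZero ε θ lam v)
    (hθ : |θ| ≤ 1 / 20)
    (hR : ‖remR ε (Real.pi / 2 + θ) v 1 - (-1 + 3 * Complex.I) / 5‖ ≤ ρ) :
    0.99 * |θ| ≤ ε ^ 2 * (0.2 + ρ) ∧ |lam - 1| ≤ ε ^ 2 * (0.6 + ρ) + |θ| ^ 2 / 2 := by
  obtain ⟨h1, h2⟩ := re_im_near hR
  constructor
  · have h3 := abs_sub_sin_le hθ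
    have h4 := abs_sub_abs_le_abs_sub θ (Real.sin θ)
    have h5 : |Real.sin θ| ≤ ε ^ 2 * (0.2 + ρ) := by
      rw [h.sin_eq, abs_mul, abs_of_nonneg (sq_nonneg ε)]
      refine mul_le_mul_of_nonneg_left ?_ (sq_nonneg ε)
      rw [abs_le] at h1 ⊢
      constructor <;> linarith
    linarith
  · refine h.abs_lam_sub_one_le.trans (add_le_add ?_ le_rfl)
    refine mul_le_mul_of_nonneg_left ?_ (sq_nonneg ε)
    rw [abs_le] at h2 ⊢
    constructor <;> linarith

theorem ReducedZero.zeroBounds {ε θ lam : ℝ} {v : L1} (h : ReducedZero ε θ lam v) (hε0 : 0 ≤ ε)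
    (hε : ε ≤ 0.1) (hθ : |θ| ≤ 1 / 20) (hl : |lam - 1| ≤ 1 / 20) (hv : ‖v‖ ≤ 17 / 10) :
    ZeroBounds ε θ lam v := by
  have hs := h.scalarIneq hε0 hε hθ hl
  have hK : ‖opK v‖ ≤ 0.85 := (norm_opK_le v).trans (by linarith)
  have hK0 := norm_nonneg (opK v)
  have e2 : ε ^ 2 ≤ 0.01 := by nlinarith
  have e20 := sq_nonneg ε
  have hr : ‖remR ε (Real.pi / 2 + θ) v 1‖ ≤ 3.69 := by
    refine (l1_norm_apply_le _ 1).trans ((norm_remR_le _ _ _).trans ?_)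
    rw [abs_of_nonneg hε0]
    have : ε * (4 * ‖opK v‖ * ‖opK v‖) ≤ 0.1 * (4 * 0.85 * 0.85) := by gcongr
    linarith
  obtain ⟨ha, hb, hZ, hq, ht, hn⟩ := hs.bounds (by rw [← ReducedZero.norm_opK_eq]; exact hK) hr
  have hKeq := ReducedZero.norm_opK_eq v
  have hεq : ε * convBound v ≤ ε * (0.66 * ε) := by gcongr
  have hεq2 : ε * (ε * convBound v) ≤ ε * (ε * 0.066) := by gcongr; linarith
  have hεb : ε * ‖opK v 3‖ ≤ ε * (0.167 * ε) := by gcongr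
  have d0 := h.coef_two_sub_le hε0
  have d1 : ‖opK v 2 - (2 - Complex.I) / 5‖ ≤ 1.016 * ε ^ 2 := by
    have h1 : 2 * (|lam - 1| + |θ|) * ‖opK v 2‖ ≤
        2 * (0.661 * ε ^ 2 + 0.6655 * ε ^ 2) * 0.4545 := by gcongr
    linarith
  have r0 := ReducedZero.remR_one_sub_le hε0 θ v
  have r1 : ‖remR ε (Real.pi / 2 + θ) v 1 - (-1 + 3 * Complex.I) / 5‖ ≤ 3.005 * ε ^ 2 := by
    have h1 : 3 * |θ| * ‖opK v 2‖ ≤ 3 * (0.6655 * ε ^ 2) * 0.4545 := by gcongr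
    linarith
  -- `θ` depends on `Re R₁ ≈ -0.2` only, whereas the earlier bound used `|R₁| ≈ 0.63`. The resulting
  -- gain is fed back into the estimates of the second coefficient and of `R₁`.
  obtain ⟨t1, n1⟩ := h.theta_lam_le hθ (r1.trans (by linarith : _ ≤ (0.03005 : ℝ)))
  have t2 : |θ| ≤ 0.2325 * ε ^ 2 := by linarith
  have tt : |θ| ^ 2 ≤ 0.0006 * ε ^ 2 := by
    rw [sq]
    have : |θ| * |θ| ≤ (0.2325 * 0.01) * (0.2325 * ε ^ 2) := by gcongr; linarith
    linarith
  have n2 : |lam - 1| ≤ 0.6304 * ε ^ 2 := by linarith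
  have d2 : ‖opK v 2 - (2 - Complex.I) / 5‖ ≤ 0.634 * ε ^ 2 := by
    have h1 : 2 * (|lam - 1| + |θ|) * ‖opK v 2‖ ≤
        2 * (0.6304 * ε ^ 2 + 0.2325 * ε ^ 2) * 0.4545 := by gcongr
    linarith
  have r2 : ‖remR ε (Real.pi / 2 + θ) v 1 - (-1 + 3 * Complex.I) / 5‖ ≤ 1.874 * ε ^ 2 := by
    have h1 : 3 * |θ| * ‖opK v 2‖ ≤ 3 * (0.2325 * ε ^ 2) * 0.4545 := by gcongr
    linarith
  have hK2 : ‖opK v‖ ≤ 0.4723 := by linarith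
  refine ⟨hb, hZ, d2, r2, t2, n2, hK2, ?_⟩
  have h1 := h.norm_le_aux
  rw [abs_of_nonneg hε0] at h1
  have h2 : ε * (4 * ‖opK v‖ + ε * (4 * ‖opK v‖ * ‖opK v‖)) ≤
      0.1 * (4 * 0.4723 + 0.1 * (4 * 0.4723 * 0.4723)) := by gcongr
  have h3 : (|lam - 1| + |θ|) * ‖v‖ ≤ (0.6304 * 0.01 + 0.2325 * 0.01) * (17 / 10) := by
    gcongr
    · linarith
    · linarith
  linarith

/-! ### From sharp bounds to the prescribed neighbourhood -/

theorem seqNorm_eq_norm (a : L1) (h : a 0 = 0) : seqNorm a = 2 * ‖a‖ := by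
  rw [seqNorm, l1_norm_eq, (l1_summable a).tsum_eq_zero_add, h, norm_zero, zero_add]

/-- The approximate coefficients as an element of `ℓ¹`. -/
def approxCL (ε : ℝ) : L1 := ((2 - Complex.I) / 5 * (ε : ℂ)) • unitTwo

theorem approxCL_coe (ε : ℝ) : (approxCL ε : ℕ → ℂ) = approxC ε := by
  funext k; simp [approxCL, approxC, unitTwo_apply]

theorem norm_smul_opK_sub_approxCL (ε : ℝ) (hε : 0 ≤ ε) (v : L1) : ‖ε • opK v - approxCL ε‖ =
    ε * (‖opK v 2 - (2 - Complex.I) / 5‖ + ‖opK v 3‖ + tailFour (opK v)) := by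
  have e : ε • opK v - approxCL ε = ε • (opK v - ((2 - Complex.I) / 5) • unitTwo) := by
    refine l1_ext fun k => ?_
    simp [approxCL]; ring
  rw [e, norm_smul, Real.norm_of_nonneg hε]
  congr 1
  have e2 : ∀ k, (opK v - ((2 - Complex.I) / 5) • unitTwo) k =
      if k = 2 then opK v 2 - (2 - Complex.I) / 5 else opK v k := fun k => by
    simp only [l1_sub_apply, l1_smul_apply, unitTwo_apply, basisSeq]
    by_cases h : k = 2 <;> simp [h]
  rw [norm_eq_add_tailFour _ (by rw [e2]; simp [ReducedZero.opK_zero])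
    (by rw [e2]; simp [ReducedZero.opK_one]), tailFour, e2, e2]
  simp only [e2]
  simp [tailFour]

theorem pi_bounds : 3.1415 < Real.pi ∧ Real.pi < 3.1416 :=
  ⟨Real.pi_gt_d4, Real.pi_lt_d4⟩

theorem alpha_near_aux {ε θ lam im : ℝ} (hε0 : 0 < ε) (hε : ε ≤ 0.1)
    (hlam : lam = Real.cos θ - ε ^ 2 * im) (him : |im - 0.6| ≤ 0.01874)
    (hθ : |θ| ≤ 0.2325 * ε ^ 2) (hθ2 : |θ + 0.2 * ε ^ 2| ≤ 0.0212 * ε ^ 2) :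
    |(Real.pi / 2 + θ) / lam - approxAlpha ε| < 0.0594 * ε ^ 2 := by
  have e2 : ε ^ 2 ≤ 0.01 := by nlinarith
  have e20 : 0 < ε ^ 2 := by positivity
  obtain ⟨p1, p2⟩ := pi_bounds
  have hc := abs_cos_sub_one_le θ
  have tt : |θ| ^ 2 ≤ 0.0006 * ε ^ 2 := by
    rw [sq]
    have : |θ| * |θ| ≤ (0.2325 * 0.01) * (0.2325 * ε ^ 2) := by gcongr; linarith
    linarith
  set el := lam - 1 + 0.6 * ε ^ 2 with hel
  have hel2 : |el| ≤ 0.0191 * ε ^ 2 := by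
    have e : el = (Real.cos θ - 1) - ε ^ 2 * (im - 0.6) := by rw [hel, hlam]; ring
    rw [e]
    refine (abs_sub _ _).trans ?_
    rw [abs_mul, abs_of_pos e20]
    have : ε ^ 2 * |im - 0.6| ≤ ε ^ 2 * 0.01874 := by gcongr
    linarith
  have hlam1 : 0.993 ≤ lam := by
    have := (abs_le.1 hel2).1
    linarith
  set A := approxAlpha ε with hA
  have hA2 : |A| ≤ 1.5785 := by
    rw [hA, approxAlpha, abs_of_nonneg (by
      have : 0 ≤ ε ^ 2 / 5 * (3 * Real.pi / 2 - 1) := by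
        apply mul_nonneg <;> linarith
      linarith)]
    nlinarith
  -- With `λ = 1 - 0.6 ε² + el` the terms of order `ε²` in `ω - Aλ` cancel up to the errors of `θ`
  -- and `λ`; what remains explicitly is quartic in `ε`.
  have key : (Real.pi / 2 + θ) - A * lam =
      (θ + 0.2 * ε ^ 2) + 0.6 * ε ^ 2 * (ε ^ 2 * (0.3 * Real.pi - 0.2)) - A * el := by
    rw [hel, hA, approxAlpha]; ring
  have hb : |(Real.pi / 2 + θ) - A * lam| ≤ 0.058 * ε ^ 2 := by
    rw [key]
    have h1 : |0.6 * ε ^ 2 * (ε ^ 2 * (0.3 * Real.pi - 0.2))| ≤ 0.0046 * ε ^ 2 := by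
      rw [abs_of_nonneg (by
        have : 0 ≤ 0.3 * Real.pi - 0.2 := by linarith
        positivity)]
      have : ε ^ 2 * (0.3 * Real.pi - 0.2) ≤ 0.01 * 0.75 := by
        apply mul_le_mul e2 <;> linarith
      calc 0.6 * ε ^ 2 * (ε ^ 2 * (0.3 * Real.pi - 0.2)) ≤ 0.6 * ε ^ 2 * (0.01 * 0.75) := by gcongr
        _ ≤ _ := by linarith
    have h2 : |A * el| ≤ 1.5785 * (0.0191 * ε ^ 2) := by
      rw [abs_mul]; gcongr
    refine (abs_sub _ _).trans ?_
    refine (add_le_add (abs_add_le _ _) le_rfl).trans ?_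
    linarith
  have hlam0 : 0 < lam := by linarith
  have e : (Real.pi / 2 + θ) / lam - A = ((Real.pi / 2 + θ) - A * lam) / lam := by field_simp
  rw [e, abs_div, abs_of_pos hlam0, div_lt_iff₀ hlam0]
  nlinarith

theorem ReducedZero.isHopfZero {ε θ lam : ℝ} {v : L1} (h : ReducedZero ε θ lam v) (hε0 : 0 < ε)
    (hε : ε ≤ 0.1) (hθ : |θ| ≤ 1 / 20) (hl : |lam - 1| ≤ 1 / 20) (hv : ‖v‖ ≤ 17 / 10) :
    IsHopfZero ε ((Real.pi / 2 + θ) / lam) (Real.pi / 2 + θ) (ε • opK v) := by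
  have b := h.zeroBounds hε0.le hε hθ hl hv
  have e2 : ε ^ 2 ≤ 0.01 := by nlinarith
  have e20 : 0 < ε ^ 2 := by positivity
  have hlam : 0.95 ≤ lam := by have := (abs_le.1 hl).1; linarith
  have hθ' := abs_le.1 hθ
  obtain ⟨p1, p2⟩ := pi_bounds
  have hinv : ∀ k, invK (ε • opK v : L1) k = ε * v k := fun k => by
    simp only [invK, l1_real_smul_apply, opK_apply]
    by_cases hk : 2 ≤ k
    · have : (k : ℂ) ≠ 0 := by exact_mod_cast (by omega : k ≠ 0)
      rw [if_pos hk]; field_simp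
    · rw [if_neg hk]
      obtain rfl | rfl : k = 0 ∨ k = 1 := by omega
      · simp [h.v_zero]
      · simp [h.v_one]
  have hinv' : invK (ε • opK v : L1) = (ε • v : L1) := by
    funext k; rw [hinv]; simp
  obtain ⟨hre, him⟩ := re_im_near (b.rem_near.trans (by linarith : _ ≤ (0.01874 : ℝ)))
  have hθ2 : |θ + 0.2 * ε ^ 2| ≤ 0.0212 * ε ^ 2 := by
    have e : θ + 0.2 * ε ^ 2 = (θ - Real.sin θ)
        + ε ^ 2 * ((remR ε (Real.pi / 2 + θ) v 1).re + 0.2) := by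
      rw [h.sin_eq]; ring
    rw [e]
    refine (abs_add_le _ _).trans ?_
    rw [abs_mul, abs_of_pos e20]
    have h1 := abs_sub_sin_le hθ
    have h2 : ε ^ 2 * |(remR ε (Real.pi / 2 + θ) v 1).re + 0.2| ≤ ε ^ 2 * 0.01874 := by gcongr
    linarith [b.theta_le]
  refine ⟨?_, ?_, ?_, ?_, ?_, ?_, ?_, ?_⟩
  · simp [ReducedZero.opK_zero]
  · simp [ReducedZero.opK_one]
  · rw [hinv']; exact l1_summable _
  · exact h.mapF_eq_zero (by linarith) (by linarith)
  · exact alpha_near_aux hε0 hε h.lam_eq him b.theta_le hθ2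
  · have e : Real.pi / 2 + θ - approxOmega ε = θ + 0.2 * ε ^ 2 := by rw [approxOmega]; ring
    rw [e]
    linarith
  · have e : (fun k => (ε • opK v : L1) k - approxC ε k) = (ε • opK v - approxCL ε : L1) := by
      funext k; rw [l1_sub_apply, ← approxCL_coe]
    rw [e, seqNorm_eq_norm _ (by
      simp [approxCL, unitTwo_apply, basisSeq, ReducedZero.opK_zero]),
      norm_smul_opK_sub_approxCL _ hε0.le]
    -- `0.634 · 0.1 + 0.167 + 0.107 · 0.1 = 0.2411`; the third harmonic dominates.
    have h1 : ‖opK v 2 - (2 - Complex.I) / 5‖ + ‖opK v 3‖ + tailFour (opK v) < 0.246 * ε := by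
      have := b.two_near; have := b.three_le; have := b.tail_le
      nlinarith
    have h2 : ε * (‖opK v 2 - (2 - Complex.I) / 5‖ + ‖opK v 3‖ + tailFour (opK v)) <
        ε * (0.246 * ε) := by gcongr
    nlinarith
  · rw [hinv', seqNorm_eq_norm _ (by simp [h.v_zero]), norm_smul, Real.norm_of_nonneg hε0.le]
    have : ε * ‖v‖ ≤ 0.1 * 1.2 := mul_le_mul hε b.norm_le (norm_nonneg _) (by norm_num)
    linarith

/-! ### The branch in the original coordinates; uniqueness -/

/-- Frequency shift along the branch. -/
def thetaB (ε : ℝ) : ℝ := (branch ε).1 / 20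

/-- The ratio `ω/α` along the branch. -/
def lamB (ε : ℝ) : ℝ := 1 + (branch ε).2.1 / 20

/-- The frequency along the branch. -/
def omegaB (ε : ℝ) : ℝ := Real.pi / 2 + thetaB ε

/-- The parameter along the branch. -/
def alphaB (ε : ℝ) : ℝ := omegaB ε / lamB ε

/-- The coefficients along the branch. -/
def coefB (ε : ℝ) : L1 := ε • opK (branch ε).2.2

theorem reducedZero_branch {ε : ℝ} (hε : |ε| ≤ 11 / 100) :
    ReducedZero ε (thetaB ε) (lamB ε) (branch ε).2.2 :=
  (reducedZero_iff ε _).2 (fixMap_branch hε)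

theorem abs_le_of_mem_Ioc {ε : ℝ} (h : ε ∈ Ioc (0 : ℝ) 0.1) : |ε| < 11 / 100 := by
  rw [abs_of_pos h.1]; linarith [h.2]

theorem abs_thetaB_le {ε : ℝ} (hε : |ε| ≤ 11 / 100) : |thetaB ε| ≤ 1 / 20 :=
  abs_div_twenty_le (branch_mem hε).1

theorem abs_lamB_sub_one_le {ε : ℝ} (hε : |ε| ≤ 11 / 100) : |lamB ε - 1| ≤ 1 / 20 := by
  rw [lamB, add_sub_cancel_left]; exact abs_div_twenty_le (branch_mem hε).2.1

theorem isHopfZero_branch {ε : ℝ} (h : ε ∈ Ioc (0 : ℝ) 0.1) :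
    IsHopfZero ε (alphaB ε) (omegaB ε) (coefB ε) :=
  have hε := (abs_le_of_mem_Ioc h).le
  (reducedZero_branch hε).isHopfZero h.1 h.2 (abs_thetaB_le hε) (abs_lamB_sub_one_le hε)
    (branch_mem hε).2.2

theorem zeroBounds_branch {ε : ℝ} (h : ε ∈ Ioc (0 : ℝ) 0.1) :
    ZeroBounds ε (thetaB ε) (lamB ε) (branch ε).2.2 :=
  have hε := (abs_le_of_mem_Ioc h).le
  (reducedZero_branch hε).zeroBounds h.1.le h.2 (abs_thetaB_le hε) (abs_lamB_sub_one_le hε)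
    (branch_mem hε).2.2

/-- The conditions of `IsHopfZero` are shown to place the rescaled unknowns in `fixDom`, where the
fixed point is unique. -/
theorem isHopfZero_unique {ε α ω : ℝ} {c : L1} (hε : ε ∈ Ioc (0 : ℝ) 0.1)
    (h : IsHopfZero ε α ω c) : α = alphaB ε ∧ ω = omegaB ε ∧ c = coefB ε := by
  obtain ⟨ε0, ε1⟩ := hε
  have e2 : ε ^ 2 ≤ 0.01 := by nlinarith
  have e20 : 0 < ε ^ 2 := by positivity
  obtain ⟨p1, p2⟩ := pi_bounds
  have hα := abs_lt.1 h.alpha_near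
  have hω := abs_lt.1 h.omega_near
  rw [approxAlpha] at hα
  rw [approxOmega] at hω
  have ha1 : 1.57 ≤ α := by nlinarith
  have hθ : |ω - Real.pi / 2| ≤ 1 / 400 := by rw [abs_le]; constructor <;> linarith
  have hωα : |ω - α| ≤ 1.2 / 100 := by
    rw [abs_le]; constructor <;> nlinarith
  have hν : |ω / α - 1| ≤ 1 / 100 := by
    have e : ω / α - 1 = (ω - α) / α := by field_simp
    rw [e, abs_div, abs_of_pos (by linarith : 0 < α), div_le_iff₀ (by linarith)]
    linarith
  let v : L1 := l1Mk (fun k => invK c k / ε) (by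
    simp only [norm_div]; exact h.summable_invK.div_const _)
  have hv : ∀ k, v k = k * c k / ε := fun k => rfl
  have v0 : v 0 = 0 := by simp [hv]
  have v1 : v 1 = 0 := by simp [hv, h.coeff_one]
  have hεc : (ε : ℂ) ≠ 0 := by exact_mod_cast ε0.ne'
  have hK : ε • opK v = c := by
    refine l1_ext fun k => ?_
    rw [l1_real_smul_apply, opK_apply]
    by_cases hk : 2 ≤ k
    · have : (k : ℂ) ≠ 0 := by exact_mod_cast (by omega : k ≠ 0)
      rw [if_pos hk, hv]; field_simp
    · rw [if_neg hk, mul_zero]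
      obtain rfl | rfl : k = 0 ∨ k = 1 := by omega
      · exact h.coeff_zero.symm
      · exact h.coeff_one.symm
  have hz : ReducedZero ε (ω - Real.pi / 2) (ω / α) v :=
    reducedZero_of_mapF ε0.ne' (by linarith) v0 v1 (by rw [hK]; exact h.zero)
  have hKn : ‖opK v‖ ≤ 0.472 := by
    have h1 := h.c_near
    have e : (fun k => c k - approxC ε k) = (ε • opK v - approxCL ε : L1) := by
      funext k; rw [l1_sub_apply, ← approxCL_coe, hK]
    rw [e, seqNorm_eq_norm _ (by
      simp [approxCL, unitTwo_apply, basisSeq, ReducedZero.opK_zero])] at h1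
    have h2 : ‖approxCL ε‖ ≤ 0.44722 * ε := by
      have e3 : ‖(2 - Complex.I) / 5‖ ≤ 0.44722 := by
        rw [norm_div, Complex.norm_def]
        have : √(Complex.normSq (2 - Complex.I)) ≤ 2.2361 := by
          rw [Real.sqrt_le_left (by norm_num)]
          norm_num [Complex.normSq_apply]
        simp only [Complex.norm_ofNat]
        linarith
      rw [approxCL, norm_smul, norm_unitTwo, norm_mul, Complex.norm_real,
        Real.norm_of_nonneg ε0.le, mul_one]
      gcongr
    have h3 := norm_le_norm_add_norm_sub' (ε • opK v) (approxCL ε)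
    rw [norm_smul, Real.norm_of_nonneg ε0.le] at h3
    have h4 : ε * ‖opK v‖ ≤ ε * 0.472 := by nlinarith
    exact le_of_mul_le_mul_left h4 ε0
  -- The bound on `K⁻¹ c` alone controls `v` only up to a factor `1/ε`. The uniform bound comes from
  -- the equation: its right-hand side involves `‖v‖` with a small coefficient, and otherwise only
  -- `‖K v‖`, which the distance to the approximate solution controls.
  have hvn : ‖v‖ ≤ 17 / 10 := by
    have h1 := hz.norm_le_aux
    rw [abs_of_pos ε0] at h1
    have h2 : ε * (4 * ‖opK v‖ + ε * (4 * ‖opK v‖ * ‖opK v‖)) ≤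
        0.1 * (4 * 0.472 + 0.1 * (4 * 0.472 * 0.472)) := by gcongr
    have h3 : (|ω / α - 1| + |ω - Real.pi / 2|) * ‖v‖ ≤ (1 / 100 + 1 / 400) * ‖v‖ := by gcongr
    linarith
  have hε' : |ε| ≤ 11 / 100 := by rw [abs_of_pos ε0]; linarith
  have hfix : fixMap ε (20 * (ω - Real.pi / 2), 20 * (ω / α - 1), v) =
      (20 * (ω - Real.pi / 2), 20 * (ω / α - 1), v) := by
    rw [← reducedZero_iff]
    convert hz using 1 <;> ring
  have hb := eq_branch hε' (x := (20 * (ω - Real.pi / 2), 20 * (ω / α - 1), v)) ⟨by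
    rw [abs_mul, abs_of_pos (by norm_num : (0 : ℝ) < 20)]; linarith, by
    rw [abs_mul, abs_of_pos (by norm_num : (0 : ℝ) < 20)]; linarith, hvn⟩ hfix
  have hω' : ω = omegaB ε := by rw [omegaB, thetaB, ← hb]; ring
  have hl' : lamB ε = ω / α := by rw [lamB, ← hb]; ring
  refine ⟨?_, hω', ?_⟩
  · rw [alphaB, hl', ← hω', div_div_cancel₀]
    linarith [abs_le.1 hθ]
  · rw [coefB, ← hb, hK]

/-! ### Lipschitz estimates along the branch; the sign of the derivative of the parameter -/

theorem remR_sub_remR (e ε ω : ℝ) (v : L1) :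
    remR e ω v - remR ε ω v = (e - ε) • convL (phaseK ω v) (opK v) := by
  unfold remR; rw [sub_smul]; abel

theorem norm_convL_phaseK_le (ω : ℝ) (v : L1) :
    ‖convL (phaseK ω v) (opK v)‖ ≤ 4 * ‖opK v‖ * ‖opK v‖ := by
  have := norm_convL_le (phaseK ω v) (opK v)
  rwa [norm_phaseK_eq] at this

theorem norm_opK_two_sub_le (v v' : L1) : ‖opK v 2 - opK v' 2‖ ≤ ‖v - v'‖ / 2 := by
  rw [← l1_sub_apply, ← map_sub]
  exact (l1_norm_apply_le _ 2).trans (norm_opK_le _)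

/-- Only the second coefficient enters the first mode linearly, with a factor of modulus close to
`√2`. This is better than the bound of `norm_remR_sub_le` for the whole remainder. -/
theorem norm_remR_one_sub_remR_one_le {e ε θ θ' : ℝ} {v v' : L1} (hε0 : 0 ≤ ε) (hε : ε ≤ 0.1)
    (hθ : |θ| ≤ 0.0024) (hv' : ‖v'‖ ≤ 1.21) (hK : ‖opK v‖ ≤ 0.48) (hK' : ‖opK v'‖ ≤ 0.48) :
    ‖remR ε (Real.pi / 2 + θ) v 1 - remR e (Real.pi / 2 + θ') v' 1‖ ≤
      0.9028 * ‖v - v'‖ + 1.68 * |θ - θ'| + 0.9216 * |e - ε| := by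
  set ω := Real.pi / 2 + θ
  set ω' := Real.pi / 2 + θ'
  have hω : ω - ω' = θ - θ' := by ring
  set Q := convL (phaseK ω v) (opK v)
  set Q' := convL (phaseK ω' v') (opK v')
  have hd : ‖opK v - opK v'‖ ≤ ‖v - v'‖ / 2 := by rw [← map_sub]; exact norm_opK_le _
  have hW : ‖phaseK ω v - phaseK ω' v'‖ ≤ ‖v - v'‖ / 2 + |θ - θ'| * 1.21 := by
    refine (norm_phaseK_sub_phaseK_le ω ω' v v').trans (add_le_add (norm_opK_le _) ?_)
    rw [hω]; gcongr
  have hQ : ‖Q 1 - Q' 1‖ ≤ 1.92 * (‖v - v'‖ + |θ - θ'| * 1.21) := by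
    refine (l1_norm_apply_le (Q - Q') 1).trans ((norm_convL_sub_le _ _ _ _).trans ?_)
    rw [norm_phaseK_eq]
    have h1 : 4 * ‖phaseK ω v - phaseK ω' v'‖ * ‖opK v‖ ≤
        4 * (‖v - v'‖ / 2 + |θ - θ'| * 1.21) * 0.48 := by gcongr
    have h2 : 4 * ‖opK v'‖ * ‖opK v - opK v'‖ ≤ 4 * 0.48 * (‖v - v'‖ / 2) := by gcongr
    linarith
  have hQ' : ‖Q' 1‖ ≤ 0.9216 := by
    refine (l1_norm_apply_le Q' 1).trans ((norm_convL_phaseK_le _ _).trans ?_)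
    have : 4 * ‖opK v'‖ * ‖opK v'‖ ≤ 4 * 0.48 * 0.48 := by gcongr
    linarith
  set C := ephase (-ω) 1 + ephase ω 2 with hC
  set C' := ephase (-ω') 1 + ephase ω' 2 with hC'
  have hCn : ‖C‖ ≤ 1.4215 := by
    have h1 := norm_coef_down_two θ
    have h2 := norm_le_norm_add_norm_sub' C (Complex.I - 1)
    rw [norm_I_sub_one] at h2
    linarith [sqrt_two_le]
  have hCd : ‖C - C'‖ ≤ 3 * |θ - θ'| := by
    have h1 := norm_ephase_sub_le (-ω) (-ω') 1
    have h2 := norm_ephase_sub_le ω ω' 2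
    have e1 : |-ω - -ω'| = |θ - θ'| := by rw [← hω, ← abs_neg]; congr 1; ring
    rw [e1] at h1
    rw [hω] at h2
    have e : C - C' = (ephase (-ω) 1 - ephase (-ω') 1) + (ephase ω 2 - ephase ω' 2) := by
      rw [hC, hC']; ring
    rw [e]
    refine (norm_add_le_of_le h1 h2).trans (le_of_eq ?_)
    push_cast; ring
  have hsplit : remR ε ω v 1 - remR e ω' v' 1 = C * (opK v 2 - opK v' 2) + (C - C') * opK v' 2
      + ε * (Q 1 - Q' 1) - ((e - ε : ℝ) : ℂ) * Q' 1 := by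
    rw [remR_one, remR_one]
    simp only [Q, Q', convL_apply, phaseK_coe]
    push_cast; ring
  rw [hsplit]
  have n1 : ‖C * (opK v 2 - opK v' 2)‖ ≤ 1.4215 * (‖v - v'‖ / 2) := by
    rw [norm_mul]; exact mul_le_mul hCn (norm_opK_two_sub_le v v') (norm_nonneg _) (by norm_num)
  have n2 : ‖(C - C') * opK v' 2‖ ≤ 3 * |θ - θ'| * 0.48 := by
    rw [norm_mul]
    exact mul_le_mul hCd ((l1_norm_apply_le _ 2).trans hK') (norm_nonneg _) (by positivity)
  have n3 : ‖(ε : ℂ) * (Q 1 - Q' 1)‖ ≤ 0.1 * (1.92 * (‖v - v'‖ + |θ - θ'| * 1.21)) := by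
    rw [norm_mul, Complex.norm_real, Real.norm_of_nonneg hε0]
    exact mul_le_mul hε hQ (norm_nonneg _) (by norm_num)
  have n4 : ‖((e - ε : ℝ) : ℂ) * Q' 1‖ ≤ |e - ε| * 0.9216 := by
    rw [norm_mul, Complex.norm_real, Real.norm_eq_abs]; gcongr
  refine (norm_sub_le _ _).trans ((add_le_add (norm_add_le_of_le (norm_add_le_of_le n1 n2) n3)
    n4).trans ?_)
  have := norm_nonneg (v - v')
  have := abs_nonneg (θ - θ')
  linarith

/-- The two fixed point equations are subtracted. The right-hand side contains `‖v - v'‖` with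
coefficient at most `4/3 · 0.233 < 0.311`, which is absorbed and leaves `0.689`. -/
theorem ReducedZero.norm_sub_le {e ε θ θ' lam lam' : ℝ} {v v' : L1} (h : ReducedZero ε θ lam v)
    (h' : ReducedZero e θ' lam' v') (hε0 : 0 ≤ ε) (hε : ε ≤ 0.1) (he : |e| ≤ 0.101)
    (hθ : |θ| ≤ 0.0024) (hl : |lam - 1| ≤ 0.0064) (hv : ‖v‖ ≤ 1.21) (hv' : ‖v'‖ ≤ 1.21)
    (hK' : ‖opK v'‖ ≤ 0.48) :
    0.689 * ‖v - v'‖ ≤ 4 / 3 * (1.21 * |lam - lam'| + 2.603 * |θ - θ'| + 2.114 * |e - ε|) := by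
  have hG := norm_innerG_sub_le ε θ θ' (lam - 1) (lam' - 1) hv hv'
  rw [sub_sub_sub_cancel_right, abs_of_nonneg hε0] at hG
  set ω' := Real.pi / 2 + θ' with hω'
  have hE : innerG e θ' (lam' - 1) v' - innerG ε θ' (lam' - 1) v' =
      (e - ε) • remR ε ω' v' + (e * (e - ε)) • convL (phaseK ω' v') (opK v') := by
    have := remR_sub_remR e ε ω' v'
    rw [sub_eq_iff_eq_add] at this
    unfold innerG
    rw [← hω', this, smul_add, smul_smul, sub_smul]
    abel
  have hEn : ‖innerG e θ' (lam' - 1) v' - innerG ε θ' (lam' - 1) v'‖ ≤ 2.114 * |e - ε| := by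
    rw [hE]
    have h1 : ‖remR ε ω' v'‖ ≤ 4 * 0.48 + 0.1 * (4 * 0.48 * 0.48) := by
      refine (norm_remR_le _ _ _).trans ?_
      rw [abs_of_nonneg hε0]
      gcongr
    have h2 : ‖convL (phaseK ω' v') (opK v')‖ ≤ 4 * 0.48 * 0.48 :=
      (norm_convL_phaseK_le _ _).trans (by gcongr)
    refine (norm_add_le _ _).trans ?_
    rw [norm_smul, norm_smul, Real.norm_eq_abs, Real.norm_eq_abs, abs_mul]
    have h3 : |e - ε| * ‖remR ε ω' v'‖ ≤
        |e - ε| * (4 * 0.48 + 0.1 * (4 * 0.48 * 0.48)) := by gcongr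
    have h4 : |e| * |e - ε| * ‖convL (phaseK ω' v') (opK v')‖ ≤
        0.101 * |e - ε| * (4 * 0.48 * 0.48) := by gcongr
    have := abs_nonneg (e - ε)
    linarith
  have e1 : v - v' = -precond ((innerG ε θ (lam - 1) v - innerG ε θ' (lam' - 1) v')
      - (innerG e θ' (lam' - 1) v' - innerG ε θ' (lam' - 1) v')) := by
    conv_lhs => rw [← h.eq_neg_precond, ← h'.eq_neg_precond]
    simp only [map_sub]; abel
  have h1 : ‖v - v'‖ ≤ 4 / 3 * (‖innerG ε θ (lam - 1) v - innerG ε θ' (lam' - 1) v'‖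
      + 2.114 * |e - ε|) := by
    conv_lhs => rw [e1, norm_neg]
    refine (norm_precond_le _).trans (mul_le_mul_of_nonneg_left ?_ (by norm_num))
    exact (_root_.norm_sub_le _ _).trans (add_le_add le_rfl hEn)
  have D0 := norm_nonneg (v - v')
  have T0 := abs_nonneg (θ - θ')
  have h2 : (|lam - 1| + |θ|) * ‖v - v'‖ ≤ (0.0064 + 0.0024) * ‖v - v'‖ := by gcongr
  have h3 : ε * (2 * ‖v - v'‖ + 3 * 1.21 * |θ - θ'| + ε * (2 * 1.21 * ‖v - v'‖
      + 2 * 1.21 ^ 2 * |θ - θ'|)) ≤ 0.1 * (2 * ‖v - v'‖ + 3 * 1.21 * |θ - θ'|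
      + 0.1 * (2 * 1.21 * ‖v - v'‖ + 2 * 1.21 ^ 2 * |θ - θ'|)) := by gcongr
  linarith

/-- The two scalar equations of the first mode are subtracted, with `|ε² - e²| ≤ 0.201 |e - ε|`. The
constants `0.0465` and `0.127` bound `0.201 · 0.23` and `0.201 · 0.63`. -/
theorem ReducedZero.abs_theta_lam_sub_le {e ε θ θ' lam lam' : ℝ} {v v' : L1} {ρ : ℝ}
    (h : ReducedZero ε θ lam v) (h' : ReducedZero e θ' lam' v') (hε0 : 0 ≤ ε) (hε : ε ≤ 0.1)
    (he : |e| ≤ 0.101) (hθ : |θ| ≤ 1 / 20) (hθ' : |θ'| ≤ 1 / 20)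
    (hre : |(remR e (Real.pi / 2 + θ') v' 1).re| ≤ 0.23)
    (him : |(remR e (Real.pi / 2 + θ') v' 1).im| ≤ 0.63)
    (hρ : ‖remR ε (Real.pi / 2 + θ) v 1 - remR e (Real.pi / 2 + θ') v' 1‖ ≤ ρ) :
    0.99 * |θ - θ'| ≤ 0.01 * ρ + 0.0465 * |e - ε| ∧
      |lam - lam'| ≤ 0.05 * |θ - θ'| + 0.01 * ρ + 0.127 * |e - ε| := by
  set r := remR ε (Real.pi / 2 + θ) v 1
  set r' := remR e (Real.pi / 2 + θ') v' 1
  have e2 : ε ^ 2 ≤ 0.01 := by nlinarith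
  have hr1 : |r.re - r'.re| ≤ ρ := (Complex.abs_re_le_norm (r - r')).trans hρ
  have hr2 : |r.im - r'.im| ≤ ρ := (Complex.abs_im_le_norm (r - r')).trans hρ
  have hρ0 : 0 ≤ ρ := (abs_nonneg _).trans hr1
  have hs : |ε ^ 2 - e ^ 2| ≤ 0.201 * |e - ε| := by
    have : ε ^ 2 - e ^ 2 = -((ε + e) * (e - ε)) := by ring
    rw [this, abs_neg, abs_mul]
    have h1 := abs_add_le ε e
    rw [abs_of_nonneg hε0] at h1
    exact mul_le_mul_of_nonneg_right (by linarith) (abs_nonneg _)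
  have key : ∀ x x' b : ℝ, |x - x'| ≤ ρ → |x'| ≤ b →
      |ε ^ 2 * x - e ^ 2 * x'| ≤ 0.01 * ρ + 0.201 * |e - ε| * b := fun x x' b h1 h2 => by
    have : ε ^ 2 * x - e ^ 2 * x' = ε ^ 2 * (x - x') + (ε ^ 2 - e ^ 2) * x' := by ring
    rw [this]
    refine (abs_add_le _ _).trans (add_le_add ?_ ?_)
    · rw [abs_mul, abs_of_nonneg (sq_nonneg ε)]; gcongr
    · rw [abs_mul]; gcongr
  have k1 := key _ _ _ hr1 hre
  have k2 := key _ _ _ hr2 him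
  rw [← h.sin_eq, ← h'.sin_eq] at k1
  constructor
  · have h1 := abs_sub_sin_sub_le hθ hθ'
    have h2 : |θ - θ'| ≤ |(θ - Real.sin θ) - (θ' - Real.sin θ')|
        + |Real.sin θ - Real.sin θ'| := by
      refine le_trans (le_of_eq ?_) (abs_add_le _ _)
      congr 1; ring
    have := abs_nonneg (e - ε)
    linarith
  · have h1 := abs_cos_sub_cos_le hθ hθ'
    have e3 : lam - lam' = (Real.cos θ - Real.cos θ') - (ε ^ 2 * r.im - e ^ 2 * r'.im) := by
      rw [h.lam_eq, h'.lam_eq]; ring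
    rw [e3]
    refine (abs_sub _ _).trans ?_
    have := abs_nonneg (e - ε)
    linarith

/-- The remainder in the first mode is Lipschitz along the branch. -/
theorem ReducedZero.norm_rem_sub_le {e ε θ θ' lam lam' : ℝ} {v v' : L1}
    (h : ReducedZero ε θ lam v) (h' : ReducedZero e θ' lam' v') (hε0 : 0 ≤ ε) (hε : ε ≤ 0.1)
    (he : |e| ≤ 0.101) (hθ : |θ| ≤ 0.0024) (hl : |lam - 1| ≤ 0.0064) (hθ' : |θ'| ≤ 1 / 20)
    (hv : ‖v‖ ≤ 1.21) (hv' : ‖v'‖ ≤ 1.21) (hK : ‖opK v‖ ≤ 0.48) (hK' : ‖opK v'‖ ≤ 0.48)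
    (hre : |(remR e (Real.pi / 2 + θ') v' 1).re| ≤ 0.23)
    (him : |(remR e (Real.pi / 2 + θ') v' 1).im| ≤ 0.63) :
    ‖remR e (Real.pi / 2 + θ') v' 1 - remR ε (Real.pi / 2 + θ) v 1‖ ≤ 6.5 * |e - ε| := by
  have h1 := norm_remR_one_sub_remR_one_le (e := e) (θ' := θ') (v := v) hε0 hε hθ hv' hK hK'
  have h2 := h.norm_sub_le h' hε0 hε he hθ hl hv hv' hK'
  obtain ⟨h3, h4⟩ := h.abs_theta_lam_sub_le h' hε0 hε he (hθ.trans (by norm_num)) hθ' hre him h1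
  rw [norm_sub_rev]
  -- What remains is a system of linear inequalities for `|θ - θ'|`, `|λ - λ'|` and `‖v - v'‖`. The
  -- factors `0.01` (from `ε²`) make the feedback through `θ` and `λ` weak enough to eliminate all
  -- three.
  have := abs_nonneg (e - ε)
  have := abs_nonneg (θ - θ')
  have := norm_nonneg (v - v')
  linarith

/-- The remainder in the first mode along the branch. -/
def sigmaB (ε : ℝ) : ℂ := remR ε (omegaB ε) (branch ε).2.2 1

section Branch

variable {ε : ℝ}

theorem contDiffAt_thetaB (hε : |ε| < 11 / 100) : ContDiffAt ℝ 1 thetaB ε :=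
  (contDiffAt_branch hε).fst.div_const 20

theorem contDiffAt_lamB (hε : |ε| < 11 / 100) : ContDiffAt ℝ 1 lamB ε :=
  contDiffAt_const.add ((contDiffAt_branch hε).snd.fst.div_const 20)

theorem contDiffAt_omegaB (hε : |ε| < 11 / 100) : ContDiffAt ℝ 1 omegaB ε :=
  contDiffAt_const.add (contDiffAt_thetaB hε)

theorem contDiffAt_coefB (hε : |ε| < 11 / 100) : ContDiffAt ℝ 1 coefB ε := by
  have h : ContDiffAt ℝ 1 (fun ε => opK (branch ε).2.2) ε :=
    opK.contDiff.contDiffAt.comp ε (contDiffAt_branch hε).snd.snd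
  exact contDiffAt_id.smul h

theorem lamB_pos (hε : |ε| ≤ 11 / 100) : 0 < lamB ε := by
  linarith [(abs_le.1 (abs_lamB_sub_one_le hε)).1]

theorem contDiffAt_alphaB (hε : |ε| < 11 / 100) : ContDiffAt ℝ 1 alphaB ε :=
  (contDiffAt_omegaB hε).div (contDiffAt_lamB hε) (lamB_pos hε.le).ne'

theorem contDiff_remR_one : ContDiff ℝ 1 fun p : ℝ × ℝ × L1 => remR p.1 p.2.1 p.2.2 1 :=
  (lp.evalCLM ℝ (fun _ : ℕ => ℂ) 1 1).contDiff.comp contDiff_remR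

theorem contDiffAt_sigmaB (hε : |ε| < 11 / 100) : ContDiffAt ℝ 1 sigmaB ε := by
  have h2 : ContDiffAt ℝ 1 (fun ε => (ε, omegaB ε, (branch ε).2.2)) ε :=
    contDiffAt_id.prodMk ((contDiffAt_omegaB hε).prodMk (contDiffAt_branch hε).snd.snd)
  have h3 := (contDiff_remR_one.contDiffAt (x := (ε, omegaB ε, (branch ε).2.2))).comp ε h2
  exact h3

theorem sigmaB_near (h : ε ∈ Ioc (0 : ℝ) 0.1) :
    |(sigmaB ε).re + 0.2| ≤ 0.01874 ∧ |(sigmaB ε).im - 0.6| ≤ 0.01874 := by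
  have b := zeroBounds_branch h
  have e2 : ε ^ 2 ≤ 0.01 := by nlinarith [h.1, h.2]
  exact re_im_near (b.rem_near.trans (by linarith : _ ≤ (0.01874 : ℝ)))

/-- A Lipschitz bound between `ε` and nearby `e` bounds the derivative. Such an `e` may exceed 0.1,
where the sharp bounds are not available; it inherits slightly weaker ones (1.21, 0.48, 0.23, 0.63)
from `ε` by continuity, and two-sided derivatives can be used even at `ε = 0.1`. -/
theorem norm_deriv_sigmaB_le (h : ε ∈ Ioc (0 : ℝ) 0.1) : ‖deriv sigmaB ε‖ ≤ 6.5 := by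
  have hε := abs_le_of_mem_Ioc h
  have b := zeroBounds_branch h
  have hd := ((contDiffAt_sigmaB hε).differentiableAt one_ne_zero).hasDerivAt
  have e2 : ε ^ 2 ≤ 0.01 := by nlinarith [h.1, h.2]
  obtain ⟨s1, s2⟩ := sigmaB_near h
  have hb := (contDiffAt_branch hε).continuousAt
  have hs := (contDiffAt_sigmaB hε).continuousAt
  have c1 : ContinuousAt (fun e => ‖(branch e).2.2‖) ε := hb.snd.snd.norm
  have c2 : ContinuousAt (fun e => ‖opK (branch e).2.2‖) ε :=
    (opK.continuous.continuousAt.comp hb.snd.snd).norm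
  have c3 : ContinuousAt (fun e => |(sigmaB e).re|) ε :=
    (Complex.continuous_re.continuousAt.comp hs).abs
  have c4 : ContinuousAt (fun e => |(sigmaB e).im|) ε :=
    (Complex.continuous_im.continuousAt.comp hs).abs
  have c5 : ContinuousAt (fun e : ℝ => |e|) ε := continuous_abs.continuousAt
  have hv := b.norm_le
  have hK := b.norm_K_le
  refine hd.le_of_lip' (by norm_num) ?_
  filter_upwards [c1.eventually_lt continuousAt_const (by linarith : _ < (1.21 : ℝ)),
    c2.eventually_lt continuousAt_const (by linarith : _ < (0.48 : ℝ)),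
    c3.eventually_lt continuousAt_const (abs_lt.2
      ⟨by linarith [abs_le.1 s1], by linarith [abs_le.1 s1]⟩ : _ < (0.23 : ℝ)),
    c4.eventually_lt continuousAt_const (abs_lt.2
      ⟨by linarith [abs_le.1 s2], by linarith [abs_le.1 s2]⟩ : _ < (0.63 : ℝ)),
    c5.eventually_lt continuousAt_const (by rw [abs_of_pos h.1]; linarith [h.2] : _ < (0.101 : ℝ))]
    with e e1 e2' e3 e4 e5
  have he : |e| ≤ 11 / 100 := by linarith
  exact (reducedZero_branch hε.le).norm_rem_sub_le (reducedZero_branch he) h.1.le h.2 e5.le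
    (by linarith [b.theta_le]) (by linarith [b.lam_le]) (abs_thetaB_le he) (by linarith) e1.le
    (by linarith) e2'.le e3.le e4.le

/-- The algebra behind the sign of the derivative of the parameter: `t`, `l` are the derivatives
of `θ` and `λ`, and `r`, `d` are the first mode of the remainder and its derivative. -/
theorem alpha_deriv_pos_aux {ε θ lam t l : ℝ} {r d : ℂ} (h0 : 0 < ε) (h1 : ε ≤ 0.1)
    (hθ : |θ| ≤ 0.00233) (hlam : |lam - 1| ≤ 0.0064) (hr : |r.re + 0.2| ≤ 0.01874)
    (hi : |r.im - 0.6| ≤ 0.01874) (hd : ‖d‖ ≤ 6.5)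
    (E1 : Real.cos θ * t = 2 * ε * r.re + ε ^ 2 * d.re)
    (E2 : l = -Real.sin θ * t - (2 * ε * r.im + ε ^ 2 * d.im)) :
    0 < t * lam - (Real.pi / 2 + θ) * l := by
  obtain ⟨p1, p2⟩ := pi_bounds
  have hc := Real.cos_le_one θ
  have hc' : 0.999 ≤ Real.cos θ := by
    have h3 := abs_le.1 (abs_cos_sub_one_le θ)
    have : |θ| ^ 2 ≤ 0.00233 ^ 2 := by gcongr
    linarith
  have hs : |Real.sin θ| ≤ 0.00233 := (Real.abs_sin_le_abs).trans hθ
  set c := Real.cos θ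
  set s := Real.sin θ
  set w := Real.pi / 2 + θ with hw
  rw [abs_le] at hθ hlam hr hi
  have w0 : 1.568 ≤ w := by rw [hw]; linarith
  have w1 : w ≤ 1.5735 := by rw [hw]; linarith
  have hws : |w * s| ≤ 1.5735 * 0.00233 := by
    rw [abs_mul, abs_of_pos (by linarith : 0 < w)]; gcongr
  rw [abs_le] at hws
  set m := lam + w * s with hm
  set n := w * c with hnn
  have m1 : m ≤ 1.0102 := by rw [hm]; linarith
  have m0 : 0.98 ≤ m := by rw [hm]; linarith
  have n1 : n ≤ 1.5735 := by
    have : w * c ≤ w * 1 := by gcongr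
    linarith
  have n0 : 1.566 ≤ n := by
    have : 1.568 * 0.999 ≤ w * c := by gcongr
    linarith
  -- `t` and `l` are eliminated after multiplication by `cos θ > 0`. At `ε = 0` one has `m = 1` and
  -- `n = π/2`.
  have key : c * (t * lam - w * l) = 2 * ε * (r.re * m + n * r.im)
      + ε ^ 2 * (m * d.re + n * d.im) := by
    rw [E2, hm, hnn]
    linear_combination (lam + w * s) * E1
  -- The limiting value is `-1/5 + (π/2)(3/5) ≈ 0.74`.
  have k1 : 0.68 ≤ r.re * m + n * r.im := by
    have j1 : 1.566 * 0.5812 ≤ n * r.im := by gcongr; linarith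
    have j2 : -r.re * m ≤ 0.2188 * 1.0102 := by gcongr; linarith
    linarith
  -- Cauchy–Schwarz in the plane: `√(1.0102² + 1.5735²) · 6.5 < 12.2`.
  have k2 : -12.2 ≤ m * d.re + n * d.im := by
    have hD : d.re ^ 2 + d.im ^ 2 ≤ 6.5 ^ 2 := by
      have := Complex.sq_norm d
      rw [Complex.normSq_apply] at this
      have h3 : ‖d‖ ^ 2 ≤ 6.5 ^ 2 := by gcongr
      linarith
    have h4 : m ^ 2 + n ^ 2 ≤ 1.0102 ^ 2 + 1.5735 ^ 2 := by gcongr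
    have h5 : (m * d.re + n * d.im) ^ 2 ≤ (1.0102 ^ 2 + 1.5735 ^ 2) * 6.5 ^ 2 := by
      calc (m * d.re + n * d.im) ^ 2 ≤ (m ^ 2 + n ^ 2) * (d.re ^ 2 + d.im ^ 2) := by
            linarith [sq_nonneg (m * d.im - n * d.re)]
        _ ≤ _ := by gcongr
    have h6 := abs_le_of_sq_le_sq (a := m * d.re + n * d.im) (b := 12.2)
      (h5.trans (by norm_num)) (by norm_num)
    exact (abs_le.1 h6).1
  -- The sum is at least `ε (2 · 0.68 - 12.2 ε)`, and `1.36 > 1.22` decides the sign for `ε ≤ 0.1`.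
  have k3 : 0 < c * (t * lam - w * l) := by
    rw [key]
    have h7 : ε ^ 2 * -12.2 ≤ ε ^ 2 * (m * d.re + n * d.im) := by gcongr
    have h8 : 2 * ε * 0.68 ≤ 2 * ε * (r.re * m + n * r.im) := by gcongr
    have h9 : ε * ε ≤ ε * 0.1 := by gcongr
    linarith
  exact pos_of_mul_pos_right k3 (by linarith)

theorem deriv_alphaB_pos (h : ε ∈ Ioc (0 : ℝ) 0.1) : 0 < deriv alphaB ε := by
  have hε := abs_le_of_mem_Ioc h
  have b := zeroBounds_branch h
  obtain ⟨h0, h1⟩ := h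
  have e2 : ε ^ 2 ≤ 0.01 := by nlinarith
  obtain ⟨s1, s2⟩ := sigmaB_near ⟨h0, h1⟩
  have hd := ((contDiffAt_sigmaB hε).differentiableAt one_ne_zero).hasDerivAt
  have hθ := ((contDiffAt_thetaB hε).differentiableAt one_ne_zero).hasDerivAt
  have hl := ((contDiffAt_lamB hε).differentiableAt one_ne_zero).hasDerivAt
  have hω : HasDerivAt omegaB (deriv thetaB ε) ε := hθ.const_add _
  have hlp := lamB_pos hε.le
  have hα : HasDerivAt alphaB _ ε := hω.div hl hlp.ne'
  rw [hα.deriv]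
  refine div_pos ?_ (by positivity)
  set t := deriv thetaB ε
  set l := deriv lamB ε
  set D := deriv sigmaB ε
  have hn : ‖D‖ ≤ 6.5 := norm_deriv_sigmaB_le ⟨h0, h1⟩
  have hre : HasDerivAt (fun e => (sigmaB e).re) D.re ε :=
    (Complex.reCLM.hasFDerivAt.comp_hasDerivAt ε hd)
  have him : HasDerivAt (fun e => (sigmaB e).im) D.im ε :=
    (Complex.imCLM.hasFDerivAt.comp_hasDerivAt ε hd)
  have hsq : HasDerivAt (fun e : ℝ => e ^ 2) (2 * ε) ε := by simpa using hasDerivAt_pow 2 ε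
  have ev : ∀ᶠ e in 𝓝 ε, |e| ≤ 11 / 100 :=
    (continuous_abs.continuousAt.eventually_lt continuousAt_const hε).mono fun _ h => h.le
  have E1 : Real.cos (thetaB ε) * t = 2 * ε * (sigmaB ε).re + ε ^ 2 * D.re := by
    refine hθ.sin.unique ((hsq.mul hre).congr_of_eventuallyEq ?_)
    filter_upwards [ev] with e he
    exact (reducedZero_branch he).sin_eq
  have E2 : l = -Real.sin (thetaB ε) * t - (2 * ε * (sigmaB ε).im + ε ^ 2 * D.im) := by
    refine hl.unique ((hθ.cos.sub (hsq.mul him)).congr_of_eventuallyEq ?_)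
    filter_upwards [ev] with e he
    exact (reducedZero_branch he).lam_eq
  exact alpha_deriv_pos_aux h0 h1 (by linarith [b.theta_le]) (by linarith [b.lam_le]) s1 s2 hn E1 E2

end Branch

/-! ### Monotonicity, limits and range of the parameter -/

theorem derivWithin_alphaB {ε : ℝ} (h : ε ∈ Ioc (0 : ℝ) 0.1) :
    derivWithin alphaB (Ioc 0 0.1) ε = deriv alphaB ε :=
  ((contDiffAt_alphaB (abs_le_of_mem_Ioc h)).differentiableAt one_ne_zero).derivWithin
    ((uniqueDiffOn_Ioc (0 : ℝ) 0.1) ε h)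

theorem strictMonoOn_alphaB : StrictMonoOn alphaB (Ioc 0 0.1) := by
  refine strictMonoOn_of_deriv_pos (convex_Ioc 0 0.1) (fun ε h =>
    (contDiffAt_alphaB (abs_le_of_mem_Ioc h)).continuousAt.continuousWithinAt) fun ε h => ?_
  rw [interior_Ioc] at h
  exact deriv_alphaB_pos ⟨h.1, h.2.le⟩

theorem alphaB_bounds {ε : ℝ} (h : ε ∈ Ioc (0 : ℝ) 0.1) :
    Real.pi / 2 + 0.68 * ε ^ 2 < alphaB ε ∧ alphaB ε < Real.pi / 2 + 0.81 * ε ^ 2 := by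
  have h1 := abs_lt.1 (isHopfZero_branch h).alpha_near
  rw [approxAlpha] at h1
  obtain ⟨p1, p2⟩ := pi_bounds
  have : 0 < ε ^ 2 := by have := h.1; positivity
  constructor <;> nlinarith

theorem abs_omegaB_sub_le {ε : ℝ} (h : ε ∈ Ioc (0 : ℝ) 0.1) :
    |omegaB ε - Real.pi / 2| ≤ 0.226 * ε ^ 2 := by
  have h1 := abs_lt.1 (isHopfZero_branch h).omega_near
  rw [approxOmega] at h1
  rw [abs_le]
  constructor <;> linarith [sq_nonneg ε]

theorem norm_coefB_le {ε : ℝ} (h : ε ∈ Ioc (0 : ℝ) 0.1) : ‖coefB ε‖ ≤ 0.5 * ε := by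
  rw [coefB, norm_smul, Real.norm_of_nonneg h.1.le, mul_comm]
  have := (zeroBounds_branch h).norm_K_le
  have := h.1
  gcongr
  linarith

theorem Ioc_zero_tenth_mem : Ioc (0 : ℝ) 0.1 ∈ 𝓝[>] (0 : ℝ) :=
  Ioc_mem_nhdsGT_of_mem ⟨le_rfl, by norm_num⟩

theorem tendsto_of_sub_le_sq {f : ℝ → ℝ} {l C : ℝ}
    (h : ∀ ε ∈ Ioc (0 : ℝ) 0.1, |f ε - l| ≤ C * ε ^ 2) : Tendsto f (𝓝[>] 0) (𝓝 l) := by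
  rw [tendsto_iff_norm_sub_tendsto_zero]
  have hc : Tendsto (fun ε : ℝ => C * ε ^ 2) (𝓝[>] 0) (𝓝 0) := by
    have : Continuous fun ε : ℝ => C * ε ^ 2 := by fun_prop
    simpa using (this.tendsto 0).mono_left nhdsWithin_le_nhds
  exact squeeze_zero' (Eventually.of_forall fun _ => norm_nonneg _)
    (by filter_upwards [Ioc_zero_tenth_mem] with ε hε using h ε hε) hc

theorem tendsto_alphaB : Tendsto alphaB (𝓝[>] 0) (𝓝 (Real.pi / 2)) := by
  refine tendsto_of_sub_le_sq (C := 0.81) fun ε h => ?_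
  obtain ⟨h1, h2⟩ := alphaB_bounds h
  have := sq_nonneg ε
  rw [abs_le]; constructor <;> linarith

theorem tendsto_omegaB : Tendsto omegaB (𝓝[>] 0) (𝓝 (Real.pi / 2)) :=
  tendsto_of_sub_le_sq fun _ h => abs_omegaB_sub_le h

theorem tendsto_coefB : Tendsto coefB (𝓝[>] 0) (𝓝 0) := by
  have hc : Tendsto (fun ε : ℝ => 0.5 * ε) (𝓝[>] 0) (𝓝 0) := by
    have : Continuous fun ε : ℝ => 0.5 * ε := by fun_prop
    simpa using (this.tendsto 0).mono_left nhdsWithin_le_nhds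
  exact squeeze_zero_norm'
    (by filter_upwards [Ioc_zero_tenth_mem] with ε hε using norm_coefB_le hε) hc

/-- The right end of the parameter range comes from `0.01 · ((3π/2 - 1)/5 - 0.0594)`, which exceeds
`6.830e-3` by very little. -/
theorem lt_alphaB_tenth : Real.pi / 2 + 6.830e-3 < alphaB 0.1 := by
  have h1 := abs_lt.1 (isHopfZero_branch (ε := 0.1) ⟨by norm_num, le_rfl⟩).alpha_near
  rw [approxAlpha] at h1
  linarith [pi_bounds.1]

theorem existsUnique_alphaB {α : ℝ} (h : α ∈ Ioc (Real.pi / 2) (Real.pi / 2 + 6.830e-3)) :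
    ∃! ε : ℝ, ε ∈ Ioc (0 : ℝ) 0.1 ∧ alphaB ε = α := by
  refine existsUnique_of_exists_of_unique ?_ fun a b ha hb =>
    strictMonoOn_alphaB.injOn ha.1 hb.1 (ha.2.trans hb.2.symm)
  obtain ⟨e, he, hlt⟩ : ∃ e ∈ Ioc (0 : ℝ) 0.1, alphaB e < α := by
    have := (tendsto_alphaB.eventually_lt_const h.1).and Ioc_zero_tenth_mem
    obtain ⟨e, h1, h2⟩ := this.exists
    exact ⟨e, h2, h1⟩
  have hsub : Icc e 0.1 ⊆ Ioc (0 : ℝ) 0.1 := fun x hx => ⟨he.1.trans_le hx.1, hx.2⟩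
  have hc : ContinuousOn alphaB (Icc e 0.1) := fun x hx =>
    (contDiffAt_alphaB (abs_le_of_mem_Ioc (hsub hx))).continuousAt.continuousWithinAt
  obtain ⟨x, hx, rfl⟩ := intermediate_value_Icc he.2 hc ⟨hlt.le, h.2.trans lt_alphaB_tenth.le⟩
  exact ⟨x, hsub hx, rfl⟩

/-- Keeps the amplitude off the end point, so that a two-sided neighbourhood of it lies in the range
of the branch. -/
theorem lt_tenth_of_alphaB_le {ε : ℝ} (h : ε ∈ Ioc (0 : ℝ) 0.1)
    (hα : alphaB ε ≤ Real.pi / 2 + 6.830e-3) : ε < 0.1 := by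
  refine lt_of_le_of_ne h.2 fun e => ?_
  subst e
  exact absurd lt_alphaB_tenth (not_lt.2 hα)

/-! ### Fourier series and Wright's equation -/

/-- The real `2π`-periodic function with Fourier coefficients `symExt a`. -/
def fSeries (a : ℕ → ℂ) (s : ℝ) : ℝ :=
  2 * ∑' k : ℕ, (a (k + 1) * Complex.exp (Complex.I * ((k : ℂ) + 1) * (s : ℂ))).re

theorem fourierFun_eq_fSeries (ω : ℝ) (a : ℕ → ℂ) (t : ℝ) :
    fourierFun ω a t = fSeries a (ω * t) := by
  unfold fourierFun fSeries
  congr 2; funext k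
  have : Complex.I * (ω : ℂ) * ((k : ℂ) + 1) * (t : ℂ) =
      Complex.I * ((k : ℂ) + 1) * ((ω * t : ℝ) : ℂ) := by push_cast; ring
  rw [this]

theorem HasSum.congr_apply {ι M : Type*} [AddCommMonoid M] [TopologicalSpace M] {f g : ι → M}
    {x : M} (h : HasSum f x) (e : ∀ k, f k = g k) : HasSum g x := by
  rwa [← funext e]

theorem norm_exp_I_mul_int (k : ℤ) (s : ℝ) : ‖Complex.exp (Complex.I * k * s)‖ = 1 := by
  rw [Complex.norm_exp]; simp

theorem norm_exp_I_mul_nat_succ (k : ℕ) (s : ℝ) :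
    ‖Complex.exp (Complex.I * ((k : ℂ) + 1) * s)‖ = 1 := by
  simpa using norm_exp_I_mul_int ((k : ℤ) + 1) s

theorem summable_succ (a : L1) : Summable fun k => ‖a (k + 1)‖ :=
  (summable_nat_add_iff 1).2 (l1_summable a)

theorem summable_fSeries (a : L1) (s : ℝ) :
    Summable fun k : ℕ => a (k + 1) * Complex.exp (Complex.I * ((k : ℂ) + 1) * s) :=
  Summable.of_norm (by
    simpa only [norm_mul, norm_exp_I_mul_nat_succ, mul_one] using summable_succ a)

theorem hasSum_fSeries (a : L1) (s : ℝ) :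
    HasSum (fun k : ℤ => symExt a k * Complex.exp (Complex.I * k * s)) (fSeries a s : ℂ) := by
  have h := (summable_fSeries a s).hasSum
  set X := ∑' k : ℕ, a (k + 1) * Complex.exp (Complex.I * ((k : ℂ) + 1) * s)
  have e : (fSeries a s : ℂ) = X + (starRingEnd ℂ) X := by
    rw [Complex.add_conj, fSeries, (Complex.hasSum_re h).tsum_eq]
  rw [e]
  refine hasSum_int_of_nat (by simp) ?_ ?_
  · simpa [symExt_natCast_succ] using h
  · have h2 : HasSum (fun k : ℕ => (starRingEnd ℂ) (a (k + 1)
        * Complex.exp (Complex.I * ((k : ℂ) + 1) * s))) ((starRingEnd ℂ) X) := h.star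
    refine h2.congr_apply fun k => ?_
    rw [symExt_neg_natCast_succ, map_mul, ← Complex.exp_conj]
    congr 2
    simp
    ring

theorem fSeries_add_two_pi (a : ℕ → ℂ) (s : ℝ) : fSeries a (s + 2 * Real.pi) = fSeries a s := by
  unfold fSeries
  congr 2; funext k; congr 2
  have : Complex.I * ((k : ℂ) + 1) * ((s + 2 * Real.pi : ℝ) : ℂ) =
      Complex.I * ((k : ℂ) + 1) * s + ((k + 1 : ℕ) : ℂ) * (2 * Real.pi * Complex.I) := by
    push_cast; ring
  rw [this]
  exact Complex.exp_periodic.nat_mul (k + 1) _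

theorem abs_fSeries_le (a : L1) (s : ℝ) : |fSeries a s| ≤ 2 * ‖a‖ := by
  rw [fSeries, abs_mul, abs_two]
  refine mul_le_mul_of_nonneg_left ?_ zero_le_two
  have h1 := Complex.hasSum_re (summable_fSeries a s).hasSum
  rw [h1.tsum_eq]
  refine (Complex.abs_re_le_norm _).trans ((norm_tsum_le_tsum_norm ?_).trans ?_)
  · simpa only [norm_mul, norm_exp_I_mul_nat_succ, mul_one] using summable_succ a
  · simp only [norm_mul, norm_exp_I_mul_nat_succ, mul_one]
    rw [l1_norm_eq, (l1_summable a).tsum_eq_zero_add]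
    linarith [norm_nonneg (a 0)]

theorem hasDerivAt_fSeries {a b : L1} (hb : ∀ k, b k = Complex.I * k * a k) (s : ℝ) :
    HasDerivAt (fSeries a) (fSeries b s) s := by
  have key := hasDerivAt_tsum (𝕜 := ℝ) (u := fun k => ‖b (k + 1)‖) (y₀ := 0)
    (g := fun k s => (a (k + 1) * Complex.exp (Complex.I * ((k : ℂ) + 1) * (s : ℂ))).re)
    (g' := fun k s => (b (k + 1) * Complex.exp (Complex.I * ((k : ℂ) + 1) * (s : ℂ))).re)
    (summable_succ b) ?_ ?_
    (Complex.hasSum_re (summable_fSeries a 0).hasSum).summable s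
  · exact key.const_mul 2
  · intro k x
    have h : HasDerivAt (fun w : ℝ => Complex.I * ((k : ℂ) + 1) * (w : ℂ))
        (Complex.I * ((k : ℂ) + 1) * 1) x := (Complex.ofRealCLM.hasDerivAt (x := x)).const_mul _
    have h2 := Complex.reCLM.hasFDerivAt.comp_hasDerivAt x (h.cexp.const_mul (a (k + 1)))
    have e : b (k + 1) * Complex.exp (Complex.I * ((k : ℂ) + 1) * (x : ℂ)) =
        a (k + 1) * (Complex.exp (Complex.I * ((k : ℂ) + 1) * x)
          * (Complex.I * ((k : ℂ) + 1) * 1)) := by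
      rw [hb]; push_cast; ring
    rw [e]
    exact h2
  · intro k x
    refine (Complex.abs_re_le_norm _).trans (le_of_eq ?_)
    rw [norm_mul, norm_exp_I_mul_nat_succ, mul_one]

theorem exp_shift (k : ℤ) (s ω : ℝ) : Complex.exp (Complex.I * k * ((s - ω : ℝ) : ℂ)) =
    Complex.exp (-Complex.I * k * ω) * Complex.exp (Complex.I * k * s) := by
  rw [← Complex.exp_add]; congr 1; push_cast; ring

theorem symExt_opU (ω : ℝ) (a : ℕ → ℂ) (k : ℤ) :
    symExt (opU ω a) k = Complex.exp (-Complex.I * k * ω) * symExt a k := by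
  rcases lt_trichotomy k 0 with h | h | h
  · have h1 : ¬ 0 < k := by omega
    have h2 : ((k.natAbs : ℕ) : ℂ) = -(k : ℂ) := by
      have : ((k.natAbs : ℕ) : ℤ) = -k := by omega
      rw [← Int.cast_natCast, this, Int.cast_neg]
    simp only [symExt, h, h1, if_true, if_false, opU, map_mul, ← Complex.exp_conj, h2]
    congr 2; simp
  · simp [h]
  · have h2 : ((k.natAbs : ℕ) : ℂ) = (k : ℂ) := by
      have : ((k.natAbs : ℕ) : ℤ) = k := by omega
      rw [← Int.cast_natCast, this]
    simp only [symExt, h, if_true, opU, h2]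

theorem symExt_deriv (a b : ℕ → ℂ) (hb : ∀ k, b k = Complex.I * k * a k) (k : ℤ) :
    symExt b k = Complex.I * k * symExt a k := by
  rcases lt_trichotomy k 0 with h | h | h
  · have h1 : ¬ 0 < k := by omega
    have h2 : ((k.natAbs : ℕ) : ℂ) = -(k : ℂ) := by
      have : ((k.natAbs : ℕ) : ℤ) = -k := by omega
      rw [← Int.cast_natCast, this, Int.cast_neg]
    simp only [symExt, h, h1, if_true, if_false, hb, map_mul, h2]
    simp
  · simp [h]
  · have h2 : ((k.natAbs : ℕ) : ℂ) = (k : ℂ) := by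
      have : ((k.natAbs : ℕ) : ℤ) = k := by omega
      rw [← Int.cast_natCast, this]
    simp only [symExt, h, if_true, hb, h2]

theorem norm_opU (ω : ℝ) (a : ℕ → ℂ) (k : ℕ) : ‖opU ω a k‖ = ‖a k‖ := by
  rw [opU, norm_mul]
  have := norm_ephase ω k
  rw [ephase] at this
  rw [this, one_mul]

/-- The operator `U_ω` on `ℓ¹`. -/
def opUL (ω : ℝ) (a : L1) : L1 := l1Mk (opU ω a) (by simpa only [norm_opU] using l1_summable a)

theorem opUL_coe (ω : ℝ) (a : L1) : (opUL ω a : ℕ → ℂ) = opU ω a := rfl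

theorem fSeries_sub (a : L1) (s ω : ℝ) : fSeries a (s - ω) = fSeries (opU ω a) s := by
  have h1 := hasSum_fSeries a (s - ω)
  have h2 := hasSum_fSeries (opUL ω a) s
  rw [opUL_coe] at h2
  have e : ∀ k : ℤ, symExt a k * Complex.exp (Complex.I * k * ((s - ω : ℝ) : ℂ)) =
      symExt (opU ω a) k * Complex.exp (Complex.I * k * s) := fun k => by
    rw [exp_shift, symExt_opU]; ring
  simp only [e] at h1
  exact_mod_cast h1.unique h2

/-- The convolution over `ℤ`. -/
def convZ (a b : ℕ → ℂ) (k : ℤ) : ℂ := ∑' j : ℤ, symExt a j * symExt b (k - j)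

theorem convZ_natCast (a b : ℕ → ℂ) (k : ℕ) : convZ a b k = seqConv a b k := rfl

theorem convZ_neg (a b : ℕ → ℂ) (k : ℤ) : convZ a b (-k) = (starRingEnd ℂ) (convZ a b k) := by
  rw [convZ, convZ, Complex.conj_tsum, ← (Equiv.neg ℤ).tsum_eq]
  refine tsum_congr fun j => ?_
  have e : -k - (Equiv.neg ℤ) j = -(k - j) := by simp; ring
  rw [e, map_mul, Equiv.neg_apply, symExt_neg, symExt_neg]

theorem hasSum_fSeries_mul (a b : L1) (s : ℝ) :
    HasSum (fun k : ℤ => convZ a b k * Complex.exp (Complex.I * k * s))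
      ((fSeries a s * fSeries b s : ℝ) : ℂ) := by
  have n : ∀ c : L1, Summable fun k : ℤ => ‖symExt c k * Complex.exp (Complex.I * k * s)‖ :=
    fun c => by simpa only [norm_mul, norm_exp_I_mul_int, mul_one] using summable_norm_symExt c
  have h := hasSum_conv (n a) (n b)
  rw [(hasSum_fSeries a s).tsum_eq, (hasSum_fSeries b s).tsum_eq] at h
  rw [Complex.ofReal_mul]
  refine h.congr_apply fun k => ?_
  rw [convZ, ← tsum_mul_right]
  refine tsum_congr fun j => ?_
  have : Complex.exp (Complex.I * k * s) = Complex.exp (Complex.I * j * s)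
      * Complex.exp (Complex.I * ((k - j : ℤ) : ℂ) * s) := by
    rw [← Complex.exp_add]; congr 1; push_cast; ring
  rw [this]; ring

/-- The Fourier coefficients of `ω u' + α u(· - ω) (1 + u)`. -/
def modeZ (α ω : ℝ) (a : ℕ → ℂ) (k : ℤ) : ℂ :=
  ω * (Complex.I * k * symExt a k) + α * symExt (opU ω a) k + α * convZ (opU ω a) a k

theorem modeZ_neg (α ω : ℝ) (a : ℕ → ℂ) (k : ℤ) :
    modeZ α ω a (-k) = (starRingEnd ℂ) (modeZ α ω a k) := by
  simp only [modeZ, symExt_neg, convZ_neg, map_add, map_mul, Complex.conj_ofReal, Complex.conj_I]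
  push_cast
  simp

theorem modeZ_natCast_succ (α ω : ℝ) (a : ℕ → ℂ) (k : ℕ) : modeZ α ω a ((k : ℤ) + 1) =
    ω * (Complex.I * (k + 1 : ℕ) * a (k + 1)) + α * opU ω a (k + 1)
      + α * seqConv (opU ω a) a (k + 1) := by
  have h := convZ_natCast (opU ω a) a (k + 1)
  push_cast at h
  rw [modeZ, symExt_natCast_succ, symExt_natCast_succ, h]
  push_cast; rfl

theorem hasSum_modeZ (α ω : ℝ) {a b : L1} (hb : ∀ k, b k = Complex.I * k * a k) (s : ℝ) :
    HasSum (fun k : ℤ => modeZ α ω a k * Complex.exp (Complex.I * k * s))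
      ((ω * fSeries b s + α * fSeries a (s - ω) * (1 + fSeries a s) : ℝ) : ℂ) := by
  have h1 := (hasSum_fSeries b s).mul_left (ω : ℂ)
  have h2 := (hasSum_fSeries (opUL ω a) s).mul_left (α : ℂ)
  have h3 := (hasSum_fSeries_mul (opUL ω a) a s).mul_left (α : ℂ)
  have h := (h1.add h2).add h3
  rw [opUL_coe, ← fSeries_sub] at h
  have e : ((ω * fSeries b s + α * fSeries a (s - ω) * (1 + fSeries a s) : ℝ) : ℂ) =
      ω * (fSeries b s : ℂ) + α * (fSeries a (s - ω) : ℂ)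
        + α * ((fSeries a (s - ω) * fSeries a s : ℝ) : ℂ) := by push_cast; ring
  rw [e]
  refine h.congr_apply fun k => ?_
  rw [modeZ, symExt_deriv a b hb]; ring

theorem summable_norm_modeZ (α ω : ℝ) {a b : L1} (hb : ∀ k, b k = Complex.I * k * a k) :
    Summable fun k : ℤ => ‖modeZ α ω a k‖ := by
  have h1 := (summable_norm_symExt b).mul_left ‖(ω : ℂ)‖
  have h2 := (summable_norm_symExt (opUL ω a)).mul_left ‖(α : ℂ)‖
  have h3 := (summable_norm_conv (summable_norm_symExt (opUL ω a))
    (summable_norm_symExt a)).mul_left ‖(α : ℂ)‖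
  refine Summable.of_nonneg_of_le (fun _ => norm_nonneg _) (fun k => ?_) ((h1.add h2).add h3)
  rw [modeZ, ← symExt_deriv a b hb]
  refine norm_add_le_of_le (norm_add_le_of_le ?_ ?_) ?_ <;> rw [norm_mul]
  · rfl
  · rfl

/-- The coefficient sequence with `a_k` replaced by `a_k / (i k)`. -/
def primL (a : L1) : L1 := l1Mk (fun k => a k / (Complex.I * k)) (by
  refine Summable.of_nonneg_of_le (fun _ => norm_nonneg _) (fun k => ?_) (l1_summable a)
  rw [norm_div, norm_mul, Complex.norm_I, one_mul, Complex.norm_natCast]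
  obtain rfl | hk := Nat.eq_zero_or_pos k
  · simp
  · exact div_le_self (norm_nonneg _) (by exact_mod_cast hk))

theorem hasDerivAt_fSeries_primL {a : L1} (h0 : a 0 = 0) (s : ℝ) :
    HasDerivAt (fSeries (primL a)) (fSeries a s) s := by
  refine hasDerivAt_fSeries (fun k => ?_) s
  obtain rfl | hk := Nat.eq_zero_or_pos k
  · simp [h0]
  · have : (k : ℂ) ≠ 0 := by exact_mod_cast hk.ne'
    simp only [primL, l1Mk_apply]
    field_simp

/-- If all modes of positive index vanish then so does the mean value. -/
theorem fSeries_solves {α ω : ℝ} {a b : L1} (hb : ∀ k, b k = Complex.I * k * a k) (h0 : a 0 = 0)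
    (hsmall : ‖a‖ < 1 / 2) (h : ∀ k : ℕ, modeZ α ω a ((k : ℤ) + 1) = 0) (s : ℝ) :
    ω * fSeries b s + α * fSeries a (s - ω) * (1 + fSeries a s) = 0 := by
  have hz : ∀ k : ℤ, k ≠ 0 → modeZ α ω a k = 0 := by
    intro k hk
    rcases lt_or_gt_of_ne hk with hk | hk
    · obtain ⟨n, rfl⟩ : ∃ n : ℕ, k = -((n : ℤ) + 1) := ⟨(-k - 1).toNat, by omega⟩
      rw [modeZ_neg, h, map_zero]
    · obtain ⟨n, rfl⟩ : ∃ n : ℕ, k = (n : ℤ) + 1 := ⟨(k - 1).toNat, by omega⟩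
      exact h n
  -- Negative modes vanish by conjugation symmetry, so the residual of the equation is the constant
  -- given by the mode 0.
  have hconst : ∀ x : ℝ, ω * fSeries b x + α * fSeries a (x - ω) * (1 + fSeries a x) =
      (modeZ α ω a 0).re := fun x => by
    have h1 := hasSum_modeZ α ω hb x
    have h2 : HasSum (fun k : ℤ => modeZ α ω a k * Complex.exp (Complex.I * k * x))
        (modeZ α ω a 0) := by
      have := hasSum_single (f := fun k : ℤ => modeZ α ω a k * Complex.exp (Complex.I * k * x)) 0
        (fun k hk => by simp [hz k hk])
      simpa using this
    rw [← h1.unique h2, Complex.ofReal_re]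
  have hpos : ∀ x, 0 < 1 + fSeries a x := fun x => by
    have := (abs_le.1 (abs_fSeries_le a x)).1
    linarith
  have hprim : ∀ x, HasDerivAt (fun x => fSeries (primL a) (x - ω)) (fSeries a (x - ω)) x :=
    fun x => (hasDerivAt_fSeries_primL h0 (x - ω)).comp_sub_const x ω
  -- The residual divided by `1 + u` is the derivative of the periodic function `ω log (1 + u) + α
  -- P(· - ω)`, where `P` is a primitive of `u`; this primitive is periodic since `u` has no mean.
  -- By Rolle's theorem that derivative vanishes somewhere, so the constant is 0. Smallness of `a`
  -- only serves to make `1 + u` positive.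
  have hP : ∀ x, HasDerivAt (fun x => ω * Real.log (1 + fSeries a x)
      + α * fSeries (primL a) (x - ω)) ((modeZ α ω a 0).re / (1 + fSeries a x)) x := fun x => by
    have h1 := ((((hasDerivAt_fSeries hb x).const_add 1).log (hpos x).ne').const_mul ω).add
      ((hprim x).const_mul α)
    have e : (modeZ α ω a 0).re / (1 + fSeries a x) =
        ω * (fSeries b x / (1 + fSeries a x)) + α * fSeries a (x - ω) := by
      have := (hpos x).ne'
      rw [← hconst x]
      field_simp
    rw [e]
    exact h1
  obtain ⟨x, -, hx⟩ := exists_hasDerivAt_eq_zero (a := 0) (b := 2 * Real.pi)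
    (by have := Real.pi_pos; positivity)
    (continuous_iff_continuousAt.2 fun x => (hP x).continuousAt).continuousOn (by
      have e1 := fSeries_add_two_pi a 0
      have e2 := fSeries_add_two_pi (primL a) (0 - ω)
      rw [zero_add] at e1
      rw [show 0 - ω + 2 * Real.pi = 2 * Real.pi - ω by ring] at e2
      rw [e1, e2]) fun x _ => hP x
  rw [hconst s]
  exact (div_eq_zero_iff.1 hx).resolve_right (hpos x).ne'

/-- The basis vector `e_1` of `ℓ¹`. -/
def unitOne : L1 := lp.single 1 1 1

theorem unitOne_apply (k : ℕ) : unitOne k = basisSeq 1 k := by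
  simp [unitOne, lp.single_apply, basisSeq, Pi.single_apply]

theorem norm_unitOne : ‖unitOne‖ = 1 := by
  simp [unitOne, lp.norm_single]

theorem seqConv_comm (a b : ℕ → ℂ) (k : ℕ) : seqConv a b k = seqConv b a k := by
  rw [seqConv, seqConv, ← (Equiv.subLeft (k : ℤ)).tsum_eq]
  refine tsum_congr fun j => ?_
  simp [Equiv.subLeft_apply, mul_comm]

/-- Convolution with the first harmonic meets only `j = ±1` and is a combination of the two shifts.
This is the origin of the operator `L_ω`. -/
theorem seqConv_unitOne (x : ℂ) (b : L1) {k : ℕ} (hk : 1 ≤ k) :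
    seqConv (x • unitOne : L1) b k = x * shiftUp b k + (starRingEnd ℂ) x * b (k + 1) := by
  have hz : ∀ j : ℤ, j ∉ ({1, -1} : Finset ℤ) →
      symExt (x • unitOne : L1) j * symExt b ((k : ℤ) - j) = 0 := by
    intro j hj
    have hj' : j.natAbs ≠ 1 := by simp at hj; omega
    simp [symExt, unitOne_apply, basisSeq, hj']
  rw [seqConv, tsum_eq_sum hz, Finset.sum_pair (by norm_num)]
  have e1 : symExt (x • unitOne : L1) 1 = x := by simp [symExt, unitOne_apply, basisSeq]
  have e2 : symExt (x • unitOne : L1) (-1) = (starRingEnd ℂ) x := by rw [symExt_neg, e1]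
  have e3 : symExt b ((k : ℤ) - 1) = shiftUp b k := by
    rw [symExt, shiftUp]
    by_cases h2 : 2 ≤ k
    · have : ((k : ℤ) - 1).natAbs = k - 1 := by omega
      rw [if_pos (by omega), if_pos h2, this]
    · rw [if_neg (by omega), if_neg (by omega), if_neg h2]
  have e4 : symExt b ((k : ℤ) - -1) = b (k + 1) := by
    rw [sub_neg_eq_add, symExt_natCast_succ]
  rw [e1, e2, e3, e4]

theorem conj_ephase_one (ω : ℝ) : (starRingEnd ℂ) (ephase ω 1) = ephase (-ω) 1 := by
  rw [ephase, ← Complex.exp_conj, ephase]; congr 1; simp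

theorem opUL_smul_unitOne_add (ε ω : ℝ) (c : L1) :
    opUL ω (ε • (unitOne + c)) = ε • (ephase ω 1 • unitOne + opUL ω c) := by
  refine l1_ext fun k => ?_
  simp only [opUL, l1Mk_apply, opU, l1_real_smul_apply, l1_add_apply, l1_smul_apply,
    unitOne_apply, basisSeq, ephase]
  by_cases h : k = 1
  · subst h; simp; ring
  · simp [h]; ring

/-- The modes of the equation for the rescaled coefficients are the entries of `F`. -/
theorem modeZ_eq_mapF (ε α ω : ℝ) (c : L1) (n : ℕ) :
    modeZ α ω (ε • (unitOne + c) : L1) ((n : ℤ) + 1) = ε * mapF ε α ω c (n + 1) := by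
  rw [modeZ_natCast_succ, ← opUL_coe, ← convL_apply, opUL_smul_unitOne_add]
  have hk : 1 ≤ n + 1 := by omega
  -- Expansion of `U_ω (e_1 + c) * (e_1 + c)`: the product of first harmonics gives the `e_2`-term
  -- of `F`, the two mixed products give `L_ω c`, and the last one is `U_ω c * c`.
  have h1 : convL (ε • (ephase ω 1 • unitOne + opUL ω c)) (ε • (unitOne + c)) (n + 1) =
      ε * (ε * (seqConv (ephase ω 1 • unitOne : L1) unitOne (n + 1)
        + seqConv (ephase ω 1 • unitOne : L1) c (n + 1)
        + seqConv (opUL ω c) ((1 : ℂ) • unitOne : L1) (n + 1)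
        + seqConv (opUL ω c) c (n + 1))) := by
    rw [one_smul]
    simp only [map_smul, map_add, smul_apply, add_apply,
      l1_real_smul_apply, l1_add_apply, convL_apply]
    ring
  rw [h1, seqConv_comm (opUL ω c) ((1 : ℂ) • unitOne : L1), seqConv_unitOne _ _ hk,
    seqConv_unitOne _ _ hk, seqConv_unitOne _ _ hk, conj_ephase_one]
  have h2 : shiftUp unitOne (n + 1) = basisSeq 2 (n + 1) := by
    simp only [shiftUp, unitOne_apply, basisSeq]
    split_ifs <;> first | rfl | omega
  have h3 : unitOne (n + 1 + 1) = 0 := by simp [unitOne_apply, basisSeq]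
  have h4 : opU ω (ε • (unitOne + c) : L1) = fun k => (opUL ω (ε • (unitOne + c)) : L1) k := rfl
  have h5 : opL ω c (n + 1) = ephase ω 1 * shiftUp c (n + 1) + shiftUp (opUL ω c) (n + 1)
      + (ephase (-ω) 1 * c (n + 1 + 1) + opUL ω c (n + 1 + 1)) := by
    simp only [opL, shiftUp, shiftDown, exp_neg_I_mul, exp_I_mul, opUL_coe]
    split_ifs <;> ring
  simp only [mapF, h2, h3, h5, invK, exp_neg_I_mul, l1_real_smul_apply, l1_add_apply,
    l1_smul_apply, unitOne_apply, map_one, opUL_coe]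
  by_cases hn : n = 0
  · subst hn; simp [basisSeq]; ring
  · have : basisSeq 1 (n + 1) = 0 := by simp [basisSeq, hn]
    rw [this]; ring

theorem fSeries_smul_unitOne_add (ε : ℝ) (c : L1) (s : ℝ) :
    fSeries (ε • (unitOne + c) : L1) s = ε * (2 * Real.cos s + fSeries c s) := by
  have h0 : fSeries unitOne s = 2 * Real.cos s := by
    rw [fSeries, tsum_eq_single 0]
    · have : Complex.I * (((0 : ℕ) : ℂ) + 1) * (s : ℂ) = s * Complex.I := by push_cast; ring
      rw [this]
      simp [unitOne_apply, basisSeq, Complex.exp_ofReal_mul_I_re]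
    · intro k hk
      simp [unitOne_apply, basisSeq, hk]
  have h1 := ((hasSum_fSeries unitOne s).add (hasSum_fSeries c s)).mul_left (ε : ℂ)
  have h2 := hasSum_fSeries (ε • (unitOne + c)) s
  have e : ∀ k : ℤ, symExt (ε • (unitOne + c) : L1) k = ε * (symExt unitOne k + symExt c k) := by
    intro k
    rw [← symExt_add, ← symExt_smul]; rfl
  have h3 := h2.unique (h1.congr_apply fun k => by rw [e]; ring)
  rw [h0] at h3
  exact_mod_cast h3

theorem hopfFun_eq (ε ω : ℝ) (c : L1) (t : ℝ) :
    hopfFun ε ω c t = fSeries (ε • (unitOne + c) : L1) (ω * t) := by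
  rw [hopfFun, fourierFun_eq_fSeries]
  congr 1; funext k
  simp [unitOne_apply, mul_add]

/-! ### Sign pattern and slow oscillation -/

/-- On `[-0.3, 0.3]` the cosine exceeds 0.2, so `f` is strictly increasing there. As `sin 0.3 > 0.29
> 0.1`, it changes sign. -/
theorem exists_zero_near_sin {f f' : ℝ → ℝ} (hf : ∀ x, HasDerivAt f (f' x) x)
    (h1 : ∀ x, |f x - Real.sin x| ≤ 0.1) (h2 : ∀ x, |f' x - Real.cos x| ≤ 0.2) :
    ∃ z ∈ Ioo (-0.3 : ℝ) 0.3, (∀ x ∈ Ico (-0.3) z, f x < 0) ∧ ∀ x ∈ Ioc z 0.3, 0 < f x := by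
  have hmono : StrictMonoOn f (Icc (-0.3) 0.3) := by
    refine strictMonoOn_of_deriv_pos (convex_Icc _ _)
      (fun x _ => (hf x).continuousAt.continuousWithinAt) fun x hx => ?_
    rw [interior_Icc] at hx
    rw [(hf x).deriv]
    have := (abs_le.1 (h2 x)).1
    have := Real.one_sub_sq_div_two_le_cos (x := x)
    nlinarith [hx.1, hx.2]
  have hs : (0.29 : ℝ) < Real.sin 0.3 := by
    have := Real.sin_gt_sub_cube (x := 0.3) (by norm_num)
    norm_num at this ⊢
    linarith
  have ha : f (-0.3) < 0 := by
    have := (abs_le.1 (h1 (-0.3))).2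
    rw [Real.sin_neg] at this
    linarith
  have hb : 0 < f 0.3 := by linarith [(abs_le.1 (h1 0.3)).1]
  obtain ⟨z, hz, hfz⟩ := intermediate_value_Icc (by norm_num : (-0.3 : ℝ) ≤ 0.3)
    (fun x _ => (hf x).continuousAt.continuousWithinAt) ⟨ha.le, hb.le⟩
  have hz1 : z ≠ -0.3 := fun e => by rw [e] at hfz; linarith
  have hz2 : z ≠ 0.3 := fun e => by rw [e] at hfz; linarith
  refine ⟨z, ⟨lt_of_le_of_ne hz.1 hz1.symm, lt_of_le_of_ne hz.2 hz2⟩, fun x hx => ?_,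
    fun x hx => ?_⟩
  · rw [← hfz]; exact hmono ⟨hx.1, hx.2.le.trans hz.2⟩ hz hx.2
  · rw [← hfz]; exact hmono hz ⟨hz.1.trans hx.1.le, hx.2⟩ hx.1

/-- The sign pattern of a periodic function close to the cosine. -/
theorem exists_signs_of_near_cos {g g' : ℝ → ℝ} (hg : ∀ x, HasDerivAt g (g' x) x)
    (hper : ∀ x, g (x + 2 * Real.pi) = g x) (h1 : ∀ x, |g x - Real.cos x| ≤ 0.1)
    (h2 : ∀ x, |g' x + Real.sin x| ≤ 0.2) :
    ∃ a b : ℝ, Real.pi - 0.6 < b - a ∧ b - a < Real.pi + 0.6 ∧ (∀ x ∈ Ioo a b, 0 < g x) ∧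
      ∀ x ∈ Ioo (b - 2 * Real.pi) a, g x < 0 := by
  -- The zeros near `-π/2` and `π/2` come from `exists_zero_near_sin`, applied to `g (· - π/2)` and
  -- to `-g (· + π/2)`.
  obtain ⟨z, hz, zn, zp⟩ := exists_zero_near_sin (f := fun x => g (x - Real.pi / 2))
    (f' := fun x => g' (x - Real.pi / 2)) (fun x => (hg _).comp_sub_const x _)
    (fun x => by simpa [Real.cos_sub_pi_div_two] using h1 (x - Real.pi / 2))
    (fun x => by simpa [Real.sin_sub_pi_div_two, ← sub_eq_add_neg] using h2 (x - Real.pi / 2))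
  obtain ⟨w, hw, wn, wp⟩ := exists_zero_near_sin (f := fun x => -g (x + Real.pi / 2))
    (f' := fun x => -g' (x + Real.pi / 2)) (fun x => ((hg _).comp_add_const x _).neg)
    (fun x => by
      have := h1 (x + Real.pi / 2)
      rw [Real.cos_add_pi_div_two, ← abs_neg] at this
      convert this using 2; ring)
    (fun x => by
      have := h2 (x + Real.pi / 2)
      rw [Real.sin_add_pi_div_two, ← abs_neg] at this
      convert this using 2; ring)
  have hs : (0.29 : ℝ) < Real.sin 0.3 := by
    have := Real.sin_gt_sub_cube (x := 0.3) (by norm_num)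
    norm_num at this ⊢
    linarith
  obtain ⟨p1, p2⟩ := pi_bounds
  -- Outside the windows of half-width 0.3 around the zeros of the cosine, its modulus exceeds 0.29
  -- and dominates the error 0.1.
  have hc : ∀ x, |x| ≤ Real.pi / 2 - 0.3 → 0.29 < Real.cos x := fun x hx => by
    rw [← Real.cos_abs]
    refine hs.trans_le ?_
    rw [← Real.cos_pi_div_two_sub]
    exact Real.cos_le_cos_of_nonneg_of_le_pi (abs_nonneg x) (by linarith) hx
  obtain ⟨z1, z2⟩ := hz
  obtain ⟨w1, w2⟩ := hw
  refine ⟨z - Real.pi / 2, w + Real.pi / 2, by linarith, by linarith, fun x hx => ?_,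
    fun x hx => ?_⟩
  · obtain ⟨x1, x2⟩ := hx
    by_cases c1 : x ≤ -(Real.pi / 2 - 0.3)
    · have := zp (x + Real.pi / 2) ⟨by linarith, by linarith⟩
      simpa using this
    by_cases c2 : Real.pi / 2 - 0.3 ≤ x
    · have := wn (x - Real.pi / 2) ⟨by linarith, by linarith⟩
      simpa using this
    · have h3 := hc x (abs_le.2 ⟨by linarith, by linarith⟩)
      linarith [(abs_le.1 (h1 x)).1]
  · obtain ⟨x1, x2⟩ := hx
    by_cases c1 : -(Real.pi / 2) - 0.3 ≤ x
    · have := zn (x + Real.pi / 2) ⟨by linarith, by linarith⟩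
      simpa using this
    by_cases c2 : x + 2 * Real.pi ≤ Real.pi / 2 + 0.3
    · have := wp (x + 2 * Real.pi - Real.pi / 2) ⟨by linarith, by linarith⟩
      simp only [sub_add_cancel, hper] at this
      linarith
    · have h3 := hc (x + Real.pi) (abs_le.2 ⟨by linarith, by linarith⟩)
      rw [Real.cos_add_pi] at h3
      linarith [(abs_le.1 (h1 x)).2]

/-- The sequence `i k a_k` in `ℓ¹`. -/
def derivL (a : ℕ → ℂ) (h : Summable fun k : ℕ => ‖invK a k‖) : L1 :=
  l1Mk (fun k => Complex.I * k * a k) (by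
    refine h.congr fun k => ?_
    rw [invK, mul_assoc, norm_mul Complex.I, Complex.norm_I, one_mul])

theorem norm_derivL (a : ℕ → ℂ) (h) :
    ‖derivL a h‖ = seqNorm (invK a) / 2 := by
  have e : ∀ k, ‖derivL a h k‖ = ‖invK a k‖ := fun k => by
    simp only [derivL, l1Mk_apply]
    rw [invK, mul_assoc, norm_mul Complex.I, Complex.norm_I, one_mul]
  rw [l1_norm_eq, seqNorm, (l1_summable _).tsum_eq_zero_add]
  simp only [e]
  simp [invK]

theorem norm_le_half_norm_derivL (c : L1) (h) (h0 : c 0 = 0) (h1 : c 1 = 0) :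
    ‖c‖ ≤ ‖derivL c h‖ / 2 := by
  rw [l1_norm_eq (derivL c h), ← tsum_div_const]
  refine l1_norm_le_of_apply_le ((l1_summable _).div_const 2) fun k => ?_
  simp only [derivL, l1Mk_apply, norm_mul, Complex.norm_I, one_mul, Complex.norm_natCast]
  obtain rfl | rfl | hk : k = 0 ∨ k = 1 ∨ 2 ≤ k := by omega
  · simp [h0]
  · simp [h1]
  · have : (2 : ℝ) ≤ k := by exact_mod_cast hk
    have := mul_le_mul_of_nonneg_right this (norm_nonneg (c k))
    linarith

namespace IsHopfZero

variable {ε α ω : ℝ} {c : L1}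

theorem norm_derivL_le (h : IsHopfZero ε α ω c) : ‖derivL c h.summable_invK‖ ≤ 0.16 := by
  rw [norm_derivL]
  linarith [h.invK_bound]

theorem norm_le (h : IsHopfZero ε α ω c) : ‖c‖ ≤ 0.08 :=
  (norm_le_half_norm_derivL c h.summable_invK h.coeff_zero h.coeff_one).trans
    (by linarith [h.norm_derivL_le])

theorem summable_invK_coef (h : IsHopfZero ε α ω c) :
    Summable fun k : ℕ => ‖invK (ε • (unitOne + c) : L1) k‖ := by
  have h1 : Summable fun k : ℕ => ‖invK unitOne k‖ := by
    refine summable_of_ne_finset_zero (s := {1}) fun k hk => ?_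
    have : k ≠ 1 := by simpa using hk
    simp [invK, unitOne_apply, basisSeq, this]
  refine Summable.of_nonneg_of_le (fun _ => norm_nonneg _) (fun k => ?_)
    ((h1.add h.summable_invK).mul_left |ε|)
  have e : invK (ε • (unitOne + c) : L1) k = ε * (invK unitOne k + invK c k) := by
    simp only [invK, l1_real_smul_apply, l1_add_apply]; ring
  rw [e, norm_mul, Complex.norm_real, Real.norm_eq_abs]
  exact mul_le_mul_of_nonneg_left (norm_add_le _ _) (abs_nonneg _)

theorem solvesWright (h : IsHopfZero ε α ω c) (hε : ε ∈ Ioc (0 : ℝ) 0.1) :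
    SolvesWright α (hopfFun ε ω c) := by
  set a : L1 := ε • (unitOne + c) with ha
  have hb : ∀ k, derivL a h.summable_invK_coef k = Complex.I * k * a k := fun k => rfl
  have hs : ‖a‖ < 1 / 2 := by
    rw [ha, norm_smul, Real.norm_of_nonneg hε.1.le]
    have h1 : ‖unitOne + c‖ ≤ 1.08 := by
      refine (norm_add_le _ _).trans ?_
      rw [norm_unitOne]; linarith [h.norm_le]
    have : ε * ‖unitOne + c‖ ≤ 0.1 * 1.08 := mul_le_mul hε.2 h1 (norm_nonneg _) (by norm_num)
    linarith
  have hsol := fSeries_solves (α := α) (ω := ω) hb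
    (by simp [ha, unitOne_apply, basisSeq, h.coeff_zero]) hs (fun n => by
      rw [ha, modeZ_eq_mapF, h.zero _ (by omega), mul_zero])
  intro t
  have hd := (hasDerivAt_fSeries hb (ω * t)).comp t ((hasDerivAt_id t).const_mul ω)
  have e : hopfFun ε ω c = fSeries a ∘ fun t => ω * id t := funext fun t => hopfFun_eq ε ω c t
  have e2 : -α * hopfFun ε ω c (t - 1) * (1 + hopfFun ε ω c t) =
      fSeries (derivL a h.summable_invK_coef) (ω * t) * (ω * 1) := by
    rw [hopfFun_eq, hopfFun_eq, mul_sub, mul_one]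
    linear_combination -hsol (ω * t)
  rw [e2, e]
  exact hd

/-- The zeros of `F` give slowly oscillating periodic solutions. -/
theorem isSOPS (h : IsHopfZero ε α ω c) (hε : ε ∈ Ioc (0 : ℝ) 0.1) :
    IsSOPS α ω (hopfFun ε ω c) := by
  obtain ⟨p1, p2⟩ := pi_bounds
  have hωn := abs_lt.1 h.omega_near
  have e2 : ε ^ 2 ≤ 0.01 := by nlinarith [hε.1, hε.2]
  rw [approxOmega] at hωn
  have hω1 : 1.5 < ω := by linarith
  have hω2 : ω < 1.6 := by linarith [sq_nonneg ε]
  have hω0 : 0 < ω := by linarith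
  refine ⟨hω0, h.solvesWright hε, ?_⟩
  set d := derivL c h.summable_invK with hd
  have hdn : ‖d‖ ≤ 0.16 := h.norm_derivL_le
  have hcn : ‖c‖ ≤ 0.08 := h.norm_le
  -- The solution divided by `2ε` is the cosine plus half the series of `c`. The perturbation is at
  -- most `‖c‖ ≤ 0.08`, and its derivative at most `‖d‖ ≤ 0.16`.
  obtain ⟨a, b, hab1, hab2, hp, hn⟩ := exists_signs_of_near_cos
    (g := fun s => Real.cos s + fSeries c s / 2) (g' := fun s => -Real.sin s + fSeries d s / 2)
    (fun s => (Real.hasDerivAt_cos s).add ((hasDerivAt_fSeries (b := d) (fun k => rfl) s).div_const 2))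
    (fun s => by rw [Real.cos_add_two_pi, fSeries_add_two_pi])
    (fun s => by
      rw [add_sub_cancel_left, abs_div, abs_two]
      linarith [abs_fSeries_le c s])
    (fun s => by
      rw [neg_add_eq_sub, sub_add_cancel, abs_div, abs_two]
      linarith [abs_fSeries_le d s])
  have hval : ∀ t, hopfFun ε ω c t = 2 * ε * (Real.cos (ω * t) + fSeries c (ω * t) / 2) :=
    fun t => by rw [hopfFun_eq, fSeries_smul_unitOne_add]; ring
  have hε2 : 0 < 2 * ε := by linarith [hε.1]
  have hsum : (2 * Real.pi - (b - a)) / ω + (b - a) / ω = 2 * Real.pi / ω := by ring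
  refine ⟨a / ω, (2 * Real.pi - (b - a)) / ω, (b - a) / ω, ?_, ?_, hsum, fun t ht => ?_,
    fun t ht => ?_, fun t => ?_⟩
  -- Both sign intervals are longer than `π - 0.6 > 1.6 > ω` in rescaled time, hence longer than 1
  -- in the original time.
  · rw [lt_div_iff₀ hω0]; linarith
  · rw [lt_div_iff₀ hω0]; linarith
  · rw [hval]
    have e : ω * (t + a / ω) = ω * t + a := by field_simp
    refine mul_pos hε2 (hp _ ?_)
    obtain ⟨t1, t2⟩ := ht
    rw [lt_div_iff₀ hω0] at t2
    rw [e]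
    constructor <;> nlinarith
  · rw [hval]
    have e : ω * (t + a / ω) = ω * t + a := by field_simp
    refine mul_neg_of_pos_of_neg hε2 (hn _ ?_)
    obtain ⟨t1, t2⟩ := ht
    rw [← neg_div, div_lt_iff₀ hω0] at t1
    rw [e]
    constructor <;> nlinarith
  · rw [hsum, hopfFun_eq, hopfFun_eq, mul_add, mul_div_cancel₀ _ hω0.ne', fSeries_add_two_pi]

end IsHopfZero

/-! ### Fourier coefficients of small periodic solutions -/

/-- The Fourier coefficients of a `2π`-periodic real function. -/
def fcoef (u : ℝ → ℝ) (k : ℤ) : ℂ :=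
  1 / (2 * Real.pi) * ∫ s in (0 : ℝ)..2 * Real.pi, Complex.exp (-Complex.I * k * s) * u s

theorem norm_exp_neg_I_mul_int (k : ℤ) (s : ℝ) : ‖Complex.exp (-Complex.I * k * s)‖ = 1 := by
  rw [Complex.norm_exp]; simp

theorem exp_neg_I_mul_int_two_pi (k : ℤ) :
    Complex.exp (-Complex.I * k * ((2 * Real.pi : ℝ) : ℂ)) = 1 := by
  rw [Complex.exp_eq_one_iff]
  exact ⟨-k, by push_cast; ring⟩

theorem intervalIntegral_conj (f : ℝ → ℂ) (a b : ℝ) :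
    ∫ s in a..b, (starRingEnd ℂ) (f s) = (starRingEnd ℂ) (∫ s in a..b, f s) := by
  rw [intervalIntegral, intervalIntegral, integral_conj, integral_conj, map_sub]

theorem fcoef_neg (u : ℝ → ℝ) (k : ℤ) : fcoef u (-k) = (starRingEnd ℂ) (fcoef u k) := by
  rw [fcoef, fcoef, map_mul, ← intervalIntegral_conj]
  congr 1
  · have : (1 / (2 * Real.pi) : ℂ) = ((1 / (2 * Real.pi) : ℝ) : ℂ) := by push_cast; rfl
    rw [this, Complex.conj_ofReal]
  · refine intervalIntegral.integral_congr fun s _ => ?_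
    simp only [map_mul, ← Complex.exp_conj, Complex.conj_ofReal]
    congr 2
    simp

theorem norm_fcoef_le {u : ℝ → ℝ} {M : ℝ} (h : ∀ s, |u s| ≤ M) (k : ℤ) : ‖fcoef u k‖ ≤ M := by
  have h1 := intervalIntegral.norm_integral_le_of_norm_le_const (a := 0) (b := 2 * Real.pi)
    (f := fun s => Complex.exp (-Complex.I * k * s) * u s) (C := M) (fun s _ => by
      rw [norm_mul, norm_exp_neg_I_mul_int, one_mul, Complex.norm_real]; exact h s)
  have hp := Real.two_pi_pos
  rw [sub_zero, abs_of_pos hp] at h1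
  rw [fcoef, norm_mul]
  have e : ‖(1 / (2 * Real.pi) : ℂ)‖ = 1 / (2 * Real.pi) := by
    have : (1 / (2 * Real.pi) : ℂ) = ((1 / (2 * Real.pi) : ℝ) : ℂ) := by push_cast; rfl
    rw [this, Complex.norm_real, Real.norm_of_nonneg (by positivity)]
  rw [e, div_mul_eq_mul_div, one_mul, div_le_iff₀ hp]
  exact h1

theorem continuous_exp_mul {u : ℝ → ℝ} (h : Continuous u) (k : ℤ) :
    Continuous fun s : ℝ => Complex.exp (-Complex.I * k * s) * u s := by fun_prop

theorem fcoef_sub {u v : ℝ → ℝ} (hu : Continuous u) (hv : Continuous v) (k : ℤ) :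
    fcoef u k - fcoef v k = fcoef (fun s => u s - v s) k := by
  rw [fcoef, fcoef, fcoef, ← mul_sub, ← intervalIntegral.integral_sub
    ((continuous_exp_mul hu k).intervalIntegrable _ _)
    ((continuous_exp_mul hv k).intervalIntegrable _ _)]
  congr 2; funext s; push_cast; ring

theorem fcoef_deriv {u u' : ℝ → ℝ} (h : ∀ s, HasDerivAt u (u' s) s) (hc : Continuous u')
    (hper : ∀ s, u (s + 2 * Real.pi) = u s) (k : ℤ) :
    fcoef u' k = Complex.I * k * fcoef u k := by
  have hu : Continuous u := continuous_iff_continuousAt.2 fun s => (h s).continuousAt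
  have hd : ∀ s : ℝ, HasDerivAt (fun s : ℝ => Complex.exp (-Complex.I * k * s) * u s)
      (Complex.exp (-Complex.I * k * s) * u' s
        - Complex.I * k * (Complex.exp (-Complex.I * k * s) * u s)) s := fun s => by
    have h1 : HasDerivAt (fun w : ℝ => -Complex.I * (k : ℂ) * (w : ℂ))
        (-Complex.I * (k : ℂ) * 1) s := (Complex.ofRealCLM.hasDerivAt (x := s)).const_mul _
    have h2 := h1.cexp.mul (h s).ofReal_comp
    have e : Complex.exp (-Complex.I * k * s) * u' s
        - Complex.I * k * (Complex.exp (-Complex.I * k * s) * u s) =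
        Complex.exp (-Complex.I * k * s) * (-Complex.I * k * 1) * u s
          + Complex.exp (-Complex.I * k * s) * u' s := by ring
    rw [e]
    exact h2
  have i1 := (continuous_exp_mul hc k).intervalIntegrable (μ := MeasureTheory.volume)
    0 (2 * Real.pi)
  have i2 := ((continuous_exp_mul hu k).const_mul (Complex.I * k)).intervalIntegrable
    (μ := MeasureTheory.volume) 0 (2 * Real.pi)
  have hint := intervalIntegral.integral_eq_sub_of_hasDerivAt (a := 0) (b := 2 * Real.pi)
    (fun s _ => hd s) (i1.sub i2)
  have hp := hper 0
  rw [zero_add] at hp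
  rw [intervalIntegral.integral_sub i1 i2, intervalIntegral.integral_const_mul,
    exp_neg_I_mul_int_two_pi, hp] at hint
  simp only [Complex.ofReal_zero, mul_zero, Complex.exp_zero, sub_self] at hint
  rw [fcoef, fcoef]
  linear_combination (1 / (2 * Real.pi) : ℂ) * hint

theorem hasSum_fcoef {u : ℝ → ℝ} (hc : Continuous u) (hper : ∀ s, u (s + 2 * Real.pi) = u s)
    (hs : Summable fun k => ‖fcoef u k‖) (s : ℝ) :
    HasSum (fun k : ℤ => fcoef u k * Complex.exp (Complex.I * k * s)) (u s) := by
  have : Fact (0 < 2 * Real.pi) := ⟨Real.two_pi_pos⟩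
  have hpi : (Real.pi : ℂ) ≠ 0 := by exact_mod_cast Real.pi_ne_zero
  let U : ℝ → ℂ := fun s => u s
  have hU : Function.Periodic U (2 * Real.pi) := fun s => by simp only [U, hper]
  let F : C(AddCircle (2 * Real.pi), ℂ) := ⟨hU.lift, continuous_coinduced_dom.2 (by
    change Continuous U
    fun_prop)⟩
  have hF : ∀ x : ℝ, F (x : AddCircle (2 * Real.pi)) = u x := fun x => hU.lift_coe x
  have hcoef : fourierCoeff F = fcoef u := by
    funext k
    rw [fourierCoeff_eq_intervalIntegral _ k 0, fcoef, zero_add, Complex.real_smul]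
    congr 1
    · push_cast; rfl
    · refine intervalIntegral.integral_congr fun x _ => ?_
      simp only [hF, smul_eq_mul, fourier_coe_apply]
      congr 2
      push_cast
      field_simp
  have h := has_pointwise_sum_fourier_series_of_summable (f := F) (by rw [hcoef]; exact hs.of_norm)
    (s : AddCircle (2 * Real.pi))
  rw [hF, hcoef] at h
  refine h.congr_apply fun k => ?_
  rw [fourier_coe_apply, smul_eq_mul]
  congr 2
  push_cast
  field_simp

theorem integral_exp_int_mul (m : ℤ) : ∫ s in (0 : ℝ)..2 * Real.pi, Complex.exp (Complex.I * m * s)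
    = if m = 0 then (2 * Real.pi : ℂ) else 0 := by
  split_ifs with h
  · subst h; simp
  · have hm : Complex.I * m ≠ 0 := mul_ne_zero Complex.I_ne_zero (by exact_mod_cast h)
    rw [integral_exp_mul_complex hm]
    have : Complex.exp (Complex.I * m * ((2 * Real.pi : ℝ) : ℂ)) = 1 := by
      rw [Complex.exp_eq_one_iff]
      exact ⟨m, by push_cast; ring⟩
    rw [this]; simp

/-- Uniqueness of absolutely convergent Fourier series. -/
theorem eq_zero_of_hasSum_exp {g : ℤ → ℂ} (hg : Summable fun k => ‖g k‖)
    (h : ∀ s : ℝ, HasSum (fun k : ℤ => g k * Complex.exp (Complex.I * k * s)) 0) (n : ℤ) :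
    g n = 0 := by
  have h1 := intervalIntegral.hasSum_integral_of_dominated_convergence
    (μ := MeasureTheory.volume) (a := 0) (b := 2 * Real.pi)
    (F := fun (k : ℤ) (s : ℝ) => g k * Complex.exp (Complex.I * ((k - n : ℤ) : ℂ) * s))
    (f := fun _ => (0 : ℂ))
    (fun k _ => ‖g k‖)
    (fun k => (by fun_prop : Continuous fun s : ℝ =>
      g k * Complex.exp (Complex.I * ((k - n : ℤ) : ℂ) * s)).aestronglyMeasurable)
    (fun k => MeasureTheory.ae_of_all _ fun s _ => by rw [norm_mul, norm_exp_I_mul_int, mul_one])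
    (MeasureTheory.ae_of_all _ fun s _ => hg) intervalIntegrable_const
    (MeasureTheory.ae_of_all _ fun s _ => by
      have := (h s).mul_left (Complex.exp (-Complex.I * n * s))
      rw [mul_zero] at this
      refine this.congr_apply fun k => ?_
      rw [mul_left_comm, ← Complex.exp_add]
      congr 2; push_cast; ring)
  simp only [intervalIntegral.integral_const_mul, integral_exp_int_mul,
    intervalIntegral.integral_zero] at h1
  have h2 := hasSum_single (f := fun k : ℤ => g k * if k - n = 0 then (2 * Real.pi : ℂ) else 0) n
    (fun k hk => by simp [sub_ne_zero.2 hk])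
  have h3 := h1.unique h2
  have hpi : (2 * Real.pi : ℂ) ≠ 0 := by exact_mod_cast Real.two_pi_pos.ne'
  simp only [sub_self, if_true] at h3
  exact (mul_eq_zero.1 h3.symm).resolve_right hpi

/-- A `2π`-periodic solution, small and in rescaled time, of the equation. -/
structure PerWright (β ω : ℝ) (u : ℝ → ℝ) : Prop where
  pos : 0 < β
  le_two : β ≤ 2
  deriv : ∀ s, HasDerivAt u (-β * u (s - ω) * (1 + u s)) s
  periodic : ∀ s, u (s + 2 * Real.pi) = u s
  bound : ∀ s, |u s| ≤ 1 / 2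

namespace PerWright

variable {β ω : ℝ} {u : ℝ → ℝ}

theorem continuous (h : PerWright β ω u) : Continuous u :=
  continuous_iff_continuousAt.2 fun s => (h.deriv s).continuousAt

/-- `(log (1 + u))' = -β u(· - ω)` integrates to 0 over a period, and a delay does not change the
mean. -/
theorem fcoef_zero (h : PerWright β ω u) : fcoef u 0 = 0 := by
  have hpos : ∀ s, 0 < 1 + u s := fun s => by linarith [(abs_le.1 (h.bound s)).1]
  have hl : ∀ s, HasDerivAt (fun s => Real.log (1 + u s)) (-β * u (s - ω)) s := fun s => by
    have h1 := ((h.deriv s).const_add 1).log (hpos s).ne'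
    rwa [mul_div_assoc, div_self (hpos s).ne', mul_one] at h1
  have hc := h.continuous
  have hc' : Continuous fun s => -β * u (s - ω) := by fun_prop
  have h1 := intervalIntegral.integral_eq_sub_of_hasDerivAt (a := 0) (b := 2 * Real.pi)
    (fun s _ => hl s) (hc'.intervalIntegrable _ _)
  have hp := h.periodic 0
  rw [zero_add] at hp
  rw [hp, sub_self, intervalIntegral.integral_const_mul, mul_eq_zero,
    or_iff_right (neg_ne_zero.2 h.pos.ne'),
    intervalIntegral.integral_comp_sub_right (fun s => u s)] at h1
  have h2 := Function.Periodic.intervalIntegral_add_eq (f := u) (T := 2 * Real.pi) h.periodic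
    (0 - ω) 0
  rw [zero_add, show 0 - ω + 2 * Real.pi = 2 * Real.pi - ω by ring, h1] at h2
  rw [fcoef]
  simp only [Int.cast_zero, mul_zero, zero_mul, Complex.exp_zero, one_mul,
    intervalIntegral.integral_ofReal, ← h2, Complex.ofReal_zero]

/-- The equation expresses derivatives through values: from `|u| ≤ 1/2` and `β ≤ 2` one gets the
bounds `3/2`, `6`, `33` of the first three, and three integrations by parts give the decay. Cubic
decay, uniform over all such solutions, makes `∑ k |a_k|` controllable by uniform closeness. -/
theorem pow_mul_norm_fcoef_le (h : PerWright β ω u) (k : ℤ) :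
    |(k : ℝ)| ^ 3 * ‖fcoef u k‖ ≤ 33 := by
  have hu := h.continuous
  have hb := h.le_two
  have hb0 := h.pos
  let u1 : ℝ → ℝ := fun s => -β * u (s - ω) * (1 + u s)
  let u2 : ℝ → ℝ := fun s => -β * (u1 (s - ω) * (1 + u s) + u (s - ω) * u1 s)
  let u3 : ℝ → ℝ := fun s => -β * (u2 (s - ω) * (1 + u s) + u1 (s - ω) * u1 s
    + (u1 (s - ω) * u1 s + u (s - ω) * u2 s))
  have c1 : Continuous u1 := by simp only [u1]; fun_prop
  have c2 : Continuous u2 := by simp only [u2]; fun_prop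
  have c3 : Continuous u3 := by simp only [u3]; fun_prop
  have d0 : ∀ s, HasDerivAt u (u1 s) s := h.deriv
  have d0' : ∀ s, HasDerivAt (fun s => u (s - ω)) (u1 (s - ω)) s := fun s =>
    (d0 _).comp_sub_const s ω
  have d1 : ∀ s, HasDerivAt u1 (u2 s) s := fun s => by
    have h1 := ((d0' s).mul ((d0 s).const_add 1)).const_mul (-β)
    have e : u1 = fun y => -β * (u (y - ω) * (1 + u y)) := by
      funext x; simp only [u1]; ring
    rw [e]
    exact h1
  have d1' : ∀ s, HasDerivAt (fun s => u1 (s - ω)) (u2 (s - ω)) s := fun s =>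
    (d1 _).comp_sub_const s ω
  have d2 : ∀ s, HasDerivAt u2 (u3 s) s := fun s =>
    (((d1' s).mul ((d0 s).const_add 1)).add ((d0' s).mul (d1 s))).const_mul (-β)
  have p0 := h.periodic
  have p0' : ∀ s, u (s + 2 * Real.pi - ω) = u (s - ω) := fun s => by
    rw [← p0 (s - ω)]; congr 1; ring
  have p1 : ∀ s, u1 (s + 2 * Real.pi) = u1 s := fun s => by simp only [u1, p0, p0']
  have p1' : ∀ s, u1 (s + 2 * Real.pi - ω) = u1 (s - ω) := fun s => by
    rw [← p1 (s - ω)]; congr 1; ring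
  have p2 : ∀ s, u2 (s + 2 * Real.pi) = u2 s := fun s => by simp only [u2, p0, p0', p1, p1']
  have b0 := h.bound
  have b0' : ∀ s, |1 + u s| ≤ 3 / 2 := fun s => by
    have := abs_le.1 (b0 s)
    rw [abs_le]; constructor <;> linarith
  have b1 : ∀ s, |u1 s| ≤ 3 / 2 := fun s => by
    simp only [u1, abs_mul, abs_neg, abs_of_pos hb0]
    calc β * |u (s - ω)| * |1 + u s| ≤ 2 * (1 / 2) * (3 / 2) := by
          gcongr
          · exact b0 _
          · exact b0' _
      _ = 3 / 2 := by norm_num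
  have b2 : ∀ s, |u2 s| ≤ 6 := fun s => by
    simp only [u2, abs_mul, abs_neg, abs_of_pos hb0]
    have e1 : |u1 (s - ω) * (1 + u s)| ≤ 3 / 2 * (3 / 2) := by
      rw [abs_mul]; exact mul_le_mul (b1 _) (b0' _) (abs_nonneg _) (by norm_num)
    have e2 : |u (s - ω) * u1 s| ≤ 1 / 2 * (3 / 2) := by
      rw [abs_mul]; exact mul_le_mul (b0 _) (b1 _) (abs_nonneg _) (by norm_num)
    calc β * |u1 (s - ω) * (1 + u s) + u (s - ω) * u1 s| ≤
        2 * (3 / 2 * (3 / 2) + 1 / 2 * (3 / 2)) := by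
          gcongr
          exact (abs_add_le _ _).trans (add_le_add e1 e2)
      _ = 6 := by norm_num
  have b3 : ∀ s, |u3 s| ≤ 33 := fun s => by
    simp only [u3, abs_mul, abs_neg, abs_of_pos hb0]
    have e1 : |u2 (s - ω) * (1 + u s)| ≤ 6 * (3 / 2) := by
      rw [abs_mul]; exact mul_le_mul (b2 _) (b0' _) (abs_nonneg _) (by norm_num)
    have e2 : |u1 (s - ω) * u1 s| ≤ 3 / 2 * (3 / 2) := by
      rw [abs_mul]; exact mul_le_mul (b1 _) (b1 _) (abs_nonneg _) (by norm_num)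
    have e3 : |u (s - ω) * u2 s| ≤ 1 / 2 * 6 := by
      rw [abs_mul]; exact mul_le_mul (b0 _) (b2 _) (abs_nonneg _) (by norm_num)
    refine (mul_le_mul hb ((abs_add_le _ _).trans (add_le_add ((abs_add_le _ _).trans
      (add_le_add e1 e2)) ((abs_add_le _ _).trans (add_le_add e2 e3)))) (abs_nonneg _)
      (by norm_num)).trans (by norm_num)
  have e : fcoef u3 k = (Complex.I * k) ^ 3 * fcoef u k := by
    rw [fcoef_deriv d2 c3 p2, fcoef_deriv d1 c2 p1, fcoef_deriv d0 c1 p0]; ring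
  have h1 := norm_fcoef_le b3 k
  rw [e, norm_mul, norm_pow, norm_mul, Complex.norm_I, one_mul, Complex.norm_intCast] at h1
  exact h1

theorem summable_fcoef (h : PerWright β ω u) : Summable fun k : ℕ => (k : ℝ) * ‖fcoef u k‖ := by
  have hs : Summable fun k : ℕ => 33 * (1 / (k : ℝ) ^ 2) :=
    (Real.summable_one_div_nat_pow.2 one_lt_two).mul_left 33
  refine Summable.of_nonneg_of_le (fun k => by positivity) (fun k => ?_) hs
  obtain rfl | hk := Nat.eq_zero_or_pos k
  · simp
  have hk' : (0 : ℝ) < k := by exact_mod_cast hk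
  have h1 := h.pow_mul_norm_fcoef_le k
  rw [Int.cast_natCast, abs_of_pos hk'] at h1
  rw [mul_one_div, le_div_iff₀ (by positivity)]
  nlinarith

/-- The coefficients of index `k ≥ 0` as an element of `ℓ¹`. -/
def coefL (h : PerWright β ω u) : L1 := l1Mk (fun k : ℕ => fcoef u k) (by
  refine Summable.of_nonneg_of_le (fun _ => norm_nonneg _) (fun k => ?_) h.summable_fcoef
  obtain rfl | hk := Nat.eq_zero_or_pos k
  · simp [h.fcoef_zero]
  · have hk' : (1 : ℝ) ≤ k := by exact_mod_cast hk
    exact le_mul_of_one_le_left (norm_nonneg _) hk')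

theorem coefL_apply (h : PerWright β ω u) (k : ℕ) : h.coefL k = fcoef u k := rfl

theorem symExt_coefL (h : PerWright β ω u) (k : ℤ) : symExt h.coefL k = fcoef u k := by
  rcases lt_trichotomy k 0 with hk | rfl | hk
  · obtain ⟨n, rfl⟩ : ∃ n : ℕ, k = -((n : ℤ) + 1) := ⟨(-k - 1).toNat, by omega⟩
    rw [symExt_neg, symExt_natCast_succ, coefL_apply, fcoef_neg]; push_cast; rfl
  · rw [symExt_zero, h.fcoef_zero]
  · obtain ⟨n, rfl⟩ : ∃ n : ℕ, k = (n : ℤ) + 1 := ⟨(k - 1).toNat, by omega⟩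
    rw [symExt_natCast_succ, coefL_apply]; push_cast; rfl

theorem eq_fSeries (h : PerWright β ω u) (s : ℝ) : u s = fSeries h.coefL s := by
  have hs := summable_norm_symExt h.coefL
  simp only [h.symExt_coefL] at hs
  have h1 := hasSum_fcoef h.continuous h.periodic hs s
  have h2 := hasSum_fSeries h.coefL s
  simp only [h.symExt_coefL] at h2
  exact_mod_cast h1.unique h2

/-- The Fourier coefficients are the only ones. -/
theorem coefL_eq (h : PerWright β ω u) {a : L1} (ha : ∀ s, u s = fSeries a s) (h0 : a 0 = 0) :
    h.coefL = a := by
  have hz : ∀ k : ℤ, symExt h.coefL k - symExt a k = 0 := by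
    refine eq_zero_of_hasSum_exp ?_ fun s => ?_
    · refine Summable.of_nonneg_of_le (fun _ => norm_nonneg _) (fun k => norm_sub_le _ _)
        ((summable_norm_symExt h.coefL).add (summable_norm_symExt a))
    · have h1 := (hasSum_fSeries h.coefL s).sub (hasSum_fSeries a s)
      rw [← h.eq_fSeries, ← ha, sub_self] at h1
      exact h1.congr_apply fun k => by ring
  refine l1_ext fun k => ?_
  obtain rfl | hk := Nat.eq_zero_or_pos k
  · rw [h0, coefL_apply]; exact h.fcoef_zero
  · obtain ⟨n, rfl⟩ : ∃ n, k = n + 1 := ⟨k - 1, by omega⟩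
    have := sub_eq_zero.1 (hz ((n : ℤ) + 1))
    rwa [symExt_natCast_succ, symExt_natCast_succ] at this

end PerWright

/-! ### Isolation of the branch and absence of bifurcations -/

theorem ContDiffAt.exists_local_inverse {f : ℝ → ℝ} {x : ℝ} (hf : ContDiffAt ℝ 1 f x)
    (hd : deriv f x ≠ 0) : ∃ E : ℝ → ℝ, ContDiffAt ℝ 1 E (f x) ∧ E (f x) = x ∧
      ∀ᶠ y in 𝓝 (f x), f (E y) = y := by
  have h := (hf.differentiableAt one_ne_zero).hasDerivAt.hasFDerivAt_equiv hd
  refine ⟨hf.localInverse h one_ne_zero, hf.to_localInverse h one_ne_zero,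
    hf.localInverse_apply_image h one_ne_zero, ?_⟩
  exact (hf.hasStrictFDerivAt' h one_ne_zero).eventually_right_inverse

/-- The coefficients `k c_k`, recovered from `A = (i k a_k)` where `a = ρ (e_1 + c)`. -/
def rescaled (ρ : ℝ) (A : L1) : L1 := ρ⁻¹ • (-Complex.I • A) - unitOne

/-- The open conditions that single out the zero of `F`. -/
def hopfNhd : Set (ℝ × ℝ × ℝ × L1) := {p | 0 < p.2.2.1 ∧ p.2.2.1 < 0.1 ∧
  |p.1 - approxAlpha p.2.2.1| < 0.0594 * p.2.2.1 ^ 2 ∧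
  |p.2.1 - approxOmega p.2.2.1| < 0.0260 * p.2.2.1 ^ 2 ∧
  2 * ‖opK (rescaled p.2.2.1 p.2.2.2) - approxCL p.2.2.1‖ < 0.4929 * p.2.2.1 ^ 2 ∧
  2 * ‖rescaled p.2.2.1 p.2.2.2‖ < 0.3191}

/-- All the conditions are strict and depend continuously on `(α, ω, ρ, A)`; positivity of `ρ` makes
`ρ⁻¹` continuous. In these coordinates, closeness to a solution on the branch yields the hypotheses
of `isHopfZero_unique`. -/
theorem hopfNhd_mem_nhds {p : ℝ × ℝ × ℝ × L1} (hp : p ∈ hopfNhd) : hopfNhd ∈ 𝓝 p := by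
  obtain ⟨h1, h2, h3, h4, h5, h6⟩ := hp
  have cρ : ContinuousAt (fun q : ℝ × ℝ × ℝ × L1 => q.2.2.1) p := by fun_prop
  have cα : ContinuousAt (fun q : ℝ × ℝ × ℝ × L1 => |q.1 - approxAlpha q.2.2.1|) p := by
    unfold approxAlpha; fun_prop
  have cω : ContinuousAt (fun q : ℝ × ℝ × ℝ × L1 => |q.2.1 - approxOmega q.2.2.1|) p := by
    unfold approxOmega; fun_prop
  have cA : ContinuousAt (fun q : ℝ × ℝ × ℝ × L1 => rescaled q.2.2.1 q.2.2.2) p := by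
    unfold rescaled
    have cA' : ContinuousAt (fun q : ℝ × ℝ × ℝ × L1 => -Complex.I • q.2.2.2) p := by fun_prop
    exact ((cρ.inv₀ h1.ne').smul cA').sub continuousAt_const
  have cK : ContinuousAt (fun q : ℝ × ℝ × ℝ × L1 => opK (rescaled q.2.2.1 q.2.2.2)) p :=
    opK.continuous.continuousAt.comp cA
  have cC : ContinuousAt (fun q : ℝ × ℝ × ℝ × L1 => approxCL q.2.2.1) p := by
    unfold approxCL
    have : ContinuousAt (fun q : ℝ × ℝ × ℝ × L1 => ((q.2.2.1 : ℝ) : ℂ)) p :=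
      Complex.continuous_ofReal.continuousAt.comp cρ
    exact (continuousAt_const.mul this).smul continuousAt_const
  have c2 : ∀ C : ℝ, ContinuousAt (fun q : ℝ × ℝ × ℝ × L1 => C * q.2.2.1 ^ 2) p := fun C => by
    fun_prop
  filter_upwards [continuousAt_const.eventually_lt cρ h1, cρ.eventually_lt continuousAt_const h2,
    cα.eventually_lt (c2 _) h3, cω.eventually_lt (c2 _) h4,
    (continuousAt_const.mul (cK.sub cC).norm).eventually_lt (c2 _) h5,
    (continuousAt_const.mul cA.norm).eventually_lt continuousAt_const h6] with q a1 a2 a3 a4 a5 a6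
  exact ⟨a1, a2, a3, a4, a5, a6⟩

theorem rescaled_derivL {ρ : ℝ} (hρ : ρ ≠ 0) (c : L1) (hs) (k : ℕ) :
    rescaled ρ (derivL (ρ • (unitOne + c) : L1) hs) k = k * c k := by
  have hρ' : (ρ : ℂ) ≠ 0 := by exact_mod_cast hρ
  simp only [rescaled, derivL, l1_sub_apply, l1_real_smul_apply, l1_smul_apply, l1Mk_apply,
    l1_add_apply, unitOne_apply, Complex.ofReal_inv]
  have e : (k : ℂ) * basisSeq 1 k = basisSeq 1 k := by
    rw [basisSeq]; by_cases h : k = 1 <;> simp [h]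
  field_simp
  linear_combination (-Complex.I ^ 2) * e - ((k : ℂ) * c k + basisSeq 1 k) * Complex.I_sq

theorem mem_hopfNhd_iff {α ω ρ : ℝ} (hρ : ρ ≠ 0) {c : L1} (h0 : c 0 = 0) (h1 : c 1 = 0) (hs) :
    (α, ω, ρ, derivL (ρ • (unitOne + c) : L1) hs) ∈ hopfNhd ↔ 0 < ρ ∧ ρ < 0.1 ∧
      |α - approxAlpha ρ| < 0.0594 * ρ ^ 2 ∧ |ω - approxOmega ρ| < 0.0260 * ρ ^ 2 ∧
      seqNorm (fun k => c k - approxC ρ k) < 0.4929 * ρ ^ 2 ∧ seqNorm (invK c) < 0.3191 := by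
  have e := rescaled_derivL hρ c hs
  set A := rescaled ρ (derivL (ρ • (unitOne + c) : L1) hs) with hA
  have hK : opK A = c := by
    refine l1_ext fun k => ?_
    rw [opK_apply]
    by_cases hk : 2 ≤ k
    · have : (k : ℂ) ≠ 0 := by exact_mod_cast (by omega : k ≠ 0)
      rw [if_pos hk, e]; field_simp
    · rw [if_neg hk]
      obtain rfl | rfl : k = 0 ∨ k = 1 := by omega
      · exact h0.symm
      · exact h1.symm
  have e1 : seqNorm (fun k => c k - approxC ρ k) = 2 * ‖opK A - approxCL ρ‖ := by
    rw [hK, ← seqNorm_eq_norm _ (by simp [h0, approxCL, unitTwo_apply, basisSeq])]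
    congr 1; funext k; rw [l1_sub_apply, ← approxCL_coe]
  have e2 : seqNorm (invK c) = 2 * ‖A‖ := by
    rw [← seqNorm_eq_norm _ (by simp [e])]
    congr 1; funext k; rw [e, invK]
  rw [e1, e2]
  rfl

/-- Dominated convergence as `t ↓ 0`, with majorant `M/k²`. This interpolates between uniform
smallness and cubic decay of coefficients. -/
theorem exists_tsum_mul_min_lt {M r : ℝ} (hM : 0 ≤ M) (hr : 0 < r) :
    ∃ t > 0, ∑' k : ℕ, (k : ℝ) * min t (M / (k : ℝ) ^ 3) < r := by
  have h : Tendsto (fun t : ℝ => ∑' k : ℕ, (k : ℝ) * min t (M / (k : ℝ) ^ 3)) (𝓝[>] 0)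
      (𝓝 (∑' _ : ℕ, (0 : ℝ))) := by
    refine tendsto_tsum_of_dominated_convergence (bound := fun k : ℕ => M * (1 / (k : ℝ) ^ 2))
      ((Real.summable_one_div_nat_pow.2 one_lt_two).mul_left M) (fun k => ?_) ?_
    · have hc : Continuous fun t : ℝ => (k : ℝ) * min t (M / (k : ℝ) ^ 3) := by fun_prop
      have h1 := (hc.tendsto 0).mono_left (nhdsWithin_le_nhds (s := Ioi 0))
      rwa [min_eq_left (by positivity), mul_zero] at h1
    · filter_upwards [self_mem_nhdsWithin] with t ht k
      have ht' : (0 : ℝ) < t := ht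
      rw [Real.norm_of_nonneg (by positivity)]
      obtain rfl | hk := Nat.eq_zero_or_pos k
      · simp
      · have hk' : (0 : ℝ) < k := by exact_mod_cast hk
        calc (k : ℝ) * min t (M / (k : ℝ) ^ 3) ≤ k * (M / (k : ℝ) ^ 3) := by
              gcongr; exact min_le_right _ _
          _ = M * (1 / (k : ℝ) ^ 2) := by field_simp
  rw [tsum_zero] at h
  obtain ⟨t, h1, h2⟩ := ((h.eventually_lt_const hr).and self_mem_nhdsWithin).exists
  exact ⟨t, h2, h1⟩

theorem tsum_mul_le_of_le_min {d : ℕ → ℝ} {M t : ℝ} (ht : 0 ≤ t) (hM : 0 ≤ M)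
    (hd : ∀ k, 0 ≤ d k) (h : ∀ k : ℕ, 1 ≤ k → d k ≤ min t (M / (k : ℝ) ^ 3)) :
    ∑' k : ℕ, (k : ℝ) * d k ≤ ∑' k : ℕ, (k : ℝ) * min t (M / (k : ℝ) ^ 3) := by
  have h1 : ∀ k : ℕ, (k : ℝ) * d k ≤ k * min t (M / (k : ℝ) ^ 3) := fun k => by
    obtain rfl | hk := Nat.eq_zero_or_pos k
    · simp
    · exact mul_le_mul_of_nonneg_left (h k hk) (Nat.cast_nonneg k)
  have h2 : Summable fun k : ℕ => (k : ℝ) * min t (M / (k : ℝ) ^ 3) := by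
    refine Summable.of_nonneg_of_le (fun k => by positivity) (fun k => ?_)
      ((Real.summable_one_div_nat_pow.2 one_lt_two).mul_left M)
    obtain rfl | hk := Nat.eq_zero_or_pos k
    · simp
    · have hk' : (0 : ℝ) < k := by exact_mod_cast hk
      calc (k : ℝ) * min t (M / (k : ℝ) ^ 3) ≤ k * (M / (k : ℝ) ^ 3) := by
            gcongr; exact min_le_right _ _
        _ = M * (1 / (k : ℝ) ^ 2) := by field_simp
  exact (Summable.of_nonneg_of_le (fun k => mul_nonneg (Nat.cast_nonneg k) (hd k)) h1
    h2).tsum_le_tsum h1 h2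

theorem IsPeriodicWright.perWright {α ω : ℝ} {y : ℝ → ℝ} (h : IsPeriodicWright α ω y)
    (hα : 0 < α) (h2 : α ≤ 2 * ω) (hb : ∀ s, |y (s / ω)| ≤ 1 / 2) :
    PerWright (α / ω) ω fun s => y (s / ω) := by
  obtain ⟨hω, hs, hp⟩ := h
  refine ⟨div_pos hα hω, by rwa [div_le_iff₀ hω], fun s => ?_, fun s => ?_, hb⟩
  · have h1 := (hs (s / ω)).comp s ((hasDerivAt_id s).div_const ω)
    have e : -(α / ω) * y ((s - ω) / ω) * (1 + y (s / ω)) =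
        -α * y (s / ω - 1) * (1 + y (s / ω)) * (1 / ω) := by
      rw [sub_div, div_self hω.ne']; ring
    rw [e]
    exact h1
  · show y ((s + 2 * Real.pi) / ω) = y (s / ω)
    rw [add_div, hp]

theorem IsSOPS.isPeriodicWright {α ω : ℝ} {y : ℝ → ℝ} (h : IsSOPS α ω y) :
    IsPeriodicWright α ω y := by
  obtain ⟨hω, hs, τ, tm, tp, -, -, e, -, -, hp⟩ := h
  exact ⟨hω, hs, fun t => by rw [← e, hp]⟩

namespace PerWright

variable {β β' ω ω' : ℝ} {u v : ℝ → ℝ}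

theorem norm_coefL_le (h : PerWright β ω u) {k : ℕ} (hk : 1 ≤ k) :
    ‖h.coefL k‖ ≤ 33 / (k : ℝ) ^ 3 := by
  have hk' : (0 : ℝ) < k := by exact_mod_cast hk
  have h1 := h.pow_mul_norm_fcoef_le k
  rw [Int.cast_natCast, abs_of_pos hk'] at h1
  rw [le_div_iff₀ (by positivity), mul_comm]
  exact h1

theorem norm_coefL_sub_le (h : PerWright β ω u) (h' : PerWright β' ω' v) {δ : ℝ}
    (hδ : ∀ s, |u s - v s| ≤ δ) (k : ℕ) : ‖h.coefL k - h'.coefL k‖ ≤ δ := by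
  rw [coefL_apply, coefL_apply, fcoef_sub h.continuous h'.continuous]
  exact norm_fcoef_le hδ k

/-- The bound `t` combines uniform closeness with the phase error, at most `k |φ| · 33/k³ ≤ 33 |φ|`.
The other bound adds the decay `33/k³` of the two solutions. -/
theorem norm_opUL_coefL_sub_le (h : PerWright β ω u) (h' : PerWright β' ω' v) {δ φ t : ℝ}
    (hδ : ∀ s, |u s - v s| ≤ δ) (ht : δ + 33 * |φ| ≤ t) {k : ℕ} (hk : 1 ≤ k) :
    ‖opUL φ h.coefL k - h'.coefL k‖ ≤ min t (66 / (k : ℝ) ^ 3) := by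
  have hk1 : (1 : ℝ) ≤ k := by exact_mod_cast hk
  have hk' : (0 : ℝ) < k := by linarith
  have n1 := h.norm_coefL_le hk
  have n2 := h'.norm_coefL_le hk
  have e0 : opUL φ h.coefL k = ephase φ k * h.coefL k := rfl
  refine le_min ?_ ?_
  · have e : opUL φ h.coefL k - h'.coefL k = ephase φ k * (h.coefL k - h'.coefL k)
        + (ephase φ k - ephase 0 k) * h'.coefL k := by
      rw [e0]
      have : ephase 0 k = 1 := by simp [ephase]
      rw [this]; ring
    rw [e]
    have h1 : ‖ephase φ k * (h.coefL k - h'.coefL k)‖ ≤ δ := by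
      rw [norm_mul, norm_ephase, one_mul]; exact h.norm_coefL_sub_le h' hδ k
    have h2 : ‖(ephase φ k - ephase 0 k) * h'.coefL k‖ ≤ 33 * |φ| := by
      rw [norm_mul]
      have h3 := norm_ephase_sub_le φ 0 k
      rw [sub_zero] at h3
      calc ‖ephase φ k - ephase 0 k‖ * ‖h'.coefL k‖ ≤ (k * |φ|) * (33 / (k : ℝ) ^ 3) := by gcongr
        _ = 33 * |φ| * (1 / (k : ℝ) ^ 2) := by field_simp
        _ ≤ 33 * |φ| * 1 := by
          gcongr
          rw [div_le_one (by positivity)]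
          exact one_le_pow₀ hk1
        _ = _ := mul_one _
    exact (norm_add_le_of_le h1 h2).trans ht
  · refine (norm_sub_le _ _).trans ?_
    rw [e0, norm_mul, norm_ephase, one_mul]
    refine (add_le_add n1 n2).trans (le_of_eq ?_)
    ring

theorem summable_invK_opUL (h : PerWright β ω u) (φ : ℝ) :
    Summable fun k : ℕ => ‖invK (opUL φ h.coefL) k‖ := by
  refine h.summable_fcoef.congr fun k => ?_
  rw [invK, norm_mul, Complex.norm_natCast, opUL_coe, norm_opU, coefL_apply]

theorem eq_fSeries_opUL (h : PerWright β ω u) (φ s : ℝ) :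
    fSeries (opUL φ h.coefL) s = u (s - φ) := by
  rw [h.eq_fSeries, fSeries_sub, opUL_coe]

/-- The coefficients of a translated solution satisfy the equations for the modes. -/
theorem modeZ_opUL (h : PerWright β ω u) (φ : ℝ) (n : ℤ) :
    modeZ (β * ω) ω (opUL φ h.coefL) n = 0 := by
  set b := derivL (opUL φ h.coefL) (h.summable_invK_opUL φ)
  have hb : ∀ k, b k = Complex.I * k * opUL φ h.coefL k := fun k => rfl
  refine eq_zero_of_hasSum_exp (summable_norm_modeZ _ _ hb) (fun s => ?_) n
  have h1 := hasSum_modeZ (β * ω) ω hb s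
  have e : fSeries (opUL φ h.coefL) = fun s => u (s - φ) := funext (h.eq_fSeries_opUL φ)
  have h2 := (hasDerivAt_fSeries hb s)
  rw [e] at h2
  have h3 := h2.unique ((h.deriv (s - φ)).comp_sub_const s φ)
  rw [h3, e, sub_right_comm] at h1
  convert h1 using 1
  push_cast; ring

end PerWright

theorem abs_hopfFun_le {ε α ω : ℝ} {c : L1} (h : IsHopfZero ε α ω c) (hε : ε ∈ Ioc (0 : ℝ) 0.1)
    (t : ℝ) : |hopfFun ε ω c t| ≤ 0.25 := by
  rw [hopfFun_eq]
  refine (abs_fSeries_le _ _).trans ?_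
  rw [norm_smul, Real.norm_of_nonneg hε.1.le]
  have h1 : ‖unitOne + c‖ ≤ 1.08 := by
    refine (norm_add_le _ _).trans ?_
    rw [norm_unitOne]; linarith [h.norm_le]
  have : ε * ‖unitOne + c‖ ≤ 0.1 * 1.08 := mul_le_mul hε.2 h1 (norm_nonneg _) (by norm_num)
  linarith

theorem alpha_pos_of_near {ε α ω : ℝ} (hε : ε ∈ Ioc (0 : ℝ) 0.1)
    (h1 : |α - approxAlpha ε| < 0.0594 * ε ^ 2) (h2 : |ω - approxOmega ε| < 0.0260 * ε ^ 2) :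
    0 < α ∧ α ≤ 2 * ω := by
  have e2 : ε ^ 2 ≤ 0.01 := by nlinarith [hε.1, hε.2]
  have e20 := sq_nonneg ε
  obtain ⟨p1, p2⟩ := pi_bounds
  rw [approxAlpha, abs_lt] at h1
  rw [approxOmega, abs_lt] at h2
  constructor <;> nlinarith

/-- Periodic solutions close to a solution on the branch belong to the branch. -/
theorem exists_nearby_branch {ε : ℝ} (hε : ε ∈ Ioo (0 : ℝ) 0.1) :
    ∃ r > 0, ∃ δ > 0, ∀ (α ω : ℝ) (y : ℝ → ℝ), |α - alphaB ε| < r → IsPeriodicWright α ω y →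
      |ω - omegaB ε| < δ →
      (∀ s, |y (s / ω) - hopfFun ε (omegaB ε) (coefB ε) (s / omegaB ε)| < δ) →
      ∃ ρ ∈ Ioc (0 : ℝ) 0.1, alphaB ρ = α ∧ ω = omegaB ρ ∧
        ∃ τ, ∀ t, y t = hopfFun ρ (omegaB ρ) (coefB ρ) (t + τ) := by
  have hε' : ε ∈ Ioc (0 : ℝ) 0.1 := ⟨hε.1, hε.2.le⟩
  have hz := isHopfZero_branch hε'
  have hper0 := (hz.isSOPS hε').isPeriodicWright
  set α₀ := alphaB ε
  set ω₀ := omegaB ε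
  set c₀ := coefB ε
  set a₀ : L1 := ε • (unitOne + c₀) with ha₀
  set A₀ := derivL a₀ hz.summable_invK_coef
  have hω₀ : ω₀ ≠ 0 := hper0.1.ne'
  obtain ⟨hα1, hα2⟩ := alpha_pos_of_near hε' hz.alpha_near hz.omega_near
  have hb0 : ∀ s, |hopfFun ε ω₀ c₀ (s / ω₀)| ≤ 0.25 := fun s => abs_hopfFun_le hz hε' _
  have h0 := hper0.perWright hα1 hα2 fun s => (hb0 s).trans (by norm_num)
  have ha0 : h0.coefL = a₀ := h0.coefL_eq
    (fun s => by rw [hopfFun_eq, mul_div_cancel₀ _ hω₀])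
    (by simp [ha₀, hz.coeff_zero, unitOne_apply, basisSeq])
  have hmem : (α₀, ω₀, ε, A₀) ∈ hopfNhd :=
    (mem_hopfNhd_iff hε.1.ne' hz.coeff_zero hz.coeff_one _).2
      ⟨hε.1, hε.2, hz.alpha_near, hz.omega_near, hz.c_near, hz.invK_bound⟩
  obtain ⟨r, hr, hball⟩ := Metric.mem_nhds_iff.1 (hopfNhd_mem_nhds hmem)
  have hball' : ∀ α ω ρ A, |α - α₀| < r → |ω - ω₀| < r → |ρ - ε| < r → ‖A - A₀‖ < r →
      (α, ω, ρ, A) ∈ hopfNhd := fun α ω ρ A h1 h2 h3 h4 => hball (by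
    rw [Metric.mem_ball, Prod.dist_eq, Prod.dist_eq, Prod.dist_eq, dist_eq_norm A]
    exact max_lt h1 (max_lt h2 (max_lt h3 h4)))
  obtain ⟨t, ht, hsum⟩ := exists_tsum_mul_min_lt (M := 66) (by norm_num) hr
  -- The argument is continuous at `ε > 0`. The choice `t/66` makes `33 |φ| ≤ t/2`, which with `δ ≤
  -- t/2` meets the hypothesis `δ + 33 |φ| ≤ t`.
  have harg : ∀ᶠ z : ℂ in 𝓝 (ε : ℂ), |Complex.arg z| < t / 66 := by
    have h1 : ContinuousAt (fun z => |Complex.arg z|) (ε : ℂ) :=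
      (Complex.continuousAt_arg (Complex.ofReal_mem_slitPlane.2 hε.1)).abs
    refine h1.eventually_lt continuousAt_const ?_
    rw [Complex.arg_ofReal_of_nonneg hε.1.le, abs_zero]
    positivity
  obtain ⟨δ₁, hδ₁, harg'⟩ := Metric.eventually_nhds_iff.1 harg
  refine ⟨r, hr, min (min (r / 2) (t / 2)) (min (δ₁ / 2) 0.25), by positivity,
    fun α ω y hα hy hω hclose => ?_⟩
  set δ := min (min (r / 2) (t / 2)) (min (δ₁ / 2) 0.25)
  have d1 : δ ≤ r / 2 := (min_le_left _ _).trans (min_le_left _ _)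
  have d2 : δ ≤ t / 2 := (min_le_left _ _).trans (min_le_right _ _)
  have d3 : δ ≤ δ₁ / 2 := (min_le_right _ _).trans (min_le_left _ _)
  have d4 : δ ≤ 0.25 := (min_le_right _ _).trans (min_le_right _ _)
  have hω0 : 0 < ω := hy.1
  have hin := hball' α ω ε A₀ hα (by linarith) (by simpa using hr) (by simpa using hr)
  obtain ⟨hα1', hα2'⟩ := alpha_pos_of_near hε' hin.2.2.1 hin.2.2.2.1
  have hu := hy.perWright hα1' hα2' fun s => by
    have h1 := abs_sub_abs_le_abs_sub (y (s / ω)) (hopfFun ε ω₀ c₀ (s / ω₀))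
    have := hclose s
    have := hb0 s
    linarith
  have hβ : α / ω * ω = α := div_mul_cancel₀ _ hω0.ne'
  have hδ : ∀ s, |y (s / ω) - hopfFun ε ω₀ c₀ (s / ω₀)| ≤ δ := fun s => (hclose s).le
  have ha1 : a₀ 1 = ε := by simp [ha₀, hz.coeff_one, unitOne_apply, basisSeq]
  set z := hu.coefL 1
  have hzε : ‖z - ε‖ ≤ δ := by
    have := hu.norm_coefL_sub_le h0 hδ 1
    rwa [ha0, ha1] at this
  -- Translation by the phase of the first coefficient makes that coefficient equal to its modulus
  -- `ρ`. This `ρ` is the amplitude, and `c = a/ρ - e_1` has `c 1 = 0`, which fixes the freedom of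
  -- time translation.
  set φ := Complex.arg z with hφ
  have hφt : |φ| < t / 66 := harg' (by rw [dist_eq_norm]; linarith)
  set a := opUL φ hu.coefL with ha
  set A := derivL a (hu.summable_invK_opUL φ) with hA
  have haz : a 1 = ‖z‖ := by
    have e : a 1 = ephase φ 1 * z := rfl
    rw [e, ephase]
    conv_lhs => rw [← Complex.norm_mul_exp_arg_mul_I z]
    rw [mul_left_comm, ← Complex.exp_add, ← hφ]
    have : -Complex.I * ((1 : ℕ) : ℂ) * (φ : ℂ) + φ * Complex.I = 0 := by push_cast; ring
    rw [this, Complex.exp_zero, mul_one]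
  have haz0 : a 0 = 0 := by
    have e : a 0 = ephase φ 0 * hu.coefL 0 := rfl
    rw [e, PerWright.coefL_apply]
    have := hu.fcoef_zero
    simp only [Nat.cast_zero, this, mul_zero]
  set ρ := ‖z‖ with hρ
  have hρε : |ρ - ε| ≤ δ := by
    have h1 := abs_norm_sub_norm_le z (ε : ℂ)
    rw [Complex.norm_real, Real.norm_of_nonneg hε.1.le] at h1
    exact h1.trans hzε
  have hAA : ‖A - A₀‖ < r := by
    refine lt_of_le_of_lt ?_ hsum
    rw [l1_norm_eq]
    have e : ∀ k, ‖(A - A₀) k‖ = k * ‖a k - a₀ k‖ := fun k => by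
      have : (A - A₀) k = Complex.I * k * (a k - a₀ k) := by
        change Complex.I * k * a k - Complex.I * k * a₀ k = _
        ring
      rw [this, norm_mul, norm_mul, Complex.norm_I, one_mul, Complex.norm_natCast]
    simp only [e]
    refine tsum_mul_le_of_le_min ht.le (by norm_num) (fun _ => norm_nonneg _) fun k hk => ?_
    rw [← ha0]
    exact hu.norm_opUL_coefL_sub_le h0 hδ (by linarith) hk
  have hP := hball' α ω ρ A hα (by linarith) (by linarith) hAA
  have hρ0 : 0 < ρ := hP.1
  have hρc : (ρ : ℂ) ≠ 0 := by exact_mod_cast hρ0.ne'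
  set c : L1 := ρ⁻¹ • a - unitOne with hc
  have hac : a = ρ • (unitOne + c) := by
    rw [hc, add_sub_cancel, smul_smul, mul_inv_cancel₀ hρ0.ne', one_smul]
  have hc0 : c 0 = 0 := by simp [hc, haz0, unitOne_apply, basisSeq]
  have hc1 : c 1 = 0 := by simp [hc, haz, unitOne_apply, basisSeq, hρc]
  have hinv : ∀ k, invK c k = ρ⁻¹ * invK a k - basisSeq 1 k := fun k => by
    simp only [invK, hc, l1_sub_apply, l1_real_smul_apply, unitOne_apply, basisSeq]
    by_cases hk : k = 1
    · simp [hk]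
    · simp [hk]; ring
  have hcs : Summable fun k : ℕ => ‖invK c k‖ := by
    refine Summable.of_nonneg_of_le (fun _ => norm_nonneg _) (fun k => ?_)
      (((hu.summable_invK_opUL φ).mul_left ‖(ρ : ℂ)⁻¹‖).add (l1_summable unitOne))
    have e := norm_sub_le ((ρ : ℂ)⁻¹ * invK a k) (basisSeq 1 k)
    rw [norm_mul] at e
    rw [hinv, unitOne_apply, Complex.ofReal_inv]
    exact e
  have hs' : Summable fun k : ℕ => ‖invK (ρ • (unitOne + c) : L1) k‖ := by
    rw [← hac]; exact hu.summable_invK_opUL φ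
  have hA' : A = derivL (ρ • (unitOne + c) : L1) hs' := l1_ext fun k => by
    change Complex.I * k * a k = Complex.I * k * (ρ • (unitOne + c) : L1) k
    rw [hac]
  rw [hA', mem_hopfNhd_iff hρ0.ne' hc0 hc1] at hP
  obtain ⟨-, q2, q3, q4, q5, q6⟩ := hP
  have hρm : ρ ∈ Ioc (0 : ℝ) 0.1 := ⟨hρ0, q2.le⟩
  have hzero : IsHopfZero ρ α ω c := by
    refine ⟨hc0, hc1, hcs, fun k hk => ?_, q3, q4, q5, q6⟩
    obtain ⟨n, rfl⟩ : ∃ n, k = n + 1 := ⟨k - 1, by omega⟩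
    have h1 := hu.modeZ_opUL φ ((n : ℤ) + 1)
    rw [hβ, ← ha, hac, modeZ_eq_mapF] at h1
    exact (mul_eq_zero.1 h1).resolve_left hρc
  obtain ⟨u1, u2, u3⟩ := isHopfZero_unique hρm hzero
  refine ⟨ρ, hρm, u1.symm, u2, φ / ω, fun t => ?_⟩
  rw [← u2, ← u3, hopfFun_eq, ← hac, mul_add, mul_div_cancel₀ _ hω0.ne', ha,
    hu.eq_fSeries_opUL, add_sub_cancel_right, mul_div_cancel_left₀ _ hω0.ne']

theorem hopfFun_eq_fourierFun (ε ω : ℝ) (c : L1) :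
    hopfFun ε ω c = fourierFun ω (ε • (unitOne + c) : L1) := by
  funext t; rw [hopfFun_eq, fourierFun_eq_fSeries]

/-- Since the derivative of `alphaB` is nonzero, the amplitude is locally a `C¹` function `E` of
`α`. Nearby periodic solutions lie on the branch by `exists_nearby_branch`. -/
theorem noBifurcationAt_branch {ε : ℝ} (hε : ε ∈ Ioo (0 : ℝ) 0.1) :
    NoBifurcationAt (alphaB ε) (omegaB ε) (hopfFun ε (omegaB ε) (coefB ε)) := by
  have hε' : ε ∈ Ioc (0 : ℝ) 0.1 := ⟨hε.1, hε.2.le⟩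
  have habs := abs_le_of_mem_Ioc hε'
  obtain ⟨E, hE, hEε, hEr⟩ := (contDiffAt_alphaB habs).exists_local_inverse
    (deriv_alphaB_pos hε').ne'
  obtain ⟨r, hr, δ, hδ, hnear⟩ := exists_nearby_branch hε
  have hmem : ∀ᶠ α in 𝓝 (alphaB ε), E α ∈ Ioo (0 : ℝ) 0.1 :=
    hE.continuousAt.eventually (by rw [hEε]; exact isOpen_Ioo.mem_nhds hε)
  have hev := (hE.eventually (by simp)).and (hEr.and hmem)
  obtain ⟨η₁, hη₁, hball⟩ := Metric.eventually_nhds_iff.1 hev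
  set η := min η₁ r
  have hη : 0 < η := lt_min hη₁ hr
  have hlt : ∀ α ∈ Ioo (alphaB ε - η) (alphaB ε + η), |α - alphaB ε| < η := fun α hα =>
    abs_lt.2 ⟨by linarith [hα.1], by linarith [hα.2]⟩
  have hgood : ∀ α ∈ Ioo (alphaB ε - η) (alphaB ε + η),
      ContDiffAt ℝ 1 E α ∧ alphaB (E α) = α ∧ E α ∈ Ioo (0 : ℝ) 0.1 := fun α hα =>
    hball ((hlt α hα).trans_le (min_le_left _ _))
  have hIoc : ∀ α ∈ Ioo (alphaB ε - η) (alphaB ε + η), E α ∈ Ioc (0 : ℝ) 0.1 := fun α hα =>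
    ⟨(hgood α hα).2.2.1, (hgood α hα).2.2.2.le⟩
  refine ⟨η, hη, omegaB ∘ E, fun α => E α • (unitOne + coefB (E α)), fun α hα => ?_,
    fun α hα => ?_, by simp [hEε], ?_, fun α hα => ?_, δ, hδ, fun α hα ω y hy hω hclose => ?_⟩
  · exact ((contDiffAt_omegaB (abs_le_of_mem_Ioc (hIoc α hα))).comp α
      (hgood α hα).1).contDiffWithinAt
  · have h1 : ContDiffAt ℝ 1 (fun α => coefB (E α)) α :=
      (contDiffAt_coefB (abs_le_of_mem_Ioc (hIoc α hα))).comp α (hgood α hα).1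
    exact ((hgood α hα).1.smul (contDiffAt_const.add h1)).contDiffWithinAt
  · simp only [Function.comp_apply, hEε]
    rw [hopfFun_eq_fourierFun]
  · have h1 := (isHopfZero_branch (hIoc α hα)).isSOPS (hIoc α hα)
    rw [(hgood α hα).2.1, hopfFun_eq_fourierFun] at h1
    exact h1
  · obtain ⟨ρ, hρ, h1, h2, τ, h3⟩ := hnear α ω y ((hlt α hα).trans_le (min_le_right _ _)) hy hω
      hclose
    -- Injectivity on all of `(0, 0.1]` is used, so the amplitude `ρ` need not be known to be close
    -- to `ε`.
    have e : E α = ρ := strictMonoOn_alphaB.injOn (hIoc α hα) hρ ((hgood α hα).2.1.trans h1.symm)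
    refine ⟨by simp only [Function.comp_apply, e, h2], τ, fun t => ?_⟩
    rw [h3, hopfFun_eq_fourierFun]
    simp only [Function.comp_apply, e]

end

theorem theorem4p6 :
    ∃ (αh ωh : ℝ → ℝ) (ch : ℝ → L1),
      -- the branch: for every amplitude, the unique zero in the prescribed neighbourhood
      (∀ ε ∈ Ioc (0 : ℝ) 0.1,
        IsHopfZero ε (αh ε) (ωh ε) (ch ε) ∧
          ∀ (α ω : ℝ) (c : L1), IsHopfZero ε α ω c → α = αh ε ∧ ω = ωh ε ∧ c = ch ε) ∧
      -- it consists of slowly oscillating periodic solutions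
      (∀ ε ∈ Ioc (0 : ℝ) 0.1,
        IsSOPS (αh ε) (ωh ε) (hopfFun ε (ωh ε) (ch ε))) ∧
      -- it originates from the Hopf bifurcation at parameter and frequency `π/2`
      Tendsto αh (𝓝[>] 0) (𝓝 (Real.pi / 2)) ∧
      Tendsto ωh (𝓝[>] 0) (𝓝 (Real.pi / 2)) ∧
      Tendsto ch (𝓝[>] 0) (𝓝 0) ∧
      -- it is continuously differentiable, and the parameter has positive derivative
      ContDiffOn ℝ 1 αh (Ioc 0 0.1) ∧
      ContDiffOn ℝ 1 ωh (Ioc 0 0.1) ∧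
      ContDiffOn ℝ 1 ch (Ioc 0 0.1) ∧
      (∀ ε ∈ Ioc (0 : ℝ) 0.1, 0 < derivWithin αh (Ioc 0 0.1) ε) ∧
      -- it covers the parameter range, once, and has no bifurcation point there
      (∀ α ∈ Ioc (Real.pi / 2) (Real.pi / 2 + 6.830e-3),
        ∃! ε : ℝ, ε ∈ Ioc (0 : ℝ) 0.1 ∧ αh ε = α) ∧
      (∀ ε ∈ Ioc (0 : ℝ) 0.1,
        αh ε ∈ Ioc (Real.pi / 2) (Real.pi / 2 + 6.830e-3) →
          NoBifurcationAt (αh ε) (ωh ε) (hopfFun ε (ωh ε) (ch ε))) := by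
  refine ⟨alphaB, omegaB, coefB,
    fun ε h => ⟨isHopfZero_branch h, fun α ω c hz => isHopfZero_unique h hz⟩,
    fun ε h => (isHopfZero_branch h).isSOPS h, tendsto_alphaB, tendsto_omegaB, tendsto_coefB,
    fun ε h => (contDiffAt_alphaB (abs_le_of_mem_Ioc h)).contDiffWithinAt,
    fun ε h => (contDiffAt_omegaB (abs_le_of_mem_Ioc h)).contDiffWithinAt,
    fun ε h => (contDiffAt_coefB (abs_le_of_mem_Ioc h)).contDiffWithinAt,
    fun ε h => ?_, fun α h => existsUnique_alphaB h,
    fun ε h hα => noBifurcationAt_branch ⟨h.1, lt_tenth_of_alphaB_le h hα.2⟩⟩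
  rw [derivWithin_alphaB h]
  exact deriv_alphaB_pos h
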